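/- **Conventions.** Let $A=(a_{ij})_{i,j\in I}$ be a generalized Cartan matrix with Weyl group $W$, simple roots $\alpha_i$, root lattice $Q=\bigoplus_i\mathbb Z\alpha_i$, and simple reflections $s_i(\alpha_j)=\alpha_j-a_{ij}\alpha_i$; let $T$ be the torus with coordinates $\alpha_i(t)\in\mathbb C^\times$ $(i\in I)$. A *geometric crystal* for $A$ on a variety $X$ consists of rational functions $\gamma_i,\varepsilon_i$ on $X$ and rational $\mathbb C^\times$-actions $e_i:\mathbb C^\times\times X\to X$, $(c,x)\mapsto e_i^c(x)$ $(i\in I)$, such that, as rational functions and maps, 1. $(\{1\}\times X)\cap\mathrm{dom}(e_i)$ is open and dense in $\{1\}\times X$; 2. $\gamma_j(e_i^c(x))=c^{a_{ij}}\gamma_j(x)$; 3. if $\mathbf i=(i_1,\dots,i_l)$ and $\mathbf i'$ are reduced expressions of the same $w\in W$, then $e_{\mathbf i}=e_{\mathbf i'}$, where $e_{\mathbf i}^t=e_{i_1}^{\alpha^{(1)}(t)}\cdots e_{i_l}^{\alpha^{(l)}(t)}$ for $t\in T$ and $\alpha^{(j)}=s_{i_l}\cdots s_{i_{j+1}}(\alpha_{i_j})$;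 4. $\varepsilon_i(e_i^c(x))=c^{-1}\varepsilon_i(x)$. Put $\varphi_i=\gamma_i\varepsilon_i$. The product of two sets of such data on $X$ and $Y$ is given on $X\times Y$ by $$\gamma_i(x,y)=\gamma_i(x)\gamma_i(y),\qquad \varepsilon_i(x,y)=\varepsilon_i(x)+\frac{\varepsilon_i(x)\varepsilon_i(y)}{\varphi_i(x)},$$ $$e_i^c(x,y)=(e_i^{c_1}(x),e_i^{c_2}(y)),\qquad c_1=\frac{c\,\varphi_i(x)+\varepsilon_i(y)}{\varphi_i(x)+\varepsilon_i(y)},\quad c_2=\frac c{c_1},$$ and products of more factors are formed by iteration, $X_1\times\cdots\times X_k=(X_1\times\cdots\times X_{k-1})\times X_k$. **The types.** Let $\mathfrak g$ be one of the following; $I=\{0,\dots,n\}$, $a_{ii}=2$, and the non-zero off-diagonal entries $a_{ij}$ are $-1$ between neighbours in the listed diagram, except those listed as $-2$. - $A_n^{(1)}$ $(n\ge2)$: the cycle $0,1,\dots,n$. - $B_n^{(1)}$ $(n\ge2)$: the path $1,2,\dots,n$ with $0$ joined to $2$; $a_{n,n-1}=-2$, and also $a_{20}=-2$ if $n=2$.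 - $D_n^{(1)}$ $(n\ge4)$: the path $1,2,\dots,n-1$ with $0$ joined to $2$ and $n$ joined to $n-2$. - $A_{2n-1}^{(2)}$ $(n\ge3)$: the path $1,2,\dots,n$ with $0$ joined to $2$; $a_{n-1,n}=-2$. - $D_{n+1}^{(2)}$, $A_{2n}^{(2)}$, $A_{2n}^{(2)\dagger}$ $(n\ge2)$: the path $0,1,\dots,n$; with $a_{01}=a_{n,n-1}=-2$, resp. $a_{01}=a_{n-1,n}=-2$, resp. $a_{10}=a_{n,n-1}=-2$. **The geometric crystal $\mathcal V(\mathfrak g)_L$, $L\in\mathbb C^\times$.** Let $(i_1,\dots,i_m)$ be $(n,\dots,2,1)$ for $A_n^{(1)}$; $(1,\dots,n,n-1,\dots,1)$ for $B_n^{(1)}$, $A_{2n-1}^{(2)}$; $(1,\dots,n,n-2,\dots,1)$ for $D_n^{(1)}$; $(0,1,\dots,n,n-1,\dots,1)$ for the others. The variety is $(\mathbb C^\times)^m$ with coordinates $z_1,\dots,z_m$; write $x_i$ for the coordinate at the first occurrence of the letter $i$ and $\bar x_i$ for the coordinate at the second. Let $h=2$ for $D_{n+1}^{(2)}$, $A_{2n}^{(2)}$,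 $A_{2n}^{(2)\dagger}$ and $h=1$ otherwise, and put $h_1=h$, $h_0=-h$, $h_i=0$ for $i\ge2$. For all $i$, $\gamma_i(z)=L^{h_i}\prod_j z_j^{a_{i_j,i}}$. For $i\neq0$, with $\tau_r=\bigl(z_1^{a_{i_1,i}}\cdots z_{r-1}^{a_{i_{r-1},i}}z_r\bigr)^{-1}$, $$\varepsilon_i(z)=\sum_{r:\,i_r=i}\tau_r,\qquad e_i^c:\ z_j\mapsto z_j\cdot\frac{\sum_{r\le j,\,i_r=i}c\,\tau_r+\sum_{r>j,\,i_r=i}\tau_r}{\sum_{r<j,\,i_r=i}c\,\tau_r+\sum_{r\ge j,\,i_r=i}\tau_r}.$$ For $i=0$: - $A_n^{(1)}$: $\varepsilon_0=Lx_1$, and $e_0^c$ divides every coordinate by $c$. - $B_n^{(1)},D_n^{(1)},A_{2n-1}^{(2)}$: $\varepsilon_0=\varepsilon_1\circ\bar\sigma$ and $e_0^c=\bar\sigma\circ e_1^c\circ\bar\sigma$, where the involution $\bar\sigma$ divides every coordinate by $Lx_1\bar x_1$, except that for $A_{2n-1}^{(2)}$ it divides $x_n$ by $(Lx_1\bar x_1)^2$.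 - $D_{n+1}^{(2)},A_{2n}^{(2)}$: $\varepsilon_0=\dfrac{x_0^2+L^2x_1\bar x_1}{x_0^3}$; with $\rho=\dfrac{c^2x_0^2+L^2x_1\bar x_1}{c^2(x_0^2+L^2x_1\bar x_1)}$, $e_0^c$ multiplies $x_0$ by $c\rho$ and every other coordinate by $\rho$, except that for $A_{2n}^{(2)}$ it multiplies $x_n$ by $\rho^2$. - $A_{2n}^{(2)\dagger}$: $\varepsilon_0=\dfrac{(x_0+Lx_1\bar x_1)^2}{x_0^3}$; with $\rho=\dfrac{cx_0+Lx_1\bar x_1}{c(x_0+Lx_1\bar x_1)}$, $e_0^c$ multiplies $x_0$ by $c\rho^2$ and every other coordinate by $\rho$. **Theorem.** Let $\mathfrak g$ be one of the affine types above. For every $k\ge1$ and all $L_1,\dots,L_k\in\mathbb C^\times$, the product formulas make $\mathcal V(\mathfrak g)_{L_1}\times\cdots\times\mathcal V(\mathfrak g)_{L_k}$ a geometric crystal for the Cartan matrix of $\mathfrak g$. -/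

import Mathlib

open Filter

/-! ### Tori, rational functions and rational maps

The points of the torus `(ℂ^×)^ι` are the functions `ι → ℂˣ`. Rational functions and rational maps
are represented by total functions whose values off a dense Zariski open set are irrelevant;
identities between them are required on a dense Zariski open set. -/

/-- The value of a polynomial at a point of the torus `(ℂ^×)^ι`. -/
noncomputable def evalAt {ι : Type} (P : MvPolynomial ι ℂ) (x : ι → ℂˣ) : ℂ :=
  MvPolynomial.eval (fun j => (x j : ℂ)) P

/-- The filter of the subsets of the torus `(ℂ^×)^ι` that contain a nonempty (hence dense) Zariski
open set. Thus `∀ᶠ x in generic ι, p x` says that `p` holds on a dense Zariski open set. -/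
noncomputable def generic (ι : Type) : Filter (ι → ℂˣ) where
  sets := {s | ∃ Q : MvPolynomial ι ℂ, Q ≠ 0 ∧ ∀ x, evalAt Q x ≠ 0 → x ∈ s}
  univ_sets := ⟨1, one_ne_zero, fun _ _ => Set.mem_univ _⟩
  sets_of_superset := by
    rintro s t ⟨Q, hQ, h⟩ hst
    exact ⟨Q, hQ, fun x hx => hst (h x hx)⟩
  inter_sets := by
    rintro s t ⟨Q, hQ, h⟩ ⟨R, hR, h'⟩
    refine ⟨Q * R, mul_ne_zero hQ hR, fun x hx => ?_⟩
    have hx' : evalAt Q x * evalAt R x ≠ 0 := by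
      simpa [evalAt] using hx
    exact ⟨h x (left_ne_zero_of_mul hx'), h' x (right_ne_zero_of_mul hx')⟩

/-- `P t x` holds for all `(t, x)` in a dense Zariski open subset of `(ℂ^×)^κ × (ℂ^×)^ι`. -/
def Generically (κ ι : Type) (P : (κ → ℂˣ) → (ι → ℂˣ) → Prop) : Prop :=
  ∀ᶠ p in generic (κ ⊕ ι), P (p ∘ Sum.inl) (p ∘ Sum.inr)

/-- `f` represents a rational function on `(ℂ^×)^ι`. -/
def IsRationalFun {ι : Type} (f : (ι → ℂˣ) → ℂ) : Prop :=
  ∃ P Q : MvPolynomial ι ℂ, Q ≠ 0 ∧ ∀ x, evalAt Q x ≠ 0 → f x = evalAt P x / evalAt Q x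

/-- `F` represents a rational map from `(ℂ^×)^κ` to `(ℂ^×)^ι`. -/
def IsRationalMap {κ ι : Type} (F : (κ → ℂˣ) → (ι → ℂˣ)) : Prop :=
  ∀ j, IsRationalFun fun p => (F p j : ℂ)

/-- The rational map represented by `F` is regular at the point `p`, as a map to `(ℂ^×)^ι`, and
takes the value `y` there: each coordinate is generically equal to a quotient of polynomials whose
denominator does not vanish at `p` and whose value at `p` is the coordinate of `y`. -/
def HasValueAt {κ ι : Type} (F : (κ → ℂˣ) → (ι → ℂˣ)) (p : κ → ℂˣ) (y : ι → ℂˣ) : Prop :=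
  ∀ j, ∃ P Q : MvPolynomial κ ℂ, evalAt Q p ≠ 0 ∧ evalAt P p / evalAt Q p = y j ∧
    ∀ᶠ z in generic κ, (F z j : ℂ) = evalAt P z / evalAt Q z

/-- The domain of definition of the rational map represented by `F`. -/
def domainOfDefinition {κ ι : Type} (F : (κ → ℂˣ) → (ι → ℂˣ)) : Set (κ → ℂˣ) :=
  {p | ∃ y, HasValueAt F p y}

/-- A complex number as an element of `ℂ^×`, with an irrelevant value at `0`. -/
noncomputable def unitOf (z : ℂ) : ℂˣ :=
  if h : z = 0 then 1 else Units.mk0 z h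

/-! ### Weyl groups -/

/-- The order `m_ij` of `s_i s_j` as a function of `a_ij a_ji`, for `i ≠ j` (with `0` for `∞`). -/
def coxeterNumber (a : ℤ) : ℕ :=
  if a = 0 then 2 else if a = 1 then 3 else if a = 2 then 4 else if a = 3 then 6 else 0

/-- The Coxeter matrix of the Weyl group of a generalized Cartan matrix. -/
def weylCoxeterMatrix {I : Type} [DecidableEq I] (A : Matrix I I ℤ) : CoxeterMatrix I where
  M := Matrix.of fun i j => if i = j then 1 else coxeterNumber (A i j * A j i)
  isSymm := by
    ext i j
    simp only [Matrix.transpose_apply, Matrix.of_apply, eq_comm (a := j) (b := i),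
      mul_comm (A j i)]
  diagonal i := by simp
  off_diagonal i j h := by
    simp only [Matrix.of_apply, if_neg h, coxeterNumber]
    split_ifs <;> decide

/-- The simple reflection `s_j(β) = β - β(α_j^∨) α_j` on the root lattice `⨁ ℤ α_i`, where
`α_k(α_j^∨) = a_jk`. -/
def simpleReflection {I : Type} [Fintype I] [DecidableEq I] (A : Matrix I I ℤ) (j : I)
    (β : I → ℤ) : I → ℤ :=
  β - (∑ k, β k * A j k) • Pi.single j 1

/-- The character `β = ∑ β_i α_i` at the point `t` of the torus `Hom(⨁ ℤ α_i, ℂ^×)` whose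
coordinates are `t_i = α_i(t)`. -/
def character {I : Type} [Fintype I] (β : I → ℤ) (t : I → ℂˣ) : ℂˣ :=
  ∏ i, t i ^ β i

/-! ### Geometric crystals -/

/-- The data `(e_i^c, γ_i, ε_i)` of a geometric crystal on the torus `(ℂ^×)^ι`. -/
structure CrystalData (I ι : Type) where
  e : I → ℂˣ → (ι → ℂˣ) → (ι → ℂˣ)
  γ : I → (ι → ℂˣ) → ℂ
  ε : I → (ι → ℂˣ) → ℂ

namespace CrystalData

/-- `e_i` as a map from `ℂ^× × X` to `X`. -/
def eMap {I ι : Type} (D : CrystalData I ι) (i : I) (p : Unit ⊕ ι → ℂˣ) : ι → ℂˣ :=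
  D.e i (p (Sum.inl ())) (p ∘ Sum.inr)

/-- `φ_i = γ_i ε_i`. -/
def φ {I ι : Type} (D : CrystalData I ι) (i : I) (x : ι → ℂˣ) : ℂ :=
  D.γ i x * D.ε i x

/-- For a word `(i_1, …, i_l)`, the map
`e_𝐢^t = e_{i_1}^{α^{(1)}(t)} ∘ ⋯ ∘ e_{i_l}^{α^{(l)}(t)}`, where
`α^{(j)} = s_{i_l} ⋯ s_{i_{j+1}} (α_{i_j})`. -/
def eWord {I ι : Type} [Fintype I] [DecidableEq I] (D : CrystalData I ι) (A : Matrix I I ℤ) :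
    List I → (I → ℂˣ) → (ι → ℂˣ) → (ι → ℂˣ)
  | [], _, x => x
  | i :: w, t, x =>
      D.e i (character (w.foldl (fun β j => simpleReflection A j β) (Pi.single i 1)) t)
        (D.eWord A w t x)

/-- `D` is a geometric crystal for the Kac-Moody algebra with generalized Cartan matrix `A`. -/
structure IsGeometricCrystal {I ι : Type} [Fintype I] [DecidableEq I] (A : Matrix I I ℤ)
    (D : CrystalData I ι) : Prop where
  /-- The `γ_i` are rational functions. -/
  rational_γ : ∀ i, IsRationalFun (D.γ i)
  /-- The `ε_i` are rational functions. -/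
  rational_ε : ∀ i, IsRationalFun (D.ε i)
  /-- The `e_i` are rational maps. -/
  rational_e : ∀ i, IsRationalMap (D.eMap i)
  /-- `{1} × X ∩ dom(e_i)` is open and dense in `{1} × X`. -/
  domain_one : ∀ i, ∀ᶠ x in generic ι,
    (Sum.elim (fun _ => 1) x : Unit ⊕ ι → ℂˣ) ∈ domainOfDefinition (D.eMap i)
  /-- `e_i^1 = id`. -/
  e_one : ∀ i, ∀ᶠ x in generic ι, HasValueAt (D.eMap i) (Sum.elim (fun _ => 1) x) x
  /-- `e_i^c e_i^d = e_i^{cd}`. -/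
  e_mul : ∀ i, Generically (Fin 2) ι fun c x => D.e i (c 0) (D.e i (c 1) x) = D.e i (c 0 * c 1) x
  /-- `γ_j(e_i^c(x)) = c^{a_ij} γ_j(x)`. -/
  γ_e : ∀ i j, Generically Unit ι fun c x =>
    D.γ j (D.e i (c ()) x) = ((c () ^ A i j : ℂˣ) : ℂ) * D.γ j x
  /-- `e_𝐢 = e_𝐢'` if `𝐢`, `𝐢'` are reduced expressions of the same element of the Weyl group. -/
  e_word : ∀ v w : List I, (weylCoxeterMatrix A).toCoxeterSystem.IsReduced v →
    (weylCoxeterMatrix A).toCoxeterSystem.IsReduced w →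
    (weylCoxeterMatrix A).toCoxeterSystem.wordProd v =
      (weylCoxeterMatrix A).toCoxeterSystem.wordProd w →
    Generically I ι fun t x => D.eWord A v t x = D.eWord A w t x
  /-- `ε_i(e_i^c(x)) = c^{-1} ε_i(x)`. -/
  ε_e : ∀ i, Generically Unit ι fun c x =>
    D.ε i (D.e i (c ()) x) = ((c ())⁻¹ : ℂˣ) * D.ε i x

/-- The product of two geometric crystals. -/
noncomputable def prod {I ι κ : Type} (D : CrystalData I ι) (D' : CrystalData I κ) :
    CrystalData I (ι ⊕ κ) where
  γ i z := D.γ i (z ∘ Sum.inl) * D'.γ i (z ∘ Sum.inr)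
  ε i z := D.ε i (z ∘ Sum.inl) +
    D.ε i (z ∘ Sum.inl) * D'.ε i (z ∘ Sum.inr) / D.φ i (z ∘ Sum.inl)
  e i c z :=
    let x := z ∘ Sum.inl
    let y := z ∘ Sum.inr
    let c₁ := unitOf ((c * D.φ i x + D'.ε i y) / (D.φ i x + D'.ε i y))
    Sum.elim (D.e i c₁ x) (D'.e i (c / c₁) y)

end CrystalData

/-- The coordinates on a product of `k + 1` tori `(ℂ^×)^ι`. -/
def ProductIndex (ι : Type) : ℕ → Type
  | 0 => ι
  | k + 1 => ProductIndex ι k ⊕ ι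

/-- The product `V_{L_0} × ⋯ × V_{L_k}` of `k + 1` members of a family of geometric crystals. -/
noncomputable def multiProd {I ι : Type} (V : ℂˣ → CrystalData I ι) :
    (k : ℕ) → (Fin (k + 1) → ℂˣ) → CrystalData I (ProductIndex ι k)
  | 0, L => V (L 0)
  | k + 1, L => (multiProd V k fun j => L j.castSucc).prod (V (L (Fin.last (k + 1))))

/-! ### Geometric crystals on Schubert cells

For a word `w = (i_1, …, i_m)`, the point `Y_{i_1}(x_1) ⋯ Y_{i_m}(x_m) ξ` of `B_w^- ξ` is
represented by `x`. -/

/-- `1 / (x_1^{a_{i_1,i}} ⋯ x_{r-1}^{a_{i_{r-1},i}} x_r)`. -/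
noncomputable def schubertTerm {I : Type} {m : ℕ} (A : Matrix I I ℤ) (w : Fin m → I) (i : I)
    (x : Fin m → ℂˣ) (r : Fin m) : ℂ :=
  (((∏ j with j < r, x j ^ A (w j) i) * x r)⁻¹ : ℂˣ)

/-- `ε_i = ∑_{r, i_r = i} 1 / (x_1^{a_{i_1,i}} ⋯ x_{r-1}^{a_{i_{r-1},i}} x_r)`. -/
noncomputable def schubertε {I : Type} [DecidableEq I] {m : ℕ} (A : Matrix I I ℤ) (w : Fin m → I)
    (i : I) (x : Fin m → ℂˣ) : ℂ :=
  ∑ r with w r = i, schubertTerm A w i x r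

/-- `γ_i = x_1^{a_{i_1,i}} ⋯ x_m^{a_{i_m,i}} α_i(ξ)`, with `α_i(ξ)` given as `ξ i`. -/
noncomputable def schubertγ {I : Type} {m : ℕ} (A : Matrix I I ℤ) (w : Fin m → I) (ξ : I → ℂˣ)
    (i : I) (x : Fin m → ℂˣ) : ℂ :=
  ((∏ j, x j ^ A (w j) i) * ξ i : ℂˣ)

/-- The action `e_i^c`: the `j`-th coordinate is multiplied by the quotient of the sums over the
`r` with `i_r = i` of the terms of `ε_i`, where those with `r ≤ j` (in the numerator) and those
with `r < j` (in the denominator) are multiplied by `c`. -/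
noncomputable def schubertE {I : Type} [DecidableEq I] {m : ℕ} (A : Matrix I I ℤ) (w : Fin m → I)
    (i : I) (c : ℂˣ) (x : Fin m → ℂˣ) : Fin m → ℂˣ := fun j =>
  x j * unitOf
    ((∑ r with w r = i, (if r ≤ j then (c : ℂ) else 1) * schubertTerm A w i x r) /
      (∑ r with w r = i, (if r < j then (c : ℂ) else 1) * schubertTerm A w i x r))

/-! ### The affine geometric crystals -/

/-- The families of affine types, in this order: `A_n^{(1)}`, `B_n^{(1)}`, `D_n^{(1)}`,
`A_{2n-1}^{(2)}`, `D_{n+1}^{(2)}`, `A_{2n}^{(2)}`, `A_{2n}^{(2)†}`. -/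
inductive AffineType
  | A1
  | B1
  | D1
  | A2odd
  | D2
  | A2even
  | A2evenDagger

namespace AffineType

/-- The least admissible value of `n`. -/
def minRank : AffineType → ℕ
  | A1 => 2
  | B1 => 2
  | D1 => 4
  | A2odd => 3
  | D2 => 2
  | A2even => 2
  | A2evenDagger => 2

/-- The entry `a_ij` of the Cartan matrix, `0 ≤ i, j ≤ n`. For the types `B_n^{(1)}`, `D_n^{(1)}`
and `A_{2n-1}^{(2)}` the nodes `0` and `1` are not joined and are joined to the other nodes in the
same way, so the formulas use `max i 1` and `max j 1`. -/
def cartanEntry (X : AffineType) (n i j : ℕ) : ℤ :=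
  let adjacent (i j : ℕ) : ℤ := if i + 1 = j ∨ j + 1 = i then -1 else 0
  if i = j then 2 else
  match X with
  | A1 => if (i + 1) % (n + 1) = j ∨ (j + 1) % (n + 1) = i then -1 else 0
  | B1 => if max i 1 = n ∧ max j 1 + 1 = n then -2 else adjacent (max i 1) (max j 1)
  | D1 =>
      if (max i 1 = n ∧ max j 1 + 2 = n) ∨ (max i 1 + 2 = n ∧ max j 1 = n) then -1
      else if max i 1 = n ∨ max j 1 = n then 0
      else adjacent (max i 1) (max j 1)
  | A2odd => if max i 1 + 1 = n ∧ max j 1 = n then -2 else adjacent (max i 1) (max j 1)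
  | D2 => if (i = 0 ∧ j = 1) ∨ (i = n ∧ j + 1 = n) then -2 else adjacent i j
  | A2even => if (i = 0 ∧ j = 1) ∨ (i + 1 = n ∧ j = n) then -2 else adjacent i j
  | A2evenDagger => if (i = 1 ∧ j = 0) ∨ (i = n ∧ j + 1 = n) then -2 else adjacent i j

/-- The Cartan matrix `(a_ij)`, with index set `{0, 1, …, n}`. -/
def cartan (X : AffineType) (n : ℕ) : Matrix (Fin (n + 1)) (Fin (n + 1)) ℤ :=
  Matrix.of fun i j => X.cartanEntry n i j

/-- The dimension of `V(g)_L`. -/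
def dim (X : AffineType) (n : ℕ) : ℕ :=
  match X with
  | A1 => n
  | B1 | A2odd => 2 * n - 1
  | D1 => 2 * n - 2
  | D2 | A2even | A2evenDagger => 2 * n

/-- The letters (counted from `0`) of the reduced word that defines `V(g)_L`:
`(n, …, 2, 1)` for `A_n^{(1)}`,
`(1, …, n, n-1, …, 1)` for `B_n^{(1)}` and `A_{2n-1}^{(2)}`,
`(1, …, n, n-2, …, 1)` for `D_n^{(1)}`,
`(0, 1, …, n, n-1, …, 1)` for the other types.
The coordinates of `V(g)_L` in this order are
`x_n, …, x_1`; `x_1, …, x_n, x̄_{n-1}, …, x̄_1`; `x_1, …, x_n, x̄_{n-2}, …, x̄_1`;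
`x_0, …, x_n, x̄_{n-1}, …, x̄_1`. -/
def letter (X : AffineType) (n j : ℕ) : ℕ :=
  match X with
  | A1 => n - j
  | B1 | A2odd => if j < n then j + 1 else 2 * n - 1 - j
  | D1 => if j < n then j + 1 else 2 * n - 2 - j
  | D2 | A2even | A2evenDagger => if j ≤ n then j else 2 * n - j

/-- The reduced word that defines `V(g)_L`. -/
def word (X : AffineType) (n : ℕ) (j : Fin (X.dim n)) : Fin (n + 1) :=
  Fin.ofNat (n + 1) (X.letter n j)

/-- The values `α_i(H)`. -/
def weightH (X : AffineType) (n : ℕ) (i : Fin (n + 1)) : ℤ :=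
  let s : ℤ := match X with
    | A1 | B1 | D1 | A2odd => 1
    | D2 | A2even | A2evenDagger => 2
  if (i : ℕ) = 0 then -s else if (i : ℕ) = 1 then s else 0

/-- The coordinate at place `j` (counted from `0`). -/
def coord {m : ℕ} (x : Fin m → ℂˣ) (j : ℕ) : ℂˣ :=
  if h : j < m then x ⟨j, h⟩ else 1

/-- For `B_n^{(1)}`, `D_n^{(1)}` and `A_{2n-1}^{(2)}`, the involution of `V(g)_L` induced by the
automorphism `α_0 ↔ α_1` of the Dynkin diagram: all coordinates are divided by `L x_1 x̄_1`, except
that `x_n` is divided by `(L x_1 x̄_1)^2` for `A_{2n-1}^{(2)}`. -/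
def sigmaBar (X : AffineType) (n : ℕ) (L : ℂˣ) (x : Fin (X.dim n) → ℂˣ) :
    Fin (X.dim n) → ℂˣ := fun j =>
  let a := L * coord x 0 * coord x (X.dim n - 1)
  match X with
  | A2odd => if (j : ℕ) + 1 = n then x j / a ^ 2 else x j / a
  | _ => x j / a

/-- The action `e_0^c` on `V(g)_L`. For `A_n^{(1)}` it divides all coordinates by `c`. For
`B_n^{(1)}`, `D_n^{(1)}` and `A_{2n-1}^{(2)}` it is the conjugate of `e_1^c` under the involution
`sigmaBar`. For the other types it is given by its closed form, where `q = x_1 x̄_1`. -/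
noncomputable def e0 (X : AffineType) (n : ℕ) (L c : ℂˣ) (x : Fin (X.dim n) → ℂˣ) :
    Fin (X.dim n) → ℂˣ :=
  let x0 : ℂ := coord x 0
  let q : ℂ := coord x 1 * coord x (X.dim n - 1)
  let r : ℂˣ := unitOf ((c ^ 2 * x0 ^ 2 + L ^ 2 * q) / (c ^ 2 * (x0 ^ 2 + L ^ 2 * q)))
  let r' : ℂˣ := unitOf ((c * x0 + L * q) / (c * (x0 + L * q)))
  match X with
  | A1 => fun j => x j / c
  | B1 => sigmaBar B1 n L (schubertE (cartan B1 n) (word B1 n) 1 c (sigmaBar B1 n L x))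
  | D1 => sigmaBar D1 n L (schubertE (cartan D1 n) (word D1 n) 1 c (sigmaBar D1 n L x))
  | A2odd =>
      sigmaBar A2odd n L (schubertE (cartan A2odd n) (word A2odd n) 1 c (sigmaBar A2odd n L x))
  | D2 => fun j => if (j : ℕ) = 0 then x j * c * r else x j * r
  | A2even => fun j =>
      if (j : ℕ) = 0 then x j * c * r else if (j : ℕ) = n then x j * r ^ 2 else x j * r
  | A2evenDagger => fun j => if (j : ℕ) = 0 then x j * c * r' ^ 2 else x j * r'

/-- The function `ε_0` on `V(g)_L`. -/
noncomputable def ε0 (X : AffineType) (n : ℕ) (L : ℂˣ) (x : Fin (X.dim n) → ℂˣ) : ℂ :=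
  let x0 : ℂ := coord x 0
  let q : ℂ := coord x 1 * coord x (X.dim n - 1)
  match X with
  | A1 => L * coord x (n - 1)
  | B1 => schubertε (cartan B1 n) (word B1 n) 1 (sigmaBar B1 n L x)
  | D1 => schubertε (cartan D1 n) (word D1 n) 1 (sigmaBar D1 n L x)
  | A2odd => schubertε (cartan A2odd n) (word A2odd n) 1 (sigmaBar A2odd n L x)
  | D2 => (x0 ^ 2 + L ^ 2 * q) / x0 ^ 3
  | A2even => (x0 ^ 2 + L ^ 2 * q) / x0 ^ 3
  | A2evenDagger => (x0 + L * q) ^ 2 / x0 ^ 3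

/-- The affine geometric crystal `V(g)_L`. For `i ≠ 0` it has the structure of the Schubert cell
`B_w^- L^H`. The formula for `γ_i` is also valid for `i = 0`. -/
noncomputable def V (X : AffineType) (n : ℕ) (L : ℂˣ) :
    CrystalData (Fin (n + 1)) (Fin (X.dim n)) where
  e i c x := if i = 0 then X.e0 n L c x else schubertE (X.cartan n) (X.word n) i c x
  γ i x := schubertγ (X.cartan n) (X.word n) (fun i => L ^ X.weightH n i) i x
  ε i x := if i = 0 then X.ε0 n L x else schubertε (X.cartan n) (X.word n) i x

end AffineType

/-! The axioms are identities between rational functions, so they may be checked on a Zariski dense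
set. The set used is that of the points with positive real coordinates: there every `γ`, `ε` and
action is positive and no denominator vanishes. The parameters `L` are arbitrary complex numbers, so
they are first treated as additional variables. An identity proved at all positive `(c, L, x)` is an
identity of rational functions in `(c, L, x)`, and it can be specialized to `L = L₀` provided that
everything is regular at `(1, L₀, x₀)` for some base point `x₀`. Such a point exists because it only
has to avoid the zeros of finitely many functions `ε_i` and, in products, `φ_i(x) + ε_i(y)`. This
reduction is `IsRegularFamily.isGeometricCrystal`.

At positive points, let `s_i` act on `T × X` by `(t, x) ↦ (s_i t, e_i^{α_i(t)} x)`. The composite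
along a word has `e_𝐢^t` as its second component. Hence `e_𝐢 = e_𝐢'` follows once this defines an
action of the Weyl group, that is, from `s_i² = 1` and the braid relations. Only the orders 2, 3 and
4 occur, so everything concerns pairs of indices.

The braid (Verma) relations for a product do not follow formally from those of its factors. A
stronger structure does pass to products, the unipotent crystals of Berenstein and Kazhdan: for a
pair of indices, the actions come from a partial action of the unipotent group of a group of type A₁
× A₁, A₂ or C₂, where `e_i^c` is the action of `exp(b e_i)` with `c = 1 + b ε_i`, together with a
compatible map to the opposite Borel subgroup. The formulas for `c₁` and `c₂` are exactly the
product of two such structures (`Unipotent.prod`, `IsUnipotentPair.prod`). Conversely, a relation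
between composites of the actions becomes an identity between matrices of the unipotent group
(`braid_A1A1`, `braid_A2`, `braid_C2`).

It remains to treat one crystal `V(g)_L`. For two indices other than 0 it is a Schubert cell, which
is an iterated product of one-dimensional unipotent crystals (`isUnipotentPair_schubert`). Pairs
that contain 0 are handled in three ways. Commuting actions give a unipotent crystal directly
(`unipotentAt_of_commute`); this covers type `A_n^{(1)}` and many other pairs. The involution
`sigmaBar` carries a pair `(0, j)` to `(1, j)` for the forked diagrams. For the path diagrams the
pair `(0, 1)` is mapped equivariantly to the cell of the word `(1, 0, 1)`, and the map is injective
together with enough invariants (`unipotentAt_zero_one_path`). -/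

open scoped ComplexOrder
set_option linter.unusedSectionVars false

/-! ### Rational functions that are regular at given points -/

/-- All coordinates of `x` are positive real numbers. -/
def PosPt {ι : Type} (x : ι → ℂˣ) : Prop := ∀ j, 0 < (x j : ℂ)

theorem coe_unitOf {z : ℂ} (h : z ≠ 0) : (unitOf z : ℂ) = z := by
  simp [unitOf, h]

theorem unitOf_pos {z : ℂ} (h : 0 < z) : 0 < (unitOf z : ℂ) := by
  rwa [coe_unitOf h.ne']

theorem inv_coe_pos {u : ℂˣ} (h : 0 < (u : ℂ)) : 0 < ((u⁻¹ : ℂˣ) : ℂ) := by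
  rw [Units.val_inv_eq_inv_val]; positivity

theorem mul_coe_pos {u v : ℂˣ} (h : 0 < (u : ℂ)) (h' : 0 < (v : ℂ)) : 0 < ((u * v : ℂˣ) : ℂ) := by
  rw [Units.val_mul]; positivity

theorem div_coe_pos {u v : ℂˣ} (h : 0 < (u : ℂ)) (h' : 0 < (v : ℂ)) : 0 < ((u / v : ℂˣ) : ℂ) := by
  rw [div_eq_mul_inv]; exact mul_coe_pos h (inv_coe_pos h')

theorem pow_coe_pos {u : ℂˣ} (h : 0 < (u : ℂ)) (k : ℕ) : 0 < ((u ^ k : ℂˣ) : ℂ) := by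
  rw [Units.val_pow_eq_pow_val]; positivity

theorem zpow_coe_pos {u : ℂˣ} (h : 0 < (u : ℂ)) (k : ℤ) : 0 < ((u ^ k : ℂˣ) : ℂ) := by
  cases k with
  | ofNat k => simpa using pow_coe_pos h k
  | negSucc k => simpa only [zpow_negSucc] using inv_coe_pos (pow_coe_pos h _)

theorem prod_coe_pos {α : Type*} {u : α → ℂˣ} (s : Finset α) (h : ∀ a ∈ s, 0 < (u a : ℂ)) :
    0 < ((∏ a ∈ s, u a : ℂˣ) : ℂ) := by
  rw [Units.coe_prod]; exact Finset.prod_pos h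

/-- The filter of the sets that contain the nonvanishing set of a polynomial without zeros at the
points of `G`. -/
noncomputable def nonvanishing {ι : Type} (G : Set (ι → ℂˣ)) : Filter (ι → ℂˣ) where
  sets := {s | ∃ Q : MvPolynomial ι ℂ, (∀ x ∈ G, evalAt Q x ≠ 0) ∧
    ∀ x, evalAt Q x ≠ 0 → x ∈ s}
  univ_sets := ⟨1, by simp [evalAt], fun _ _ => Set.mem_univ _⟩
  sets_of_superset := by
    rintro s t ⟨Q, hQ, h⟩ hst
    exact ⟨Q, hQ, fun x hx => hst (h x hx)⟩
  inter_sets := by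
    rintro s t ⟨Q, hQ, h⟩ ⟨R, hR, h'⟩
    refine ⟨Q * R, fun x hx => ?_, fun x hx => ?_⟩
    · simpa [evalAt] using And.intro (hQ x hx) (hR x hx)
    · have hx' : evalAt Q x * evalAt R x ≠ 0 := by simpa [evalAt] using hx
      exact ⟨h x (left_ne_zero_of_mul hx'), h' x (right_ne_zero_of_mul hx')⟩

theorem of_eventually_nonvanishing {ι : Type} {G : Set (ι → ℂˣ)} {p : (ι → ℂˣ) → Prop}
    (h : ∀ᶠ x in nonvanishing G, p x) {x : ι → ℂˣ} (hx : x ∈ G) : p x := by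
  obtain ⟨Q, hQ, h⟩ := h
  exact h x (hQ x hx)

theorem ne_zero_of_evalAt {ι : Type} {Q : MvPolynomial ι ℂ} {x : ι → ℂˣ} (hQ : evalAt Q x ≠ 0) :
    Q ≠ 0 := by
  rintro rfl
  exact hQ (by simp [evalAt])

theorem nonvanishing_ne_zero {ι : Type} {G : Set (ι → ℂˣ)} (hG : G.Nonempty)
    {Q : MvPolynomial ι ℂ} (hQ : ∀ x ∈ G, evalAt Q x ≠ 0) : Q ≠ 0 :=
  ne_zero_of_evalAt (hQ _ hG.some_mem)

/-- A polynomial without zeros on a nonempty `G` is not the zero polynomial, so what holds near `G`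
holds generically. -/
theorem generic_le_nonvanishing {ι : Type} {G : Set (ι → ℂˣ)} (hG : G.Nonempty) :
    generic ι ≤ nonvanishing G := by
  rintro s ⟨Q, hQ, h⟩
  exact ⟨Q, nonvanishing_ne_zero hG hQ, h⟩

/-- The positive reals are infinite, so the positive points are Zariski dense. -/
theorem eq_zero_of_vanishing {ι : Type} {P : MvPolynomial ι ℂ}
    (h : ∀ x, PosPt x → evalAt P x = 0) : P = 0 := by
  refine MvPolynomial.funext_set (fun _ => {z : ℂ | 0 < z}) (fun _ => ?_) fun x hx => ?_
  · refine Set.infinite_of_injective_forall_mem (f := fun k : ℕ => (k : ℂ) + 1)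
      (fun a b hab => by simpa using hab) fun k => ?_
    change (0 : ℂ) < k + 1
    positivity
  · have hx' : ∀ i, 0 < x i := fun i => hx i (Set.mem_univ i)
    have := h (fun i => Units.mk0 (x i) (hx' i).ne') (fun i => hx' i)
    simpa [evalAt] using this

/-- `f` is a rational function that is regular at the points of `G`. -/
def RegOn {ι : Type} (G : Set (ι → ℂˣ)) (f : (ι → ℂˣ) → ℂ) : Prop :=
  ∃ P Q : MvPolynomial ι ℂ, (∀ x ∈ G, evalAt Q x ≠ 0) ∧
    ∀ᶠ x in nonvanishing G, f x = evalAt P x / evalAt Q x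

namespace RegOn

variable {ι κ : Type} {G : Set (ι → ℂˣ)} {f g : (ι → ℂˣ) → ℂ}

theorem eventually_ne {Q : MvPolynomial ι ℂ} (hQ : ∀ x ∈ G, evalAt Q x ≠ 0) :
    ∀ᶠ x in nonvanishing G, evalAt Q x ≠ 0 := ⟨Q, hQ, fun _ h => h⟩

theorem congr (hf : RegOn G f) (h : ∀ᶠ x in nonvanishing G, g x = f x) : RegOn G g := by
  obtain ⟨P, Q, hQ, hP⟩ := hf
  exact ⟨P, Q, hQ, by filter_upwards [h, hP] with x h1 h2; rw [h1, h2]⟩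

theorem eval (P : MvPolynomial ι ℂ) : RegOn G (evalAt P) :=
  ⟨P, 1, by simp [evalAt], Eventually.of_forall fun x => by simp [evalAt]⟩

theorem const (c : ℂ) : RegOn G (fun _ : ι → ℂˣ => c) :=
  (eval (MvPolynomial.C c)).congr (Eventually.of_forall fun x => by simp [evalAt])

theorem coord (j : ι) : RegOn G (fun x : ι → ℂˣ => (x j : ℂ)) :=
  (eval (MvPolynomial.X j)).congr (Eventually.of_forall fun x => by simp [evalAt])

theorem add (hf : RegOn G f) (hg : RegOn G g) : RegOn G fun x => f x + g x := by
  obtain ⟨P, Q, hQ, hf⟩ := hf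
  obtain ⟨P', Q', hQ', hg⟩ := hg
  refine ⟨P * Q' + Q * P', Q * Q', fun x hx => ?_, ?_⟩
  · simpa [evalAt] using And.intro (hQ x hx) (hQ' x hx)
  · filter_upwards [hf, hg, eventually_ne hQ, eventually_ne hQ'] with x h1 h2 h3 h4
    rw [h1, h2, div_add_div _ _ h3 h4]
    simp [evalAt]

theorem mul (hf : RegOn G f) (hg : RegOn G g) : RegOn G fun x => f x * g x := by
  obtain ⟨P, Q, hQ, hf⟩ := hf
  obtain ⟨P', Q', hQ', hg⟩ := hg
  refine ⟨P * P', Q * Q', fun x hx => ?_, ?_⟩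
  · simpa [evalAt] using And.intro (hQ x hx) (hQ' x hx)
  · filter_upwards [hf, hg] with x h1 h2
    rw [h1, h2, div_mul_div_comm]
    simp [evalAt]

/-- An identity that is eventual for `nonvanishing G` holds in particular at every point of `G`. -/
theorem numerator_ne {P Q : MvPolynomial ι ℂ} (hf : ∀ᶠ x in nonvanishing G,
    f x = evalAt P x / evalAt Q x) (h0 : ∀ x ∈ G, f x ≠ 0) :
    ∀ x ∈ G, evalAt P x ≠ 0 := fun x hx h => by
  have := of_eventually_nonvanishing hf hx
  rw [h, zero_div] at this
  exact h0 x hx this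

theorem inv (hf : RegOn G f) (h0 : ∀ x ∈ G, f x ≠ 0) : RegOn G fun x => (f x)⁻¹ := by
  obtain ⟨P, Q, hQ, hf⟩ := hf
  refine ⟨Q, P, numerator_ne hf h0, ?_⟩
  filter_upwards [hf] with x h1
  rw [h1, inv_div]

theorem div (hf : RegOn G f) (hg : RegOn G g) (h0 : ∀ x ∈ G, g x ≠ 0) :
    RegOn G fun x => f x / g x := by
  simpa only [div_eq_mul_inv] using hf.mul (hg.inv h0)

theorem pow (hf : RegOn G f) (k : ℕ) : RegOn G fun x => f x ^ k := by
  induction k with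
  | zero => simpa using const 1
  | succ k ih => simpa only [pow_succ] using ih.mul hf

theorem sum {α : Type*} {F : α → (ι → ℂˣ) → ℂ} (s : Finset α) (h : ∀ a ∈ s, RegOn G (F a)) :
    RegOn G fun x => ∑ a ∈ s, F a x := by
  classical
  induction s using Finset.induction_on with
  | empty => simpa using const 0
  | insert a s ha ih =>
    simp only [Finset.sum_insert ha]
    exact (h a (by simp)).add (ih fun c hc => h c (by simp [hc]))

theorem prod {α : Type*} {F : α → (ι → ℂˣ) → ℂ} (s : Finset α) (h : ∀ a ∈ s, RegOn G (F a)) :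
    RegOn G fun x => ∏ a ∈ s, F a x := by
  classical
  induction s using Finset.induction_on with
  | empty => simpa using const 1
  | insert a s ha ih =>
    simp only [Finset.prod_insert ha]
    exact (h a (by simp)).mul (ih fun c hc => h c (by simp [hc]))

theorem eventually_ne_zero (hf : RegOn G f) (h0 : ∀ x ∈ G, f x ≠ 0) :
    ∀ᶠ x in nonvanishing G, f x ≠ 0 := by
  obtain ⟨P, Q, hQ, hf⟩ := hf
  filter_upwards [hf, eventually_ne hQ, eventually_ne (numerator_ne hf h0)] with x h1 h2 h3
  rw [h1]
  exact div_ne_zero h3 h2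

theorem unitOf (hf : RegOn G f) (h0 : ∀ x ∈ G, f x ≠ 0) :
    RegOn G fun x => (unitOf (f x) : ℂ) :=
  hf.congr (by filter_upwards [hf.eventually_ne_zero h0] with x hx using coe_unitOf hx)

theorem units_inv {u : (ι → ℂˣ) → ℂˣ} (hf : RegOn G fun x => (u x : ℂ)) :
    RegOn G fun x => (((u x)⁻¹ : ℂˣ) : ℂ) := by
  simpa only [Units.val_inv_eq_inv_val] using hf.inv fun x _ => (u x).ne_zero

theorem units_mul {u v : (ι → ℂˣ) → ℂˣ} (hu : RegOn G fun x => (u x : ℂ))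
    (hv : RegOn G fun x => (v x : ℂ)) : RegOn G fun x => ((u x * v x : ℂˣ) : ℂ) := by
  simpa only [Units.val_mul] using hu.mul hv

theorem units_div {u v : (ι → ℂˣ) → ℂˣ} (hu : RegOn G fun x => (u x : ℂ))
    (hv : RegOn G fun x => (v x : ℂ)) : RegOn G fun x => ((u x / v x : ℂˣ) : ℂ) := by
  simpa only [div_eq_mul_inv] using hu.units_mul hv.units_inv

theorem units_pow {u : (ι → ℂˣ) → ℂˣ} (hf : RegOn G fun x => (u x : ℂ)) (k : ℕ) :
    RegOn G fun x => ((u x ^ k : ℂˣ) : ℂ) := by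
  simpa only [Units.val_pow_eq_pow_val] using hf.pow k

theorem units_zpow {u : (ι → ℂˣ) → ℂˣ} (hf : RegOn G fun x => (u x : ℂ)) (k : ℤ) :
    RegOn G fun x => ((u x ^ k : ℂˣ) : ℂ) := by
  cases k with
  | ofNat k => simpa using hf.pow k
  | negSucc k => simpa only [zpow_negSucc] using (hf.units_pow (k + 1)).units_inv

theorem units_prod {α : Type*} {u : α → (ι → ℂˣ) → ℂˣ} (s : Finset α)
    (h : ∀ a ∈ s, RegOn G fun x => (u a x : ℂ)) : RegOn G fun x => ((∏ a ∈ s, u a x : ℂˣ) : ℂ) := by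
  simpa only [Units.coe_prod] using prod s h

theorem isRationalFun (hf : RegOn G f) (hG : G.Nonempty) : IsRationalFun f := by
  obtain ⟨P, Q, hQ, R, hR, h⟩ := hf
  refine ⟨P * R, Q * R, mul_ne_zero (nonvanishing_ne_zero hG hQ) (nonvanishing_ne_zero hG hR),
    fun x hx => ?_⟩
  have hx' : evalAt Q x * evalAt R x ≠ 0 := by simpa [evalAt] using hx
  rw [h x (right_ne_zero_of_mul hx'), ← mul_div_mul_right _ _ (right_ne_zero_of_mul hx')]
  simp [evalAt]

/-- Two rational functions that agree at the points with positive coordinates agree generically. -/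
theorem eventually_eq (hf : RegOn G f) (hg : RegOn G g) (hG : ∀ x, PosPt x → x ∈ G)
    (h : ∀ x, PosPt x → f x = g x) : ∀ᶠ x in nonvanishing G, f x = g x := by
  obtain ⟨P, Q, hQ, hf⟩ := hf
  obtain ⟨P', Q', hQ', hg⟩ := hg
  have h0 : P * Q' - P' * Q = 0 := eq_zero_of_vanishing fun x hx => by
    have := h x hx
    have hx := hG x hx
    rw [of_eventually_nonvanishing hf hx, of_eventually_nonvanishing hg hx,
      div_eq_div_iff (hQ x hx) (hQ' x hx)] at this
    simpa [evalAt, sub_eq_zero] using this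
  filter_upwards [hf, hg, eventually_ne hQ, eventually_ne hQ'] with x h1 h2 h3 h4
  rw [h1, h2, div_eq_div_iff h3 h4]
  have := congrArg (fun R => evalAt R x) h0
  simpa [evalAt, sub_eq_zero] using this

end RegOn

/-- `F` is a rational map that is regular at the points of `G` and maps them to points of `G'`. -/
structure RegMapOn {κ ι : Type} (G : Set (κ → ℂˣ)) (G' : Set (ι → ℂˣ))
    (F : (κ → ℂˣ) → (ι → ℂˣ)) : Prop where
  regOn : ∀ j, RegOn G fun p => (F p j : ℂ)
  mem : ∀ p ∈ G, F p ∈ G'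

theorem RegMapOn.evalAt {κ ι : Type} {G : Set (κ → ℂˣ)} {G' : Set (ι → ℂˣ)}
    {F : (κ → ℂˣ) → (ι → ℂˣ)} (hF : RegMapOn G G' F) (P : MvPolynomial ι ℂ) :
    RegOn G fun p => evalAt P (F p) := by
  induction P using MvPolynomial.induction_on with
  | C a => simpa [_root_.evalAt] using RegOn.const a
  | add p q hp hq => simpa [_root_.evalAt] using hp.add hq
  | mul_X p j hp => simpa [_root_.evalAt] using hp.mul (hF.regOn j)

/-- The pullback of a polynomial without zeros on `G'` is regular on `G` and has no zeros there, so
dense open sets pull back to dense open sets that still contain `G`. -/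
theorem RegMapOn.eventually {κ ι : Type} {G : Set (κ → ℂˣ)} {G' : Set (ι → ℂˣ)}
    {F : (κ → ℂˣ) → (ι → ℂˣ)} (hF : RegMapOn G G' F) {p : (ι → ℂˣ) → Prop}
    (h : ∀ᶠ y in nonvanishing G', p y) : ∀ᶠ x in nonvanishing G, p (F x) := by
  obtain ⟨Q, hQ, h⟩ := h
  filter_upwards [(hF.evalAt Q).eventually_ne_zero fun x hx => hQ _ (hF.mem x hx)] with x hx
  exact h _ hx

theorem RegOn.comp {κ ι : Type} {G : Set (κ → ℂˣ)} {G' : Set (ι → ℂˣ)} {F : (κ → ℂˣ) → (ι → ℂˣ)}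
    {f : (ι → ℂˣ) → ℂ} (hf : RegOn G' f) (hF : RegMapOn G G' F) : RegOn G fun p => f (F p) := by
  obtain ⟨P, Q, hQ, h⟩ := hf
  exact ((hF.evalAt P).div (hF.evalAt Q) fun p hp => hQ _ (hF.mem p hp)).congr (hF.eventually h)

namespace RegMapOn

variable {κ ι : Type} {G : Set (κ → ℂˣ)} {G' : Set (ι → ℂˣ)}

theorem eventually_eq [Finite ι] {F H : (κ → ℂˣ) → (ι → ℂˣ)} (hF : RegMapOn G G' F)
    (hH : RegMapOn G G' H) (hG : ∀ x, PosPt x → x ∈ G) (h : ∀ p, PosPt p → F p = H p) :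
    ∀ᶠ p in nonvanishing G, F p = H p := by
  have : ∀ᶠ p in nonvanishing G, ∀ j, (F p j : ℂ) = H p j := eventually_all.2 fun j =>
    (hF.regOn j).eventually_eq (hH.regOn j) hG fun p hp => by rw [h p hp]
  filter_upwards [this] with p hp
  exact funext fun j => Units.ext (hp j)

/-- A rational map that is regular at `(1, x₀)` and satisfies `F (1, x) = x` for generic `x` has the
value `x` at `(1, x)` for generic `x`. -/
theorem hasValueAt_one [Finite ι] {F : (κ ⊕ ι → ℂˣ) → (ι → ℂˣ)} {x₀ : ι → ℂˣ}
    (hF : RegMapOn {Sum.elim (fun _ => 1) x₀} Set.univ F)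
    (h : ∀ᶠ x in nonvanishing {x₀}, F (Sum.elim (fun _ => 1) x) = x) :
    ∀ᶠ x in generic ι, HasValueAt F (Sum.elim (fun _ => 1) x) x := by
  have hE : RegMapOn {x₀} {Sum.elim (fun _ => 1) x₀}
      fun x : ι → ℂˣ => (Sum.elim (fun _ => 1) x : κ ⊕ ι → ℂˣ) := by
    refine ⟨fun j => ?_, fun p hp => by rw [Set.mem_singleton_iff.1 hp]; rfl⟩
    cases j with
    | inl j => simpa using RegOn.const 1
    | inr j => exact RegOn.coord j
  refine eventually_all.2 fun j => ?_
  obtain ⟨P, Q, hQ, hP⟩ := hF.regOn j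
  -- The denominator is non-zero at `(1, x₀)`, so its restriction to the slice `(1, x)` is not
  -- identically zero.
  have hQ' := (hE.evalAt Q).eventually_ne_zero fun x hx => hQ _ (hE.mem x hx)
  have h1 : ({x₀} : Set (ι → ℂˣ)).Nonempty := ⟨x₀, rfl⟩
  filter_upwards [generic_le_nonvanishing h1 hQ', generic_le_nonvanishing h1 (hE.eventually hP),
    generic_le_nonvanishing h1 h] with x h1 h2 h3
  exact ⟨P, Q, h1, by rw [← h2, h3], generic_le_nonvanishing (Set.singleton_nonempty _) hP⟩

end RegMapOn

/-- The points with positive coordinates, and the base point `b`. -/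
def good {ι : Type} (b : ι → ℂˣ) : Set (ι → ℂˣ) := {x | PosPt x ∨ x = b}

theorem forall_good {ι : Type} {b : ι → ℂˣ} {p : (ι → ℂˣ) → Prop} :
    (∀ x ∈ good b, p x) ↔ (∀ x, PosPt x → p x) ∧ p b :=
  ⟨fun h => ⟨fun x hx => h x (Or.inl hx), h b (Or.inr rfl)⟩, by
    rintro ⟨h1, h2⟩ x (hx | rfl)
    exacts [h1 x hx, h2]⟩

/-- `F` is a rational map that is regular at the points with positive coordinates and at the base
point, maps points with positive coordinates to points with positive coordinates, and preserves
base points. -/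
structure PointedMap {κ ι : Type} (b : κ → ℂˣ) (b' : ι → ℂˣ) (F : (κ → ℂˣ) → (ι → ℂˣ)) : Prop where
  regOn : ∀ j, RegOn (good b) fun p => (F p j : ℂ)
  pos : ∀ p, PosPt p → PosPt (F p)
  base : F b = b'

namespace PointedMap

variable {κ ι μ : Type} {b : κ → ℂˣ} {b' : ι → ℂˣ} {b'' : μ → ℂˣ}

theorem regMapOn {F : (κ → ℂˣ) → (ι → ℂˣ)} (hF : PointedMap b b' F) :
    RegMapOn (good b) (good b') F :=
  ⟨hF.regOn, forall_good.2 ⟨fun x hx => Or.inl (hF.pos x hx), Or.inr hF.base⟩⟩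

theorem comp {H : (ι → ℂˣ) → (μ → ℂˣ)} {F : (κ → ℂˣ) → (ι → ℂˣ)} (hH : PointedMap b' b'' H)
    (hF : PointedMap b b' F) : PointedMap b b'' fun p => H (F p) :=
  ⟨fun j => (hH.regOn j).comp hF.regMapOn, fun p hp => hH.pos _ (hF.pos p hp), by
    rw [hF.base, hH.base]⟩

theorem precomp (σ : ι → κ) : PointedMap b (b ∘ σ) fun p : κ → ℂˣ => p ∘ σ :=
  ⟨fun j => RegOn.coord (σ j), fun _ hp j => hp (σ j), rfl⟩

theorem sumElim {F : (κ → ℂˣ) → (ι → ℂˣ)} {H : (κ → ℂˣ) → (μ → ℂˣ)} (hF : PointedMap b b' F)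
    (hH : PointedMap b b'' H) :
    PointedMap b (Sum.elim b' b'') fun p => (Sum.elim (F p) (H p) : ι ⊕ μ → ℂˣ) :=
  ⟨fun j => by cases j with
    | inl j => exact hF.regOn j
    | inr j => exact hH.regOn j,
   fun p hp j => by cases j with
    | inl j => exact hF.pos p hp j
    | inr j => exact hH.pos p hp j,
   by rw [hF.base, hH.base]⟩

end PointedMap

/-! ### Geometric crystals from identities at the points with positive coordinates -/

section WeylAction

variable {I : Type} [Fintype I] [DecidableEq I]

/-- The action of the simple reflection `s_i` on the torus with coordinates `α_k(t)`. -/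
def torusReflection (A : Matrix I I ℤ) (i : I) (t : I → ℂˣ) : I → ℂˣ :=
  fun k => t k * t i ^ (-A i k)

theorem character_single (i : I) (t : I → ℂˣ) : character (Pi.single i 1) t = t i := by
  rw [character, Finset.prod_eq_single i]
  · simp
  · intro b _ hb; simp [hb]
  · simp

/-- The reflections of the root lattice and of the torus are dual to each other; on the lattice side
only the exponent of `t i` changes. -/
theorem character_simpleReflection (A : Matrix I I ℤ) (i : I) (β : I → ℤ) (t : I → ℂˣ) :
    character (simpleReflection A i β) t = character β (torusReflection A i t) := by
  have h1 : character (simpleReflection A i β) t =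
      character β t * t i ^ (-∑ k, β k * A i k) := by
    have h2 : ∀ k, t k ^ simpleReflection A i β k =
        t k ^ β k * (if k = i then t i ^ (-∑ k, β k * A i k) else 1) := fun k => by
      simp only [simpleReflection, Pi.sub_apply, Pi.smul_apply, smul_eq_mul]
      split_ifs with h
      · subst h
        rw [Pi.single_eq_same, mul_one, ← zpow_add, sub_eq_add_neg]
      · rw [Pi.single_eq_of_ne h, mul_zero, sub_zero, mul_one]
    simp only [character]
    rw [Finset.prod_congr rfl fun k _ => h2 k, Finset.prod_mul_distrib, Finset.prod_ite_eq']
    simp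
  rw [h1]
  have h3 : ∀ s : Finset I, t i ^ (-∑ k ∈ s, β k * A i k) = ∏ k ∈ s, (t i ^ (-A i k)) ^ β k := by
    intro s
    induction s using Finset.induction_on with
    | empty => simp
    | insert a s ha ih =>
      rw [Finset.sum_insert ha, Finset.prod_insert ha, ← ih, ← zpow_mul, ← zpow_add]
      congr 1; ring
  rw [h3]
  simp only [character, torusReflection, mul_zpow, Finset.prod_mul_distrib]

/-- The action of a word in the simple reflections on the torus with coordinates `α_k(t)`. -/
def torusWord (A : Matrix I I ℤ) : List I → (I → ℂˣ) → (I → ℂˣ)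
  | [], t => t
  | i :: w, t => torusReflection A i (torusWord A w t)

/-- The characters in `eWord` become coordinates of a reflected torus point. This is what turns
`eWord` into an iterated action of simple reflections on `T × X`. -/
theorem character_foldl (A : Matrix I I ℤ) (w : List I) (β : I → ℤ) (t : I → ℂˣ) :
    character (w.foldl (fun β j => simpleReflection A j β) β) t =
      character β (torusWord A w t) := by
  induction w generalizing β with
  | nil => rfl
  | cons i w ih => rw [List.foldl_cons, ih, character_simpleReflection]; rfl

theorem torusReflection_pos (A : Matrix I I ℤ) (i : I) {t : I → ℂˣ} (ht : PosPt t) :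
    PosPt (torusReflection A i t) :=
  fun k => mul_coe_pos (ht k) (zpow_coe_pos (ht i) _)

end WeylAction

namespace CrystalData

variable {I ι : Type}

/-- The functions and actions are positive at the points with positive coordinates. -/
structure IsPositive (D : CrystalData I ι) : Prop where
  γ_pos : ∀ i x, PosPt x → 0 < D.γ i x
  ε_pos : ∀ i x, PosPt x → 0 < D.ε i x
  e_pos : ∀ i {c : ℂˣ} {x : ι → ℂˣ}, 0 < (c : ℂ) → PosPt x → PosPt (D.e i c x)

/-- The Verma relations of rank two, at the points with positive coordinates. -/
structure Braid (A : Matrix I I ℤ) (D : CrystalData I ι) (i j : I) : Prop where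
  two : A i j = 0 → A j i = 0 → ∀ c d : ℂˣ, 0 < (c : ℂ) → 0 < (d : ℂ) → ∀ x, PosPt x →
    D.e i c (D.e j d x) = D.e j d (D.e i c x)
  three : A i j = -1 → A j i = -1 → ∀ c d : ℂˣ, 0 < (c : ℂ) → 0 < (d : ℂ) → ∀ x, PosPt x →
    D.e i d (D.e j (c * d) (D.e i c x)) = D.e j c (D.e i (c * d) (D.e j d x))
  four : A i j = -2 → A j i = -1 → ∀ c d : ℂˣ, 0 < (c : ℂ) → 0 < (d : ℂ) → ∀ x, PosPt x →
    D.e i c (D.e j (c ^ 2 * d) (D.e i (c * d) (D.e j d x))) =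
      D.e j d (D.e i (c * d) (D.e j (c ^ 2 * d) (D.e i c x)))

/-- The identities of a geometric crystal hold at the points with positive coordinates. -/
structure IsPositiveCrystal (A : Matrix I I ℤ) (D : CrystalData I ι) : Prop where
  positive : D.IsPositive
  e_one : ∀ i x, PosPt x → D.e i 1 x = x
  e_mul : ∀ i (c d : ℂˣ), 0 < (c : ℂ) → 0 < (d : ℂ) → ∀ x, PosPt x →
    D.e i c (D.e i d x) = D.e i (c * d) x
  γ_e : ∀ i j (c : ℂˣ), 0 < (c : ℂ) → ∀ x, PosPt x →
    D.γ j (D.e i c x) = ((c ^ A i j : ℂˣ) : ℂ) * D.γ j x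
  ε_e : ∀ i (c : ℂˣ), 0 < (c : ℂ) → ∀ x, PosPt x → D.ε i (D.e i c x) = (c⁻¹ : ℂˣ) * D.ε i x
  braid : ∀ i j, i ≠ j → Braid A D i j

/-- The pairs of off-diagonal entries `a_ij, a_ji` of a matrix whose rank two submatrices are of
type `A₁ × A₁`, `A₂` or `C₂`. -/
def RankTwoEntries (a b : ℤ) : Prop :=
  (a = 0 ∧ b = 0) ∨ (a = -1 ∧ b = -1) ∨ (a = -2 ∧ b = -1) ∨ (a = -1 ∧ b = -2)

/-- A family of data that is regular at the points with positive coordinates and parameters, and at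
the base point `x₀` with the parameters `L₀`. -/
structure IsRegularFamily {Λ : Type} (D : (Λ → ℂˣ) → CrystalData I ι) (L₀ : Λ → ℂˣ)
    (x₀ : ι → ℂˣ) : Prop where
  γ_reg : ∀ i, RegOn (good (Sum.elim L₀ x₀)) fun p => (D (p ∘ Sum.inl)).γ i (p ∘ Sum.inr)
  γ_pos : ∀ i L x, PosPt L → PosPt x → 0 < (D L).γ i x
  γ_ne : ∀ i, (D L₀).γ i x₀ ≠ 0
  ε_reg : ∀ i, RegOn (good (Sum.elim L₀ x₀)) fun p => (D (p ∘ Sum.inl)).ε i (p ∘ Sum.inr)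
  ε_pos : ∀ i L x, PosPt L → PosPt x → 0 < (D L).ε i x
  ε_ne : ∀ i, (D L₀).ε i x₀ ≠ 0
  e_map : ∀ i, PointedMap (Sum.elim (fun _ : Unit => 1) (Sum.elim L₀ x₀)) x₀ fun p =>
    (D (p ∘ Sum.inr ∘ Sum.inl)).e i (p (Sum.inl ())) (p ∘ Sum.inr ∘ Sum.inr)

namespace IsRegularFamily

variable {Λ μ : Type} {D : (Λ → ℂˣ) → CrystalData I ι} {L₀ : Λ → ℂˣ} {x₀ : ι → ℂˣ}
  {b : μ → ℂˣ}

theorem e_comp (h : IsRegularFamily D L₀ x₀) (i : I)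
    {c : (μ → ℂˣ) → ℂˣ} {M : (μ → ℂˣ) → (Λ → ℂˣ)} {F : (μ → ℂˣ) → (ι → ℂˣ)}
    (hc : PointedMap b (fun _ : Unit => 1) fun p _ => c p) (hM : PointedMap b L₀ M)
    (hF : PointedMap b x₀ F) : PointedMap b x₀ fun p => (D (M p)).e i (c p) (F p) :=
  (h.e_map i).comp (hc.sumElim (hM.sumElim hF))

theorem γ_comp (h : IsRegularFamily D L₀ x₀) (i : I) {M : (μ → ℂˣ) → (Λ → ℂˣ)}
    {F : (μ → ℂˣ) → (ι → ℂˣ)} (hM : PointedMap b L₀ M) (hF : PointedMap b x₀ F) :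
    RegOn (good b) fun p => (D (M p)).γ i (F p) :=
  (h.γ_reg i).comp (hM.sumElim hF).regMapOn

theorem ε_comp (h : IsRegularFamily D L₀ x₀) (i : I) {M : (μ → ℂˣ) → (Λ → ℂˣ)}
    {F : (μ → ℂˣ) → (ι → ℂˣ)} (hM : PointedMap b L₀ M) (hF : PointedMap b x₀ F) :
    RegOn (good b) fun p => (D (M p)).ε i (F p) :=
  (h.ε_reg i).comp (hM.sumElim hF).regMapOn

theorem isPositive (h : IsRegularFamily D L₀ x₀) {L : Λ → ℂˣ} (hL : PosPt L) :
    (D L).IsPositive where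
  γ_pos i x hx := h.γ_pos i L x hL hx
  ε_pos i x hx := h.ε_pos i L x hL hx
  e_pos i {c x} hc hx := (h.e_map i).pos (Sum.elim (fun _ => c) (Sum.elim L x)) fun j => by
    rcases j with j | j | j
    exacts [hc, hL j, hx j]

end IsRegularFamily

variable [Fintype I] [DecidableEq I] {A : Matrix I I ℤ} {D : CrystalData I ι}

/-- The action of `s_i` on `T × X` given by `(t, x) ↦ (s_i(t), e_i^{α_i(t)}(x))`. -/
noncomputable def weylStep (A : Matrix I I ℤ) (hD : D.IsPositive) (i : I) :
    Function.End {p : (I → ℂˣ) × (ι → ℂˣ) // PosPt p.1 ∧ PosPt p.2} :=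
  fun p => ⟨(torusReflection A i p.1.1, D.e i (p.1.1 i) p.1.2),
    torusReflection_pos A i p.2.1, hD.e_pos i (p.2.1 i) p.2.2⟩

/-- Identifies `eWord` as the second component of a product of simple reflections, so that it can be
compared through group relations. -/
theorem prod_weylStep (hD : D.IsPositive) (w : List I)
    (p : {p : (I → ℂˣ) × (ι → ℂˣ) // PosPt p.1 ∧ PosPt p.2}) :
    ((w.map (weylStep A hD)).prod p).1 = (torusWord A w p.1.1, D.eWord A w p.1.1 p.1.2) := by
  induction w with
  | nil => rfl
  | cons i w ih =>
    rw [List.map_cons, List.prod_cons]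
    change (weylStep A hD i ((w.map (weylStep A hD)).prod p)).1 = _
    simp only [weylStep, ih, torusWord, eWord, character_foldl, character_single]

theorem torusReflection_self (hA : ∀ i, A i i = 2) (i : I) (t : I → ℂˣ) :
    torusReflection A i t i = (t i)⁻¹ := by
  rw [torusReflection, hA, zpow_neg]
  refine Units.ext ?_
  push_cast
  field_simp

/-- Since `α_i(s_i t) = α_i(t)⁻¹`, the two actions of `e_i` compose to `e_i^1`. -/
theorem weylStep_sq (hA : ∀ i, A i i = 2) (h : IsPositiveCrystal A D) (i : I) :
    weylStep A h.positive i * weylStep A h.positive i = 1 := by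
  funext p
  refine Subtype.ext (Prod.ext ?_ ?_)
  · change torusReflection A i (torusReflection A i p.1.1) = p.1.1
    funext k
    rw [torusReflection, torusReflection_self hA, torusReflection, inv_zpow, mul_assoc,
      mul_inv_cancel, mul_one]
  · change D.e i (torusReflection A i p.1.1 i) (D.e i (p.1.1 i) p.1.2) = p.1.2
    rw [torusReflection_self hA, h.e_mul i _ _ (inv_coe_pos (p.2.1 i)) (p.2.1 i) _ p.2.2,
      inv_mul_cancel, h.e_one i _ p.2.2]

theorem weylStep_two (h : IsPositiveCrystal A D) {i j : I}
    (hij : i ≠ j) (h1 : A i j = 0) (h2 : A j i = 0) :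
    weylStep A h.positive i * weylStep A h.positive j =
      weylStep A h.positive j * weylStep A h.positive i := by
  funext p
  refine Subtype.ext (Prod.ext ?_ ?_)
  · change torusReflection A i (torusReflection A j p.1.1) =
      torusReflection A j (torusReflection A i p.1.1)
    funext k
    simp only [torusReflection, h1, h2, neg_zero, zpow_zero, mul_one]
    ac_rfl
  · change D.e i (torusReflection A j p.1.1 i) (D.e j (p.1.1 j) p.1.2) =
      D.e j (torusReflection A i p.1.1 j) (D.e i (p.1.1 i) p.1.2)
    simp only [torusReflection, h1, h2, neg_zero, zpow_zero, mul_one]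
    exact (h.braid i j hij).two h1 h2 _ _ (p.2.1 i) (p.2.1 j) _ p.2.2

theorem weylStep_three (hA : ∀ i, A i i = 2) (h : IsPositiveCrystal A D) {i j : I}
    (hij : i ≠ j) (h1 : A i j = -1) (h2 : A j i = -1) :
    weylStep A h.positive i * weylStep A h.positive j * weylStep A h.positive i =
      weylStep A h.positive j * weylStep A h.positive i * weylStep A h.positive j := by
  funext p
  -- With `c = α_i(t)` and `d = α_j(t)`, the parameters met on the left are `c, cd, d` and those on
  -- the right are `d, cd, c`: the two sides of `Braid.three`.
  have e1 : torusReflection A j p.1.1 i = p.1.1 i * p.1.1 j := by simp [torusReflection, h2]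
  have e2 : torusReflection A i p.1.1 j = p.1.1 i * p.1.1 j := by
    simp [torusReflection, h1, mul_comm]
  have e3 : torusReflection A i (torusReflection A j p.1.1) j = p.1.1 i := by
    rw [torusReflection, e1, torusReflection_self hA, h1, neg_neg, zpow_one,
      mul_comm (p.1.1 i) (p.1.1 j), inv_mul_cancel_left]
  have e4 : torusReflection A j (torusReflection A i p.1.1) i = p.1.1 j := by
    rw [torusReflection, e2, torusReflection_self hA, h2, neg_neg, zpow_one]
    group
  refine Subtype.ext (Prod.ext ?_ ?_)
  · change torusReflection A i (torusReflection A j (torusReflection A i p.1.1)) =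
      torusReflection A j (torusReflection A i (torusReflection A j p.1.1))
    funext k
    rw [torusReflection, e4, torusReflection, e2, torusReflection,
      torusReflection, e3, torusReflection, e1, torusReflection, mul_zpow, mul_zpow]
    simp only [mul_left_comm, mul_assoc, mul_comm]
  · change D.e i (torusReflection A j (torusReflection A i p.1.1) i)
        (D.e j (torusReflection A i p.1.1 j) (D.e i (p.1.1 i) p.1.2)) =
      D.e j (torusReflection A i (torusReflection A j p.1.1) j)
        (D.e i (torusReflection A j p.1.1 i) (D.e j (p.1.1 j) p.1.2))
    rw [e1, e2, e3, e4]
    exact (h.braid i j hij).three h1 h2 _ _ (p.2.1 i) (p.2.1 j) _ p.2.2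

theorem weylStep_four (hA : ∀ i, A i i = 2) (h : IsPositiveCrystal A D) {i j : I}
    (hij : i ≠ j) (h1 : A i j = -2) (h2 : A j i = -1) :
    weylStep A h.positive i * weylStep A h.positive j * weylStep A h.positive i *
      weylStep A h.positive j = weylStep A h.positive j * weylStep A h.positive i *
        weylStep A h.positive j * weylStep A h.positive i := by
  funext p
  -- Here the parameters are `d, cd, c²d, c` on one side and `c, c²d, cd, d` on the other, in the
  -- order of application.
  have e1 : torusReflection A j p.1.1 i = p.1.1 i * p.1.1 j := by simp [torusReflection, h2]
  have e2 : torusReflection A i p.1.1 j = p.1.1 i ^ 2 * p.1.1 j := by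
    rw [torusReflection, h1, mul_comm]; rfl
  have e3 : torusReflection A i (torusReflection A j p.1.1) j = p.1.1 i ^ 2 * p.1.1 j := by
    rw [torusReflection, e1, torusReflection_self hA, h1, mul_zpow, mul_comm, mul_assoc,
      neg_neg, zpow_ofNat, zpow_ofNat, pow_two (p.1.1 j), mul_inv_cancel_right]
  have e4 : torusReflection A j (torusReflection A i p.1.1) i = p.1.1 i * p.1.1 j := by
    rw [torusReflection, e2, torusReflection_self hA, h2, neg_neg, zpow_one, pow_two, mul_assoc,
      inv_mul_cancel_left]
  have e5 : torusReflection A j (torusReflection A i (torusReflection A j p.1.1)) i =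
      p.1.1 i := by
    rw [torusReflection, e3, torusReflection_self hA, e1, h2, neg_neg, zpow_one, mul_inv, pow_two,
      mul_assoc (p.1.1 i), mul_comm (p.1.1 i)⁻¹, mul_assoc, inv_mul_cancel_left,
      mul_comm (p.1.1 i) (p.1.1 j), inv_mul_cancel_left]
  have e6 : torusReflection A i (torusReflection A j (torusReflection A i p.1.1)) j =
      p.1.1 j := by
    rw [torusReflection, e4, torusReflection_self hA, e2, h1, neg_neg, zpow_ofNat, mul_inv,
      mul_pow, pow_two (p.1.1 j), mul_mul_mul_comm, inv_mul_cancel, one_mul, inv_mul_cancel_left]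
  refine Subtype.ext (Prod.ext ?_ ?_)
  · change torusReflection A i (torusReflection A j (torusReflection A i
        (torusReflection A j p.1.1))) =
      torusReflection A j (torusReflection A i (torusReflection A j (torusReflection A i p.1.1)))
    funext k
    rw [torusReflection, e5, torusReflection, e3, torusReflection, e1, torusReflection,
      torusReflection, e6, torusReflection, e4, torusReflection, e2, torusReflection]
    ac_rfl
  · change D.e i (torusReflection A j (torusReflection A i (torusReflection A j p.1.1)) i)
        (D.e j (torusReflection A i (torusReflection A j p.1.1) j)
          (D.e i (torusReflection A j p.1.1 i) (D.e j (p.1.1 j) p.1.2))) =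
      D.e j (torusReflection A i (torusReflection A j (torusReflection A i p.1.1)) j)
        (D.e i (torusReflection A j (torusReflection A i p.1.1) i)
          (D.e j (torusReflection A i p.1.1 j) (D.e i (p.1.1 i) p.1.2)))
    rw [e1, e2, e3, e4, e5, e6]
    exact (h.braid i j hij).four h1 h2 _ _ (p.2.1 i) (p.2.1 j) _ p.2.2

/-- For involutions, a braid relation of length `m` gives `(ab)^m = 1`, the form in which Coxeter
relations have to be supplied. -/
theorem pow_mul_eq_one {M : Type*} [Monoid M] {a b : M} (ha : a * a = 1) (hb : b * b = 1) :
    (a * b = b * a → (a * b) ^ 2 = 1) ∧ (a * b * a = b * a * b → (a * b) ^ 3 = 1) ∧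
      (a * b * a * b = b * a * b * a → (a * b) ^ 4 = 1) := by
  refine ⟨fun h => ?_, fun h => ?_, fun h => ?_⟩
  · calc (a * b) ^ 2 = (a * b) * (a * b) := pow_two _
      _ = (a * b) * (b * a) := by rw [h]
      _ = a * (b * b) * a := by simp only [mul_assoc]
      _ = 1 := by rw [hb, mul_one, ha]
  · calc (a * b) ^ 3 = (a * b * a) * (b * a * b) := by simp only [pow_succ, pow_zero, one_mul, mul_assoc]
      _ = (a * b * a) * (a * b * a) := by rw [h]
      _ = a * (b * (a * a) * b) * a := by simp only [mul_assoc]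
      _ = 1 := by rw [ha, mul_one, hb, mul_one, ha]
  · calc (a * b) ^ 4 = (a * b * a * b) * (a * b * a * b) := by
          simp only [pow_succ, pow_zero, one_mul, mul_assoc]
      _ = (a * b * a * b) * (b * a * b * a) := by rw [h]
      _ = a * (b * (a * (b * b) * a) * b) * a := by simp only [mul_assoc]
      _ = 1 := by rw [hb, mul_one, ha, mul_one, hb, mul_one, ha]

theorem isLiftable_weylStep (hA : ∀ i, A i i = 2)
    (hA' : ∀ i j, i ≠ j → RankTwoEntries (A i j) (A j i)) (h : IsPositiveCrystal A D) :
    (weylCoxeterMatrix A).IsLiftable (weylStep A h.positive) := by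
  intro i j
  have hs := weylStep_sq hA h
  change _ ^ (if i = j then 1 else coxeterNumber (A i j * A j i)) = 1
  by_cases hij : i = j
  · subst hij
    rw [if_pos rfl, pow_one, hs]
  · rw [if_neg hij]
    have hp := pow_mul_eq_one (hs i) (hs j)
    rcases hA' i j hij with ⟨h1, h2⟩ | ⟨h1, h2⟩ | ⟨h1, h2⟩ | ⟨h1, h2⟩
    · rw [h1, h2]
      exact hp.1 (weylStep_two h hij h1 h2)
    · rw [h1, h2]
      exact hp.2.1 (weylStep_three hA h hij h1 h2)
    · rw [h1, h2]
      exact hp.2.2 (weylStep_four hA h hij h1 h2)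
    · rw [h1, h2]
      exact hp.2.2 (weylStep_four hA h (Ne.symm hij) h2 h1).symm

/-- The steps lift to a homomorphism from the Weyl group. It sends the product of a word to the
composite of its steps, so the composite depends only on the group element and reduced words need
not be connected by braid moves. -/
theorem eWord_congr (hA : ∀ i, A i i = 2)
    (hA' : ∀ i j, i ≠ j → RankTwoEntries (A i j) (A j i)) (h : IsPositiveCrystal A D)
    {v w : List I} (hvw : (weylCoxeterMatrix A).toCoxeterSystem.wordProd v =
      (weylCoxeterMatrix A).toCoxeterSystem.wordProd w) {t : I → ℂˣ} {x : ι → ℂˣ}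
    (ht : PosPt t) (hx : PosPt x) : D.eWord A v t x = D.eWord A w t x := by
  have key : ∀ u : List I, (weylCoxeterMatrix A).toCoxeterSystem.lift
      ⟨_, isLiftable_weylStep hA hA' h⟩ ((weylCoxeterMatrix A).toCoxeterSystem.wordProd u) =
        (u.map (weylStep A h.positive)).prod := fun u => by
    rw [CoxeterSystem.wordProd, map_list_prod, List.map_map]
    congr 2
  have := prod_weylStep (A := A) h.positive v ⟨(t, x), ht, hx⟩
  rw [← key, hvw, key, prod_weylStep] at this
  exact (congrArg Prod.snd this).symm

namespace IsRegularFamily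

variable {Λ μ : Type} {D : (Λ → ℂˣ) → CrystalData I ι} {L₀ : Λ → ℂˣ} {x₀ : ι → ℂˣ}
  {b : μ → ℂˣ}

/-- All characters equal 1 at `t = 1`, so each action in the word fixes the base point and
regularity there survives composition. -/
theorem eWord (h : IsRegularFamily D L₀ x₀) (w : List I) :
    PointedMap (Sum.elim (fun _ : I => 1) (Sum.elim L₀ x₀)) x₀ fun p =>
      (D (p ∘ Sum.inr ∘ Sum.inl)).eWord A w (p ∘ Sum.inl) (p ∘ Sum.inr ∘ Sum.inr) := by
  induction w with
  | nil => exact PointedMap.precomp (Sum.inr ∘ Sum.inr)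
  | cons i w ih =>
    refine h.e_comp i ⟨fun _ => ?_, fun p hp _ => ?_, ?_⟩
      (PointedMap.precomp (Sum.inr ∘ Sum.inl)) ih
    · exact RegOn.units_prod _ fun i _ => (RegOn.coord (Sum.inl i)).units_zpow _
    · exact prod_coe_pos _ fun i _ => zpow_coe_pos (hp _) _
    · simp [character]

/-- Regularity is claimed at the single point `(t₀, x₀)`: its image is the base point itself, so
`L₀` need not be positive. -/
theorem regMapOn_specialize {κ : Type} (t₀ : κ → ℂˣ) :
    RegMapOn {(Sum.elim t₀ x₀ : κ ⊕ ι → ℂˣ)} (good (Sum.elim t₀ (Sum.elim L₀ x₀)))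
      fun z : κ ⊕ ι → ℂˣ =>
        (Sum.elim (z ∘ Sum.inl) (Sum.elim L₀ (z ∘ Sum.inr)) : κ ⊕ (Λ ⊕ ι) → ℂˣ) := by
  refine ⟨fun j => ?_, ?_⟩
  · rcases j with j | j | j
    exacts [RegOn.coord _, RegOn.const (L₀ j : ℂ), RegOn.coord _]
  · rintro _ rfl
    exact Or.inr rfl

/-- An identity at the points with positive coordinates and parameters, specialized to the
parameters `L₀`. -/
theorem specialize {κ : Type} {p : (κ ⊕ (Λ ⊕ ι) → ℂˣ) → Prop} (t₀ : κ → ℂˣ)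
    (h : ∀ᶠ z in nonvanishing (good (Sum.elim t₀ (Sum.elim L₀ x₀))), p z) :
    ∀ᶠ z in nonvanishing {(Sum.elim t₀ x₀ : κ ⊕ ι → ℂˣ)},
      p (Sum.elim (z ∘ Sum.inl) (Sum.elim L₀ (z ∘ Sum.inr))) :=
  (regMapOn_specialize t₀).eventually h

theorem regMapOn_elim : RegMapOn {x₀} (good (Sum.elim L₀ x₀))
    fun x : ι → ℂˣ => (Sum.elim L₀ x : Λ ⊕ ι → ℂˣ) := by
  refine ⟨fun j => ?_, ?_⟩
  · rcases j with j | j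
    exacts [RegOn.const (L₀ j : ℂ), RegOn.coord _]
  · rintro _ rfl
    exact Or.inr rfl

/-- Each axiom compares two expressions that are regular on `good`, equal at positive points, hence
equal on a dense open set that contains the base point. This last property is what allows the
restriction to `L = L₀`. -/
theorem isGeometricCrystal [Finite ι] (hA : ∀ i, A i i = 2)
    (hA' : ∀ i j, i ≠ j → RankTwoEntries (A i j) (A j i)) (hr : IsRegularFamily D L₀ x₀)
    (h : ∀ L, PosPt L → IsPositiveCrystal A (D L)) : (D L₀).IsGeometricCrystal A := by
  have hΛ : ∀ {κ : Type}, PointedMap (Sum.elim (fun _ : κ => 1) (Sum.elim L₀ x₀)) L₀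
      fun p => p ∘ Sum.inr ∘ Sum.inl := PointedMap.precomp (Sum.inr ∘ Sum.inl)
  have hι : ∀ {κ : Type}, PointedMap (Sum.elim (fun _ : κ => 1) (Sum.elim L₀ x₀)) x₀
      fun p => p ∘ Sum.inr ∘ Sum.inr := PointedMap.precomp (Sum.inr ∘ Sum.inr)
  have hκ : ∀ {κ : Type} (j : κ), PointedMap (Sum.elim (fun _ : κ => 1) (Sum.elim L₀ x₀))
      (fun _ : Unit => 1) fun p _ => p (Sum.inl j) := fun j =>
    ⟨fun _ => RegOn.coord _, fun p hp _ => hp _, rfl⟩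
  have hpos : ∀ {κ : Type} (t : κ → ℂˣ) (x), PosPt x → x ∈ good (Sum.elim t (Sum.elim L₀ x₀)) :=
    fun t x hx => Or.inl hx
  have hgen : ∀ {κ : Type} (t : κ → ℂˣ),
      generic (κ ⊕ ι) ≤ nonvanishing {(Sum.elim t x₀ : κ ⊕ ι → ℂˣ)} :=
    fun t => generic_le_nonvanishing (Set.singleton_nonempty _)
  have hx₀ : ({x₀} : Set (ι → ℂˣ)).Nonempty := Set.singleton_nonempty _
  have hM : ∀ i, RegMapOn {(Sum.elim (fun _ => 1) x₀ : Unit ⊕ ι → ℂˣ)} Set.univ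
      ((D L₀).eMap i) := fun i =>
    ⟨fun j => ((hr.e_map i).regOn j).comp (regMapOn_specialize _), fun _ _ => trivial⟩
  have h1 : ∀ i, ∀ᶠ x in generic ι, HasValueAt ((D L₀).eMap i) (Sum.elim (fun _ => 1) x) x :=
    fun i => by
      refine (hM i).hasValueAt_one ?_
      have e1 : PointedMap (Sum.elim L₀ x₀) x₀ fun p =>
          (D (p ∘ Sum.inl)).e i 1 (p ∘ Sum.inr) :=
        hr.e_comp i ⟨fun _ => by simpa using RegOn.const 1, fun _ _ _ => by simp, rfl⟩
          (PointedMap.precomp Sum.inl) (PointedMap.precomp Sum.inr)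
      -- The axiom for `c = 1` is an identity in `(L, x)` alone; it is first extended from positive
      -- points and then restricted to `L₀`.
      exact regMapOn_elim.eventually (e1.regMapOn.eventually_eq
        (PointedMap.precomp (b := Sum.elim L₀ x₀) Sum.inr).regMapOn (fun x hx => Or.inl hx)
        fun p hp => (h _ fun j => hp _).e_one i _ fun j => hp _)
  refine ⟨fun i => ((hr.γ_reg i).comp regMapOn_elim).isRationalFun hx₀,
    fun i => ((hr.ε_reg i).comp regMapOn_elim).isRationalFun hx₀,
    fun i j => ((hM i).regOn j).isRationalFun (Set.singleton_nonempty _),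
    fun i => (h1 i).mono fun x hx => ⟨x, hx⟩, h1, fun i => ?_, fun i j => ?_,
    fun v w _ _ hvw => ?_, fun i => ?_⟩
  · refine hgen _ (specialize (fun _ => 1) ((hr.e_comp i (hκ 0) hΛ
      (hr.e_comp i (hκ 1) hΛ hι)).regMapOn.eventually_eq (hr.e_comp i
        (c := fun p => p (Sum.inl 0) * p (Sum.inl 1)) ⟨fun _ => ?_, fun p hp _ => ?_, ?_⟩
        hΛ hι).regMapOn (hpos _) fun p hp => ?_))
    · exact (RegOn.coord _).units_mul (RegOn.coord _)
    · exact mul_coe_pos (hp _) (hp _)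
    · simp
    · exact (h _ fun _ => hp _).e_mul i _ _ (hp _) (hp _) _ fun _ => hp _
  · exact hgen _ (specialize (fun _ => 1) ((hr.γ_comp j hΛ (hr.e_comp i (hκ ()) hΛ hι)).eventually_eq
      (((RegOn.coord (Sum.inl ())).units_zpow (A i j)).mul (hr.γ_comp j hΛ hι)) (hpos _)
      fun p hp => (h _ fun _ => hp _).γ_e i j _ (hp _) _ fun _ => hp _))
  · exact hgen _ (specialize (fun _ => 1) ((hr.eWord v).regMapOn.eventually_eq
      (hr.eWord w).regMapOn (hpos _) fun p hp =>
        eWord_congr hA hA' (h _ fun _ => hp _) hvw (fun _ => hp _) fun _ => hp _))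
  · exact hgen _ (specialize (fun _ => 1) ((hr.ε_comp i hΛ (hr.e_comp i (hκ ()) hΛ hι)).eventually_eq
      ((RegOn.coord (Sum.inl ())).units_inv.mul (hr.ε_comp i hΛ hι)) (hpos _)
      fun p hp => (h _ fun _ => hp _).ε_e i _ (hp _) _ fun _ => hp _))

end IsRegularFamily

end CrystalData

/-! ### Borel subgroups of reductive groups of rank two -/

/-- The part of the structure of a reductive group of rank two that is needed here: `x k` are the
one-parameter subgroups of the simple roots, `B` is the opposite Borel subgroup, `γ k` are the
simple roots on its torus part, `ε k` are the simple coordinates on its unipotent part, `U` contains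
the products of the `x k a`, and `coeff k` are the simple coordinates there. -/
structure RankTwoModel where
  n : ℕ
  a : Fin 2 → Fin 2 → ℤ
  x : Fin 2 → ℂ → Matrix (Fin n) (Fin n) ℂ
  B : Matrix (Fin n) (Fin n) ℂ → Prop
  γ : Fin 2 → Matrix (Fin n) (Fin n) ℂ → ℂ
  ε : Fin 2 → Matrix (Fin n) (Fin n) ℂ → ℂ
  U : Matrix (Fin n) (Fin n) ℂ → Prop
  coeff : Fin 2 → Matrix (Fin n) (Fin n) ℂ → ℂ
  Y : Fin 2 → ℂ → Matrix (Fin n) (Fin n) ℂ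
  torus : (Fin 2 → ℂ) → Matrix (Fin n) (Fin n) ℂ
  a_self : ∀ k, a k k = 2
  x_zero : ∀ k, x k 0 = 1
  x_add : ∀ k b b', x k (b + b') = x k b * x k b'
  B_mul : ∀ {m m'}, B m → B m' → B (m * m')
  B_det : ∀ {m}, B m → m.det ≠ 0
  γ_ne : ∀ {m} k, B m → γ k m ≠ 0
  γ_mul : ∀ {m m'} k, B m → B m' → γ k (m * m') = γ k m * γ k m'
  ε_mul : ∀ {m m'} k, B m → B m' → ε k (m * m') = ε k m + ε k m' / γ k m
  U_one : U 1
  U_mul : ∀ {g g'}, U g → U g' → U (g * g')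
  U_x : ∀ k b, U (x k b)
  coeff_one : ∀ k, coeff k 1 = 0
  coeff_mul : ∀ {g g'} k, U g → U g' → coeff k (g * g') = coeff k g + coeff k g'
  coeff_x : ∀ k l b, coeff k (x l b) = if l = k then b else 0
  B_Y : ∀ k u, u ≠ 0 → B (Y k u)
  γ_Y : ∀ k l u, u ≠ 0 → γ l (Y k u) = u ^ a k l
  ε_Y : ∀ k l u, u ≠ 0 → ε l (Y k u) = if l = k then u⁻¹ else 0
  x_Y : ∀ k u b, u ≠ 0 → u + b ≠ 0 → x k b * Y k u = Y k (u + b) * x k (b / (u * (u + b)))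
  x_Y' : ∀ k l u b, u ≠ 0 → l ≠ k → x l b * Y k u = Y k u * x l (b / u ^ a k l)
  B_torus : ∀ g, (∀ k, g k ≠ 0) → B (torus g)
  γ_torus : ∀ g k, (∀ k, g k ≠ 0) → γ k (torus g) = g k
  ε_torus : ∀ g k, (∀ k, g k ≠ 0) → ε k (torus g) = 0
  x_torus : ∀ g k b, (∀ k, g k ≠ 0) → x k b * torus g = torus g * x k (b / g k)
  ε_step : ∀ {m m'} k b, B m → B m' → 1 + b * ε k m ≠ 0 →
    x k b * m = m' * x k (b / (γ k m * (1 + b * ε k m))) → ε k m' = ε k m / (1 + b * ε k m)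
  γ_step : ∀ {m m'} k l b, B m → B m' → 1 + b * ε k m ≠ 0 →
    x k b * m = m' * x k (b / (γ k m * (1 + b * ε k m))) →
    γ l m' = (1 + b * ε k m) ^ a k l * γ l m

namespace RankTwoModel

/-- The product of the elements `x k b` along a word. -/
def wordMatrix (R : RankTwoModel) : List (Fin 2 × ℂ) → Matrix (Fin R.n) (Fin R.n) ℂ
  | [] => 1
  | p :: w => R.wordMatrix w * R.x p.1 p.2

end RankTwoModel

/-- Moving a root element across a triangular matrix subtracts a multiple of one column from the
next; this simplifies the resulting diagonal entry. -/
theorem sub_mul_div_eq {b d p : ℂ} (e : ℂ) (h : d + b * p ≠ 0) :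
    e - p * (b * e / (d + b * p)) = d * e / (d + b * p) := by
  rw [eq_div_iff h, sub_mul, mul_assoc, div_mul_cancel₀ _ h]
  ring

/-! ### Type A₂: lower triangular matrices of size three. -/

section A2

def A2x (k : Fin 2) (b : ℂ) : Matrix (Fin 3) (Fin 3) ℂ :=
  if k = 0 then !![1, b, 0; 0, 1, 0; 0, 0, 1] else !![1, 0, 0; 0, 1, b; 0, 0, 1]

def A2B (m : Matrix (Fin 3) (Fin 3) ℂ) : Prop :=
  ∃ d₀ d₁ d₂ p q r : ℂ, d₀ ≠ 0 ∧ d₁ ≠ 0 ∧ d₂ ≠ 0 ∧ m = !![d₀, 0, 0; p, d₁, 0; q, r, d₂]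

noncomputable def A2γ (k : Fin 2) (m : Matrix (Fin 3) (Fin 3) ℂ) : ℂ :=
  if k = 0 then m 0 0 / m 1 1 else m 1 1 / m 2 2

noncomputable def A2ε (k : Fin 2) (m : Matrix (Fin 3) (Fin 3) ℂ) : ℂ :=
  if k = 0 then m 1 0 / m 0 0 else m 2 1 / m 1 1

/-- Both factorizations are known up to the entries of `m'`, so comparing entries determines `m'`.
The coordinate `m 2 0 / m 0 0` is followed as well, because only together with it do the two `ε`
form a system closed under the steps. -/
theorem A2_step {m m' : Matrix (Fin 3) (Fin 3) ℂ} (k : Fin 2) (b : ℂ) (hm : A2B m) (hm' : A2B m')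
    (hb : 1 + b * A2ε k m ≠ 0)
    (h : A2x k b * m = m' * A2x k (b / (A2γ k m * (1 + b * A2ε k m)))) :
    A2ε k m' = A2ε k m / (1 + b * A2ε k m) ∧
    (∀ l, A2γ l m' = (1 + b * A2ε k m) ^ (if k = l then 2 else -1 : ℤ) * A2γ l m) ∧
    (k = 0 → A2ε 1 m' = A2ε 1 m + b * (A2ε 0 m * A2ε 1 m - m 2 0 / m 0 0) ∧
      m' 2 0 / m' 0 0 = m 2 0 / m 0 0 / (1 + b * A2ε 0 m)) ∧
    (k = 1 → A2ε 0 m' = A2ε 0 m + b * (m 2 0 / m 0 0) ∧ m' 2 0 / m' 0 0 = m 2 0 / m 0 0) := by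
  obtain ⟨d₀, d₁, d₂, p, q, r, h0, h1, h2, rfl⟩ := hm
  obtain ⟨D₀, D₁, D₂, P, Q, R, H0, H1, H2, rfl⟩ := hm'
  have h' := fun i j => congrFun (congrFun h i) j
  clear h
  fin_cases k
  · simp [A2ε, A2γ, A2x] at hb h' ⊢
    simp [Fin.forall_fin_succ] at h'
    have hs : d₀ + b * p ≠ 0 := by rw [h'.1.1]; exact H0
    have e1 : b / (d₀ / d₁ * (1 + b * (p / d₀))) = b * d₁ / (d₀ + b * p) := by field_simp
    rw [e1] at h'
    obtain ⟨⟨rfl, -⟩, ⟨rfl, hD⟩, rfl, hR, rfl⟩ := h'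
    have hD' : D₁ = d₀ * d₁ / (d₀ + b * p) := by
      rw [eq_sub_of_add_eq' hD.symm, sub_mul_div_eq _ hs]
    have hR' : R = r - q * (b * d₁ / (d₀ + b * p)) := by linear_combination -hR
    subst hD' hR'
    refine ⟨?_, ⟨?_, ?_⟩, ?_, ?_⟩ <;> field_simp
    ring
  · simp [A2ε, A2γ, A2x] at hb h' ⊢
    simp [Fin.forall_fin_succ] at h'
    have hs : d₁ + b * r ≠ 0 := by rw [h'.2.1.2.1]; exact H1
    have e1 : b / (d₁ / d₂ * (1 + b * (r / d₁))) = b * d₂ / (d₁ + b * r) := by field_simp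
    rw [e1] at h'
    obtain ⟨rfl, ⟨rfl, rfl, -⟩, rfl, rfl, hD⟩ := h'
    have hD' : D₂ = d₁ * d₂ / (d₁ + b * r) := by
      rw [eq_sub_of_add_eq' hD.symm, sub_mul_div_eq _ hs]
    subst hD'
    refine ⟨?_, ⟨?_, ?_⟩, ?_⟩ <;> field_simp
    simp

/-- The group is `GL₃`, and the central direction is fixed by taking 1 as the last entry of `torus`.
The matrix `Y k u` is `y_k(u⁻¹) α_k^∨(u)`, where `y_k` is the opposite root subgroup. -/
noncomputable def A2Model : RankTwoModel where
  n := 3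
  a k l := if k = l then 2 else -1
  x := A2x
  B := A2B
  γ := A2γ
  ε := A2ε
  U g := ∃ a b c : ℂ, g = !![1, a, c; 0, 1, b; 0, 0, 1]
  coeff k g := if k = 0 then g 0 1 else g 1 2
  Y k u := if k = 0 then !![u, 0, 0; 1, u⁻¹, 0; 0, 0, 1] else !![1, 0, 0; 0, u, 0; 0, 1, u⁻¹]
  torus g := !![g 0 * g 1, 0, 0; 0, g 1, 0; 0, 0, 1]
  a_self k := by simp
  x_zero k := by
    fin_cases k <;> simp [A2x] <;> ext i j <;> fin_cases i <;> fin_cases j <;> simp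
  x_add k b b' := by fin_cases k <;> simp [A2x, add_comm]
  B_mul := by
    rintro _ _ ⟨d₀, d₁, d₂, p, q, r, h0, h1, h2, rfl⟩ ⟨D₀, D₁, D₂, P, Q, R, H0, H1, H2, rfl⟩
    exact ⟨d₀ * D₀, d₁ * D₁, d₂ * D₂, p * D₀ + d₁ * P, q * D₀ + r * P + d₂ * Q, r * D₁ + d₂ * R,
      mul_ne_zero h0 H0, mul_ne_zero h1 H1, mul_ne_zero h2 H2, by simp [add_assoc]⟩
  B_det := by
    rintro _ ⟨d₀, d₁, d₂, p, q, r, h0, h1, h2, rfl⟩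
    simp [Matrix.det_fin_three, h0, h1, h2]
  γ_ne := by
    rintro _ k ⟨d₀, d₁, d₂, p, q, r, h0, h1, h2, rfl⟩
    fin_cases k <;> simp [A2γ, h0, h1, h2]
  γ_mul := by
    rintro _ _ k ⟨d₀, d₁, d₂, p, q, r, h0, h1, h2, rfl⟩ ⟨D₀, D₁, D₂, P, Q, R, H0, H1, H2, rfl⟩
    fin_cases k <;> simp [A2γ] <;> field_simp
  ε_mul := by
    rintro _ _ k ⟨d₀, d₁, d₂, p, q, r, h0, h1, h2, rfl⟩ ⟨D₀, D₁, D₂, P, Q, R, H0, H1, H2, rfl⟩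
    fin_cases k <;> simp [A2γ, A2ε] <;> field_simp
  U_one := ⟨0, 0, 0, by ext i j; fin_cases i <;> fin_cases j <;> simp⟩
  U_mul := by
    rintro _ _ ⟨a, b, c, rfl⟩ ⟨a', b', c', rfl⟩
    exact ⟨a' + a, b' + b, c' + a * b' + c, by simp [add_assoc]⟩
  U_x k b := by
    fin_cases k
    · exact ⟨b, 0, 0, by simp [A2x]⟩
    · exact ⟨0, b, 0, by simp [A2x]⟩
  coeff_one k := by fin_cases k <;> simp
  coeff_mul := by
    rintro _ _ k ⟨a, b, c, rfl⟩ ⟨a', b', c', rfl⟩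
    fin_cases k <;> simp [add_comm]
  coeff_x k l b := by fin_cases k <;> fin_cases l <;> simp [A2x]
  B_Y k u hu := by
    fin_cases k
    · exact ⟨u, u⁻¹, 1, 1, 0, 0, hu, inv_ne_zero hu, one_ne_zero, by simp⟩
    · exact ⟨1, u, u⁻¹, 0, 0, 1, one_ne_zero, hu, inv_ne_zero hu, by simp⟩
  γ_Y k l u hu := by
    fin_cases k <;> fin_cases l <;> simp [A2γ, pow_two]
  ε_Y k l u hu := by fin_cases k <;> fin_cases l <;> simp [A2ε]
  x_Y k u b hu hb := by
    fin_cases k <;> simp [A2x] <;> field_simp <;> simp [add_comm]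
  x_Y' k l u b hu hkl := by
    fin_cases k <;> fin_cases l <;> (simp [A2x] at hkl ⊢; try field_simp)
  B_torus g hg := ⟨g 0 * g 1, g 1, 1, 0, 0, 0, mul_ne_zero (hg 0) (hg 1), hg 1, one_ne_zero, rfl⟩
  γ_torus g k hg := by
    have := hg 1
    fin_cases k <;> simp [A2γ, this]
  ε_torus g k hg := by fin_cases k <;> simp [A2ε]
  x_torus g k b hg := by
    have h0 := hg 0
    have h1 := hg 1
    fin_cases k <;> simp [A2x] <;> field_simp
  ε_step k b hm hm' hb h := (A2_step k b hm hm' hb h).1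
  γ_step k l b hm hm' hb h := (A2_step k b hm hm' hb h).2.1 l

end A2

/-! ### Type A₁ × A₁: pairs of lower triangular blocks of size two. -/

section A1A1

def A1A1x (k : Fin 2) (b : ℂ) : Matrix (Fin 4) (Fin 4) ℂ :=
  if k = 0 then !![1, b, 0, 0; 0, 1, 0, 0; 0, 0, 1, 0; 0, 0, 0, 1]
  else !![1, 0, 0, 0; 0, 1, 0, 0; 0, 0, 1, b; 0, 0, 0, 1]

def A1A1B (m : Matrix (Fin 4) (Fin 4) ℂ) : Prop :=
  ∃ d₀ d₁ d₂ d₃ p r : ℂ, d₀ ≠ 0 ∧ d₁ ≠ 0 ∧ d₂ ≠ 0 ∧ d₃ ≠ 0 ∧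
    m = !![d₀, 0, 0, 0; p, d₁, 0, 0; 0, 0, d₂, 0; 0, 0, r, d₃]

noncomputable def A1A1γ (k : Fin 2) (m : Matrix (Fin 4) (Fin 4) ℂ) : ℂ :=
  if k = 0 then m 0 0 / m 1 1 else m 2 2 / m 3 3

noncomputable def A1A1ε (k : Fin 2) (m : Matrix (Fin 4) (Fin 4) ℂ) : ℂ :=
  if k = 0 then m 1 0 / m 0 0 else m 3 2 / m 2 2

theorem A1A1_step {m m' : Matrix (Fin 4) (Fin 4) ℂ} (k : Fin 2) (b : ℂ) (hm : A1A1B m)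
    (hm' : A1A1B m') (hb : 1 + b * A1A1ε k m ≠ 0)
    (h : A1A1x k b * m = m' * A1A1x k (b / (A1A1γ k m * (1 + b * A1A1ε k m)))) :
    A1A1ε k m' = A1A1ε k m / (1 + b * A1A1ε k m) ∧
    (∀ l, A1A1γ l m' = (1 + b * A1A1ε k m) ^ (if k = l then 2 else 0 : ℤ) * A1A1γ l m) ∧
    (∀ l, l ≠ k → A1A1ε l m' = A1A1ε l m) := by
  obtain ⟨d₀, d₁, d₂, d₃, p, r, h0, h1, h2, h3, rfl⟩ := hm
  obtain ⟨D₀, D₁, D₂, D₃, P, R, H0, H1, H2, H3, rfl⟩ := hm'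
  have h' := fun i j => congrFun (congrFun h i) j
  clear h
  fin_cases k
  · simp [A1A1ε, A1A1γ, A1A1x] at hb h' ⊢
    simp [Fin.forall_fin_succ] at h'
    have hs : d₀ + b * p ≠ 0 := by rw [h'.1.1]; exact H0
    have e1 : b / (d₀ / d₁ * (1 + b * (p / d₀))) = b * d₁ / (d₀ + b * p) := by field_simp
    rw [e1] at h'
    obtain ⟨⟨rfl, -⟩, ⟨rfl, hD⟩, rfl, rfl, rfl⟩ := h'
    have hD' : D₁ = d₀ * d₁ / (d₀ + b * p) := by
      rw [eq_sub_of_add_eq' hD.symm, sub_mul_div_eq _ hs]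
    subst hD'
    refine ⟨?_, ?_⟩ <;> field_simp
    simp
  · simp [A1A1ε, A1A1γ, A1A1x] at hb h' ⊢
    simp [Fin.forall_fin_succ] at h'
    have hs : d₂ + b * r ≠ 0 := by rw [h'.2.2.1.1]; exact H2
    have e1 : b / (d₂ / d₃ * (1 + b * (r / d₂))) = b * d₃ / (d₂ + b * r) := by field_simp
    rw [e1] at h'
    obtain ⟨rfl, ⟨rfl, rfl⟩, ⟨rfl, -⟩, rfl, hD⟩ := h'
    have hD' : D₃ = d₂ * d₃ / (d₂ + b * r) := by
      rw [eq_sub_of_add_eq' hD.symm, sub_mul_div_eq _ hs]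
    subst hD'
    refine ⟨?_, ?_⟩ <;> field_simp
    simp

noncomputable def A1A1Model : RankTwoModel where
  n := 4
  a k l := if k = l then 2 else 0
  x := A1A1x
  B := A1A1B
  γ := A1A1γ
  ε := A1A1ε
  U g := ∃ a b : ℂ, g = !![1, a, 0, 0; 0, 1, 0, 0; 0, 0, 1, b; 0, 0, 0, 1]
  coeff k g := if k = 0 then g 0 1 else g 2 3
  Y k u := if k = 0 then !![u, 0, 0, 0; 1, u⁻¹, 0, 0; 0, 0, 1, 0; 0, 0, 0, 1]
    else !![1, 0, 0, 0; 0, 1, 0, 0; 0, 0, u, 0; 0, 0, 1, u⁻¹]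
  torus g := !![g 0, 0, 0, 0; 0, 1, 0, 0; 0, 0, g 1, 0; 0, 0, 0, 1]
  a_self k := by simp
  x_zero k := by
    fin_cases k <;> simp [A1A1x] <;> ext i j <;> fin_cases i <;> fin_cases j <;> simp
  x_add k b b' := by fin_cases k <;> simp [A1A1x, add_comm]
  B_mul := by
    rintro _ _ ⟨d₀, d₁, d₂, d₃, p, r, h0, h1, h2, h3, rfl⟩
      ⟨D₀, D₁, D₂, D₃, P, R, H0, H1, H2, H3, rfl⟩
    exact ⟨d₀ * D₀, d₁ * D₁, d₂ * D₂, d₃ * D₃, p * D₀ + d₁ * P, r * D₂ + d₃ * R,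
      mul_ne_zero h0 H0, mul_ne_zero h1 H1, mul_ne_zero h2 H2, mul_ne_zero h3 H3,
      by simp⟩
  B_det := by
    rintro _ ⟨d₀, d₁, d₂, d₃, p, r, h0, h1, h2, h3, rfl⟩
    rw [Matrix.det_of_isLowerTriangular]
    · simp [Fin.prod_univ_succ, h0, h1, h2, h3]
    · intro i j hij
      replace hij : i < j := hij
      fin_cases i <;> fin_cases j <;> simp at hij ⊢
  γ_ne := by
    rintro _ k ⟨d₀, d₁, d₂, d₃, p, r, h0, h1, h2, h3, rfl⟩
    fin_cases k <;> simp [A1A1γ, h0, h1, h2, h3]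
  γ_mul := by
    rintro _ _ k ⟨d₀, d₁, d₂, d₃, p, r, h0, h1, h2, h3, rfl⟩
      ⟨D₀, D₁, D₂, D₃, P, R, H0, H1, H2, H3, rfl⟩
    fin_cases k <;> simp [A1A1γ] <;> field_simp
  ε_mul := by
    rintro _ _ k ⟨d₀, d₁, d₂, d₃, p, r, h0, h1, h2, h3, rfl⟩
      ⟨D₀, D₁, D₂, D₃, P, R, H0, H1, H2, H3, rfl⟩
    fin_cases k <;> simp [A1A1γ, A1A1ε] <;> field_simp
  U_one := ⟨0, 0, by ext i j; fin_cases i <;> fin_cases j <;> simp⟩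
  U_mul := by
    rintro _ _ ⟨a, b, rfl⟩ ⟨a', b', rfl⟩
    exact ⟨a' + a, b' + b, by simp⟩
  U_x k b := by
    fin_cases k
    · exact ⟨b, 0, by simp [A1A1x]⟩
    · exact ⟨0, b, by simp [A1A1x]⟩
  coeff_one k := by fin_cases k <;> simp
  coeff_mul := by
    rintro _ _ k ⟨a, b, rfl⟩ ⟨a', b', rfl⟩
    fin_cases k <;> simp [add_comm]
  coeff_x k l b := by fin_cases k <;> fin_cases l <;> simp [A1A1x]
  B_Y k u hu := by
    fin_cases k
    · exact ⟨u, u⁻¹, 1, 1, 1, 0, hu, inv_ne_zero hu, one_ne_zero, one_ne_zero, by simp⟩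
    · exact ⟨1, 1, u, u⁻¹, 0, 1, one_ne_zero, one_ne_zero, hu, inv_ne_zero hu, by simp⟩
  γ_Y k l u hu := by
    fin_cases k <;> fin_cases l <;> simp [A1A1γ, pow_two]
  ε_Y k l u hu := by fin_cases k <;> fin_cases l <;> simp [A1A1ε]
  x_Y k u b hu hb := by
    fin_cases k <;> simp [A1A1x] <;> field_simp <;> simp [add_comm]
  x_Y' k l u b hu hkl := by
    fin_cases k <;> fin_cases l <;> simp [A1A1x] at hkl ⊢
  B_torus g hg := ⟨g 0, 1, g 1, 1, 0, 0, hg 0, one_ne_zero, hg 1, one_ne_zero, rfl⟩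
  γ_torus g k hg := by fin_cases k <;> simp [A1A1γ]
  ε_torus g k hg := by fin_cases k <;> simp [A1A1ε]
  x_torus g k b hg := by
    have h0 := hg 0
    have h1 := hg 1
    fin_cases k <;> simp [A1A1x] <;> field_simp
  ε_step k b hm hm' hb h := (A1A1_step k b hm hm' hb h).1
  γ_step k l b hm hm' hb h := (A1A1_step k b hm hm' hb h).2.1 l

end A1A1

/-! ### Type C₂: lower triangular symplectic similitudes of size four, with index 0 the short root.
-/

section C2

def C2x (k : Fin 2) (b : ℂ) : Matrix (Fin 4) (Fin 4) ℂ :=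
  if k = 0 then !![1, b, 0, 0; 0, 1, 0, 0; 0, 0, 1, b; 0, 0, 0, 1]
  else !![1, 0, 0, 0; 0, 1, b, 0; 0, 0, 1, 0; 0, 0, 0, 1]

/-- The three equations say that `m` preserves, up to a scalar, the alternating form `u₀v₃ - u₃v₀ -
u₁v₂ + u₂v₁`; they are the pairings of columns that do not vanish for triangular reasons. Working
with similitudes leaves room for both simple roots to take arbitrary values on the torus. -/
def C2B (m : Matrix (Fin 4) (Fin 4) ℂ) : Prop :=
  ∃ d₀ d₁ d₂ d₃ p q r s t w : ℂ, d₀ ≠ 0 ∧ d₁ ≠ 0 ∧ d₂ ≠ 0 ∧ d₃ ≠ 0 ∧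
    d₀ * d₃ = d₁ * d₂ ∧ d₀ * w = p * d₂ ∧ d₀ * t - p * r + q * d₁ = 0 ∧
    m = !![d₀, 0, 0, 0; p, d₁, 0, 0; q, r, d₂, 0; s, t, w, d₃]

noncomputable def C2γ (k : Fin 2) (m : Matrix (Fin 4) (Fin 4) ℂ) : ℂ :=
  if k = 0 then m 0 0 / m 1 1 else m 1 1 / m 2 2

noncomputable def C2ε (k : Fin 2) (m : Matrix (Fin 4) (Fin 4) ℂ) : ℂ :=
  if k = 0 then m 1 0 / m 0 0 else m 2 1 / m 1 1

/-- Under the steps of the short root, `C2ε 1`, `C2R` and `C2S` change like the coefficients of a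
binary quadratic form under a shear. This makes them, with `C2ε 0`, a closed system of coordinates.
-/
noncomputable def C2R (m : Matrix (Fin 4) (Fin 4) ℂ) : ℂ := m 3 1 / m 1 1

noncomputable def C2S (m : Matrix (Fin 4) (Fin 4) ℂ) : ℂ :=
  (m 1 0 * m 3 1 - m 3 0 * m 1 1) / (m 0 0 * m 1 1)

/-- As for A₂, the entries of `m'` are read off from the matrix equation. The symplectic relations
are needed to eliminate the dependent entries of `m`. -/
theorem C2_step {m m' : Matrix (Fin 4) (Fin 4) ℂ} (k : Fin 2) (b : ℂ) (hm : C2B m)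
    (hm' : C2B m') (hb : 1 + b * C2ε k m ≠ 0)
    (h : C2x k b * m = m' * C2x k (b / (C2γ k m * (1 + b * C2ε k m)))) :
    C2ε k m' = C2ε k m / (1 + b * C2ε k m) ∧
    (∀ l, C2γ l m' =
      (1 + b * C2ε k m) ^ (if k = l then 2 else if k = 0 then -2 else -1 : ℤ) * C2γ l m) ∧
    (k = 0 → C2ε 1 m' = C2ε 1 m + 2 * b * C2R m + b ^ 2 * C2S m ∧ C2R m' = C2R m + b * C2S m ∧
      C2S m' = C2S m) ∧
    (k = 1 → C2ε 0 m' = C2ε 0 m + b * (C2ε 0 m * C2ε 1 m - C2R m) ∧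
      C2R m' = C2R m / (1 + b * C2ε 1 m) ∧
      C2S m' = (C2S m + b * (C2ε 1 m * C2S m - C2R m ^ 2)) / (1 + b * C2ε 1 m)) := by
  obtain ⟨d₀, d₁, d₂, d₃, p, q, r, s, t, w, h0, h1, h2, h3, g1, g2, g3, rfl⟩ := hm
  obtain ⟨D₀, D₁, D₂, D₃, P, Q, R, S, T, W, H0, H1, H2, H3, G1, G2, G3, rfl⟩ := hm'
  have h' := fun i j => congrFun (congrFun h i) j
  clear h
  fin_cases k
  · simp [C2ε, C2γ, C2x, C2R, C2S] at hb h' ⊢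
    simp [Fin.forall_fin_succ] at h'
    have hs : d₀ + b * p ≠ 0 := by rw [h'.1.1]; exact H0
    have e1 : b / (d₀ / d₁ * (1 + b * (p / d₀))) = b * d₁ / (d₀ + b * p) := by field_simp
    rw [e1] at h'
    -- Two of the similitude relations express `w` and `q` through the other entries.
    have e2 : w = p * d₂ / d₀ := by rw [eq_div_iff h0]; linear_combination g2
    have e3 : q = (p * r - d₀ * t) / d₁ := by rw [eq_div_iff h1]; linear_combination g3
    obtain ⟨⟨rfl, -⟩, ⟨rfl, hD⟩, ⟨rfl, hR, rfl, -⟩, rfl, hT, rfl, -⟩ := h'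
    have hD' : D₁ = d₀ * d₁ / (d₀ + b * p) := by
      rw [eq_sub_of_add_eq' hD.symm, sub_mul_div_eq _ hs]
    have hT' : T = t - s * (b * d₁ / (d₀ + b * p)) := by linear_combination -hT
    have hR' : R = r + b * t - (q + b * s) * (b * d₁ / (d₀ + b * p)) := by
      linear_combination -hR
    clear g1 g2 g3 G1 G2 G3 hT hR
    subst hD' hT' hR' e2 e3
    refine ⟨?_, ⟨?_, ?_⟩, ?_, ?_, ?_⟩
    · field_simp
    · field_simp
    · field_simp
    · field_simp
      ring
    · field_simp
      ring
    · rw [mul_div_cancel₀ _ hs]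
      congr 1
      linear_combination s * hD
  · simp [C2ε, C2γ, C2x, C2R, C2S] at hb h' ⊢
    simp [Fin.forall_fin_succ] at h'
    have hs : d₁ + b * r ≠ 0 := by rw [h'.2.1.2.1]; exact H1
    have e1 : b / (d₁ / d₂ * (1 + b * (r / d₁))) = b * d₂ / (d₁ + b * r) := by field_simp
    rw [e1] at h'
    have e3 : q = (p * r - d₀ * t) / d₁ := by rw [eq_div_iff h1]; linear_combination g3
    obtain ⟨rfl, ⟨rfl, rfl, -⟩, ⟨rfl, rfl, hD⟩, rfl, rfl, -, -⟩ := h'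
    have hD' : D₂ = d₁ * d₂ / (d₁ + b * r) := by
      rw [eq_sub_of_add_eq' hD.symm, sub_mul_div_eq _ hs]
    clear g1 g2 g3 G1 G2 G3 hD
    subst hD' e3
    refine ⟨?_, ⟨?_, ?_⟩, ?_, ?_, ?_⟩ <;> field_simp <;> ring

noncomputable def C2Model : RankTwoModel where
  n := 4
  a k l := if k = l then 2 else if k = 0 then -2 else -1
  x := C2x
  B := C2B
  γ := C2γ
  ε := C2ε
  -- All unitriangular matrices are allowed: they are closed under products and the superdiagonal
  -- entries are already additive on them, so the symplectic relations can be left out.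
  U g := ∃ a b c d e f : ℂ, g = !![1, a, c, e; 0, 1, b, d; 0, 0, 1, f; 0, 0, 0, 1]
  coeff k g := if k = 0 then g 0 1 else g 1 2
  Y k u := if k = 0 then !![u, 0, 0, 0; 1, u⁻¹, 0, 0; 0, 0, u, 0; 0, 0, 1, u⁻¹]
    else !![1, 0, 0, 0; 0, u, 0, 0; 0, 1, u⁻¹, 0; 0, 0, 0, 1]
  -- The last entry is forced by `d₀ d₃ = d₁ d₂`.
  torus g := !![g 0 * g 1, 0, 0, 0; 0, g 1, 0, 0; 0, 0, 1, 0; 0, 0, 0, (g 0)⁻¹]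
  a_self k := by simp
  x_zero k := by
    fin_cases k <;> simp [C2x] <;> ext i j <;> fin_cases i <;> fin_cases j <;> simp
  x_add k b b' := by fin_cases k <;> simp [C2x, add_comm]
  B_mul := by
    rintro _ _ ⟨d₀, d₁, d₂, d₃, p, q, r, s, t, w, h0, h1, h2, h3, g1, g2, g3, rfl⟩
      ⟨D₀, D₁, D₂, D₃, P, Q, R, S, T, W, H0, H1, H2, H3, G1, G2, G3, rfl⟩
    refine ⟨d₀ * D₀, d₁ * D₁, d₂ * D₂, d₃ * D₃, p * D₀ + d₁ * P, q * D₀ + r * P + d₂ * Q,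
      r * D₁ + d₂ * R, s * D₀ + t * P + w * Q + d₃ * S, t * D₁ + w * R + d₃ * T, w * D₂ + d₃ * W,
      mul_ne_zero h0 H0, mul_ne_zero h1 H1, mul_ne_zero h2 H2, mul_ne_zero h3 H3,
      ?_, ?_, ?_, by simp [add_assoc]⟩
    · linear_combination D₀ * D₃ * g1 + d₁ * d₂ * G1
    · linear_combination D₀ * D₂ * g2 + D₀ * W * g1 + d₁ * d₂ * G2
    · linear_combination D₀ * D₁ * g3 + D₀ * R * g2 + D₀ * T * g1 + d₁ * d₂ * G3
  B_det := by
    rintro _ ⟨d₀, d₁, d₂, d₃, p, q, r, s, t, w, h0, h1, h2, h3, g1, g2, g3, rfl⟩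
    rw [Matrix.det_of_isLowerTriangular]
    · simp [Fin.prod_univ_succ, h0, h1, h2, h3]
    · intro i j hij
      replace hij : i < j := hij
      fin_cases i <;> fin_cases j <;> simp at hij ⊢
  γ_ne := by
    rintro _ k ⟨d₀, d₁, d₂, d₃, p, q, r, s, t, w, h0, h1, h2, h3, g1, g2, g3, rfl⟩
    fin_cases k <;> simp [C2γ, h0, h1, h2]
  γ_mul := by
    rintro _ _ k ⟨d₀, d₁, d₂, d₃, p, q, r, s, t, w, h0, h1, h2, h3, -, -, -, rfl⟩
      ⟨D₀, D₁, D₂, D₃, P, Q, R, S, T, W, H0, H1, H2, H3, -, -, -, rfl⟩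
    fin_cases k <;> simp [C2γ] <;> field_simp
  ε_mul := by
    rintro _ _ k ⟨d₀, d₁, d₂, d₃, p, q, r, s, t, w, h0, h1, h2, h3, -, -, -, rfl⟩
      ⟨D₀, D₁, D₂, D₃, P, Q, R, S, T, W, H0, H1, H2, H3, -, -, -, rfl⟩
    fin_cases k <;> simp [C2γ, C2ε] <;> field_simp
  U_one := ⟨0, 0, 0, 0, 0, 0, by ext i j; fin_cases i <;> fin_cases j <;> simp⟩
  U_mul := by
    rintro _ _ ⟨a, b, c, d, e, f, rfl⟩ ⟨a', b', c', d', e', f', rfl⟩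
    exact ⟨a' + a, b' + b, c' + a * b' + c, d' + b * f' + d, e' + a * d' + c * f' + e, f' + f,
      by simp [add_assoc]⟩
  U_x k b := by
    fin_cases k
    · exact ⟨b, 0, 0, 0, 0, b, by simp [C2x]⟩
    · exact ⟨0, b, 0, 0, 0, 0, by simp [C2x]⟩
  coeff_one k := by fin_cases k <;> simp
  coeff_mul := by
    rintro _ _ k ⟨a, b, c, d, e, f, rfl⟩ ⟨a', b', c', d', e', f', rfl⟩
    fin_cases k <;> simp [add_comm]
  coeff_x k l b := by fin_cases k <;> fin_cases l <;> simp [C2x]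
  B_Y k u hu := by
    fin_cases k
    · exact ⟨u, u⁻¹, u, u⁻¹, 1, 0, 0, 0, 0, 1, hu, inv_ne_zero hu, hu, inv_ne_zero hu,
        by field_simp, by ring, by simp, by simp⟩
    · exact ⟨1, u, u⁻¹, 1, 0, 0, 1, 0, 0, 0, one_ne_zero, hu, inv_ne_zero hu, one_ne_zero,
        by field_simp, by ring, by simp, by simp⟩
  γ_Y k l u hu := by
    fin_cases k <;> fin_cases l <;> simp [C2γ, pow_two, div_eq_mul_inv]
  ε_Y k l u hu := by fin_cases k <;> fin_cases l <;> simp [C2ε]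
  x_Y k u b hu hb := by
    fin_cases k <;> simp [C2x] <;> field_simp <;> simp [add_comm]
  x_Y' k l u b hu hkl := by
    fin_cases k <;> fin_cases l <;> simp [C2x] at hkl ⊢ <;> field_simp
  B_torus g hg := ⟨g 0 * g 1, g 1, 1, (g 0)⁻¹, 0, 0, 0, 0, 0, 0, mul_ne_zero (hg 0) (hg 1), hg 1,
    one_ne_zero, inv_ne_zero (hg 0), by have := hg 0; field_simp, by simp, by simp, rfl⟩
  γ_torus g k hg := by
    have := hg 1
    fin_cases k <;> simp [C2γ, this]
  ε_torus g k hg := by fin_cases k <;> simp [C2ε]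
  x_torus g k b hg := by
    have h0 := hg 0
    have h1 := hg 1
    fin_cases k <;> simp [C2x] <;> field_simp <;> simp
  ε_step k b hm hm' hb h := (C2_step k b hm hm' hb h).1
  γ_step k l b hm hm' hb h := (C2_step k b hm hm' hb h).2.1 l

end C2

/-! ### Unipotent crystals of rank two -/

/-- The composites of steps along a word. -/
inductive Run {X : Type} (Step : Fin 2 → ℂ → X → X → Prop) : X → List (Fin 2 × ℂ) → X → Prop
  | nil (x : X) : Run Step x [] x
  | cons {k : Fin 2} {b : ℂ} {x y z : X} {w : List (Fin 2 × ℂ)} :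
      Step k b x y → Run Step y w z → Run Step x ((k, b) :: w) z

/-- `Step` is the restriction of a unipotent action compatible with the map `f` to the opposite
Borel subgroup. -/
structure Unipotent (R : RankTwoModel) {X : Type} (Step : Fin 2 → ℂ → X → X → Prop)
    (f : X → Matrix (Fin R.n) (Fin R.n) ℂ) : Prop where
  mem : ∀ x, R.B (f x)
  ne_zero : ∀ {k b x y}, Step k b x y → 1 + b * R.ε k (f x) ≠ 0
  step : ∀ {k b x y}, Step k b x y →
    R.x k b * f x = f y * R.x k (b / (R.γ k (f x) * (1 + b * R.ε k (f x))))
  unique : ∀ {x w w' z z'}, Run Step x w z → Run Step x w' z' →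
    R.wordMatrix w = R.wordMatrix w' → z = z'

theorem RankTwoModel.cancel (R : RankTwoModel) {m u v : Matrix (Fin R.n) (Fin R.n) ℂ}
    (hm : R.B m) (h : m * u = m * v) : u = v := by
  have hu : IsUnit m.det := isUnit_iff_ne_zero.2 (R.B_det hm)
  calc u = m⁻¹ * (m * u) := by rw [← mul_assoc, Matrix.nonsing_inv_mul _ hu, one_mul]
    _ = v := by rw [h, ← mul_assoc, Matrix.nonsing_inv_mul _ hu, one_mul]

namespace Unipotent

variable {R : RankTwoModel} {X Y Z : Type} {SX : Fin 2 → ℂ → X → X → Prop}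
  {SY : Fin 2 → ℂ → Y → Y → Prop} {SZ : Fin 2 → ℂ → Z → Z → Prop}
  {fX : X → Matrix (Fin R.n) (Fin R.n) ℂ} {fY : Y → Matrix (Fin R.n) (Fin R.n) ℂ}

/-- Moving `fX` past one letter after the other changes the word that acts on the first factor into
the word that acts on the second. The last identity records the effect on the matrices. -/
theorem run_prod (hX : Unipotent R SX fX) {p : Z → X} {q : Z → Y}
    (hS : ∀ k b z z', SZ k b z z' → SX k b (p z) (p z') ∧
      SY k (b / (R.γ k (fX (p z)) * (1 + b * R.ε k (fX (p z))))) (q z) (q z'))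
    {z z' : Z} {w : List (Fin 2 × ℂ)} (h : Run SZ z w z') :
    ∃ w', Run SX (p z) w (p z') ∧ Run SY (q z) w' (q z') ∧
      R.wordMatrix w * fX (p z) = fX (p z') * R.wordMatrix w' := by
  induction h with
  | nil x => exact ⟨[], Run.nil _, Run.nil _, by simp [RankTwoModel.wordMatrix]⟩
  | cons hs _ ih =>
    obtain ⟨w', h1, h2, h3⟩ := ih
    obtain ⟨s1, s2⟩ := hS _ _ _ _ hs
    refine ⟨_ :: w', Run.cons s1 h1, Run.cons s2 h2, ?_⟩
    simp only [RankTwoModel.wordMatrix]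
    rw [mul_assoc, hX.step s1, ← mul_assoc, h3, mul_assoc]

/-- The product of two unipotent crystals. -/
theorem prod (hX : Unipotent R SX fX) (hY : Unipotent R SY fY) (p : Z → X) (q : Z → Y)
    (hpq : ∀ z z', p z = p z' → q z = q z' → z = z')
    (hS : ∀ k b z z', SZ k b z z' → SX k b (p z) (p z') ∧
      SY k (b / (R.γ k (fX (p z)) * (1 + b * R.ε k (fX (p z))))) (q z) (q z')) :
    Unipotent R SZ fun z => fX (p z) * fY (q z) := by
  -- Cocycle property: the number `1 + b ε` of the product is the product of the corresponding
  -- numbers for the two induced steps.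
  have hε : ∀ {k b} (z : Z), 1 + b * R.ε k (fX (p z)) ≠ 0 →
      1 + b * R.ε k (fX (p z) * fY (q z)) = (1 + b * R.ε k (fX (p z))) *
      (1 + b / (R.γ k (fX (p z)) * (1 + b * R.ε k (fX (p z)))) * R.ε k (fY (q z))) := by
    intro k b z h
    have h1 := R.γ_ne k (hX.mem (p z))
    rw [R.ε_mul k (hX.mem _) (hY.mem _)]
    field_simp
    ring
  refine ⟨fun z => R.B_mul (hX.mem _) (hY.mem _), fun {k b z z'} h => ?_, fun {k b z z'} h => ?_,
    fun {z w w' z₁ z₂} h h' hw => ?_⟩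
  · obtain ⟨s1, s2⟩ := hS _ _ _ _ h
    rw [hε z (hX.ne_zero s1)]
    exact mul_ne_zero (hX.ne_zero s1) (hY.ne_zero s2)
  · obtain ⟨s1, s2⟩ := hS _ _ _ _ h
    rw [← mul_assoc, hX.step s1, mul_assoc, hY.step s2, ← mul_assoc, hε z (hX.ne_zero s1),
      R.γ_mul k (hX.mem _) (hY.mem _)]
    congr 2
    rw [div_div]
    congr 1
    ring
  · obtain ⟨v, h1, h2, h3⟩ := run_prod hX hS h
    obtain ⟨v', h1', h2', h3'⟩ := run_prod hX hS h'
    have e1 : p z₁ = p z₂ := hX.unique h1 h1' hw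
    -- The endpoints in the first factor agree, and `fX` is invertible there, so the transformed
    -- words also have equal matrices.
    refine hpq _ _ e1 (hY.unique h2 h2' (R.cancel (hX.mem (p z₁)) ?_))
    rw [← h3, hw, h3', e1]

/-- A set on which the unipotent group acts trivially. -/
theorem trivial {K : Type} (g : K → Fin 2 → ℂ) (hg : ∀ x k, g x k ≠ 0) :
    Unipotent R (fun _ _ (x y : K) => y = x) fun x => R.torus (g x) := by
  refine ⟨fun x => R.B_torus _ (hg x), fun {k b x y} _ => ?_, fun {k b x y} h => ?_,
    fun {x w w' z z'} h h' _ => ?_⟩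
  · rw [R.ε_torus _ _ (hg x)]
    simp
  · subst h
    rw [R.ε_torus _ _ (hg _), R.γ_torus _ _ (hg _), R.x_torus _ _ _ (hg _)]
    simp
  · have key : ∀ {x z w}, Run (fun _ _ (x y : K) => y = x) x w z → z = x := by
      intro x z w h
      induction h with
      | nil => rfl
      | cons h1 _ ih => rw [ih, h1]
    rw [key h, key h']

/-- The one-dimensional crystal of a simple root. -/
theorem letter (l : Fin 2) :
    Unipotent R (fun k b (u v : {u : ℂ // 0 < u}) => (v : ℂ) = if k = l then u + b else u)
      fun u => R.Y l u := by
  have key : ∀ {k b} {u v : {u : ℂ // 0 < u}}, ((v : ℂ) = if k = l then (u : ℂ) + b else u) →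
      1 + b * R.ε k (R.Y l u) = v / u := by
    intro k b u v h
    have hu := u.2.ne'
    rw [R.ε_Y _ _ _ hu, h]
    split_ifs <;> field_simp
    simp
  refine ⟨fun x => R.B_Y _ _ x.2.ne', fun {k b u v} h => ?_, fun {k b u v} h => ?_,
    fun {x w w' z z'} h h' hw => ?_⟩
  · rw [key h]
    exact div_ne_zero v.2.ne' u.2.ne'
  · rw [key h, R.γ_Y _ _ _ u.2.ne']
    have hu := u.2.ne'
    have hv := v.2.ne'
    by_cases hk : k = l
    · subst hk
      rw [if_pos rfl] at h
      rw [h] at hv ⊢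
      rw [R.x_Y _ _ _ hu hv, R.a_self]
      congr 2
      have : ((u : ℂ)) ^ (2 : ℤ) = (u : ℂ) ^ 2 := zpow_ofNat _ 2
      rw [this]
      field_simp
    · rw [if_neg hk] at h
      rw [h, R.x_Y' _ _ _ _ hu hk, div_self hu, mul_one]
  -- Along a run, `u` grows by the simple coordinate of the word matrix, so its final value depends
  -- on the matrix only.
  · have run : ∀ {x z w}, Run (fun k b (u v : {u : ℂ // 0 < u}) =>
        (v : ℂ) = if k = l then (u : ℂ) + b else u) x w z →
        R.U (R.wordMatrix w) ∧ (z : ℂ) = x + R.coeff l (R.wordMatrix w) := by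
      intro x z w h
      induction h with
      | nil => exact ⟨R.U_one, by simp [RankTwoModel.wordMatrix, R.coeff_one]⟩
      | cons h1 _ ih =>
        refine ⟨R.U_mul ih.1 (R.U_x _ _), ?_⟩
        simp only [RankTwoModel.wordMatrix]
        rw [R.coeff_mul _ ih.1 (R.U_x _ _), R.coeff_x, ih.2, h1]
        split_ifs <;> ring
    exact Subtype.ext (by rw [(run h).2, (run h').2, hw])

end Unipotent

/-- The points of a torus with positive coordinates. -/
abbrev PosPts (ι : Type) : Type := {x : ι → ℂˣ // PosPt x}

/-! ### Pairs of indices induced by unipotent crystals. -/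

namespace CrystalData

variable {I ι κ : Type}

/-- `y` is obtained from `x` by the action of the element `exp(b e_i)`, where `i = idx k`. -/
def Step (D : CrystalData I ι) (idx : Fin 2 → I) (k : Fin 2) (b : ℂ) (x y : PosPts ι) : Prop :=
  ∃ c : ℂˣ, 0 < (c : ℂ) ∧ (c : ℂ) = 1 + b * D.ε (idx k) x.1 ∧ y.1 = D.e (idx k) c x.1

/-- For two indices, `D` is induced by a unipotent crystal. -/
def IsUnipotentPair (R : RankTwoModel) (D : CrystalData I ι) (idx : Fin 2 → I) : Prop :=
  ∃ f : PosPts ι → Matrix (Fin R.n) (Fin R.n) ℂ, Unipotent R (D.Step idx) f ∧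
    ∀ k x, D.ε (idx k) x.1 = R.ε k (f x) ∧ D.γ (idx k) x.1 = R.γ k (f x)

theorem φ_pos {D : CrystalData I ι} (hD : D.IsPositive) (i : I) {x : ι → ℂˣ} (hx : PosPt x) :
    0 < D.φ i x := mul_pos (hD.γ_pos i x hx) (hD.ε_pos i x hx)

/-- If `c = 1 + b ε` on the product, then `c₁ = 1 + b ε(x)`, and `c / c₁ = 1 + b' ε(y)` with `b' = b
/ (γ(x) c₁)`. So the product formulas are the action of one root element, carried from the first
factor to the second. -/
theorem IsUnipotentPair.prod {R : RankTwoModel} {D : CrystalData I ι} {D' : CrystalData I κ}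
    {idx : Fin 2 → I} (h : IsUnipotentPair R D idx) (h' : IsUnipotentPair R D' idx)
    (hD : D.IsPositive) (hD' : D'.IsPositive) : IsUnipotentPair R (D.prod D') idx := by
  obtain ⟨f, hf, hf'⟩ := h
  obtain ⟨g, hg, hg'⟩ := h'
  let p : PosPts (ι ⊕ κ) → PosPts ι := fun z => ⟨z.1 ∘ Sum.inl, fun j => z.2 _⟩
  let q : PosPts (ι ⊕ κ) → PosPts κ := fun z => ⟨z.1 ∘ Sum.inr, fun j => z.2 _⟩
  refine ⟨_, hf.prod hg p q (fun z z' h1 h2 => ?_) fun k b z z' h => ?_, fun k x => ⟨?_, ?_⟩⟩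
  · refine Subtype.ext (funext fun j => ?_)
    cases j with
    | inl j => exact congrFun (congrArg Subtype.val h1) j
    | inr j => exact congrFun (congrArg Subtype.val h2) j
  · obtain ⟨c, hc, hc', hz⟩ := h
    have hφ := φ_pos hD (idx k) (p z).2
    have hε := hD.ε_pos (idx k) _ (p z).2
    have hγ := hD.γ_pos (idx k) _ (p z).2
    have hε' := hD'.ε_pos (idx k) _ (q z).2
    have hc1 : 0 < (c * D.φ (idx k) (p z).1 + D'.ε (idx k) (q z).1) /
      (D.φ (idx k) (p z).1 + D'.ε (idx k) (q z).1) := by positivity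
    have e1 : (c : ℂ) = 1 + b * (D.ε (idx k) (p z).1 + D.ε (idx k) (p z).1 *
      D'.ε (idx k) (q z).1 / D.φ (idx k) (p z).1) := hc'
    have e2 : (c * D.φ (idx k) (p z).1 + D'.ε (idx k) (q z).1) /
      (D.φ (idx k) (p z).1 + D'.ε (idx k) (q z).1) = 1 + b * D.ε (idx k) (p z).1 := by
      rw [e1, div_eq_iff (by positivity)]
      field_simp
      ring
    rw [← (hf' k (p z)).1, ← (hf' k (p z)).2, ← e2]
    refine ⟨⟨_, unitOf_pos hc1, by rw [coe_unitOf hc1.ne', e2], ?_⟩,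
      ⟨_, div_coe_pos hc (unitOf_pos hc1), ?_, ?_⟩⟩
    · change z'.1 ∘ Sum.inl = _
      rw [hz]
      rfl
    · rw [Units.val_div_eq_div_val, coe_unitOf hc1.ne', div_eq_iff hc1.ne', add_mul, one_mul,
        mul_right_comm, div_mul_eq_mul_div, mul_div_mul_right _ _ hc1.ne', e2, e1, φ]
      field_simp
      ring
    · change z'.1 ∘ Sum.inr = _
      rw [hz]
      rfl
  · rw [R.ε_mul _ (hf.mem _) (hg.mem _), ← (hf' _ _).1, ← (hf' _ _).2, ← (hg' _ _).1]
    have hγ := hD.γ_pos (idx k) _ (p x).2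
    have hε := hD.ε_pos (idx k) _ (p x).2
    change D.ε (idx k) (p x).1 + D.ε (idx k) (p x).1 * D'.ε (idx k) (q x).1 /
      (D.γ (idx k) (p x).1 * D.ε (idx k) (p x).1) = _
    congr 1
    field_simp
  · rw [R.γ_mul _ (hf.mem _) (hg.mem _), ← (hf' _ _).2, ← (hg' _ _).2]
    rfl

/-- A crystal with an equivariant map to a unipotent crystal, and with sufficiently many
invariants. -/
theorem IsUnipotentPair.of_map {R : RankTwoModel} {J K : Type} {D : CrystalData I ι}
    {D' : CrystalData J κ} {idx : Fin 2 → I} {idx' : Fin 2 → J} (h : IsUnipotentPair R D' idx')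
    (Φ : (ι → ℂˣ) → (κ → ℂˣ)) (hΦ : ∀ x, PosPt x → PosPt (Φ x)) (inv : (ι → ℂˣ) → K)
    (g : K → Fin 2 → ℂ) (hg : ∀ x k, PosPt x → g (inv x) k ≠ 0)
    (hinj : ∀ x y, PosPt x → PosPt y → Φ x = Φ y → inv x = inv y → x = y)
    (he : ∀ k (c : ℂˣ) x, 0 < (c : ℂ) → PosPt x → Φ (D.e (idx k) c x) = D'.e (idx' k) c (Φ x))
    (hinv : ∀ k (c : ℂˣ) x, 0 < (c : ℂ) → PosPt x → inv (D.e (idx k) c x) = inv x)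
    (hε : ∀ k x, PosPt x → D.ε (idx k) x = D'.ε (idx' k) (Φ x))
    (hγ : ∀ k x, PosPt x → D.γ (idx k) x = D'.γ (idx' k) (Φ x) * g (inv x) k) :
    IsUnipotentPair R D idx := by
  classical
  obtain ⟨f, hf, hf'⟩ := h
  -- `g` may vanish at elements of `K` that are not invariants of positive points, whereas a torus
  -- element is needed at every element of `K`.
  let g' : K → Fin 2 → ℂ := fun x k => if g x k = 0 then 1 else g x k
  have hg' : ∀ x k, g' x k ≠ 0 := fun x k => by
    simp only [g']
    split_ifs with h
    · exact one_ne_zero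
    · exact h
  refine ⟨_, hf.prod (Unipotent.trivial g' hg') (fun x => ⟨Φ x.1, hΦ _ x.2⟩)
    (fun x => inv x.1) (fun x y h1 h2 => ?_) fun k b x y h => ?_, fun k x => ⟨?_, ?_⟩⟩
  · exact Subtype.ext (hinj _ _ x.2 y.2 (congrArg Subtype.val h1) h2)
  · obtain ⟨c, hc, hc', hy⟩ := h
    refine ⟨⟨c, hc, ?_, ?_⟩, ?_⟩
    · rw [hc', hε k _ x.2]
    · change Φ y.1 = _
      rw [hy, he k c _ hc x.2]
    · rw [hy, hinv k c _ hc x.2]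
  · rw [R.ε_mul _ (hf.mem _) (R.B_torus _ (hg' _)), R.ε_torus _ _ (hg' _), ← (hf' _ _).1,
      hε k _ x.2, zero_div, add_zero]
  · rw [R.γ_mul _ (hf.mem _) (R.B_torus _ (hg' _)), R.γ_torus _ _ (hg' _), ← (hf' _ _).2,
      hγ k _ x.2]
    simp only [g', if_neg (hg _ _ x.2)]

end CrystalData

/-! ### The relations of rank two, from identities in the unipotent group. -/

namespace CrystalData

variable {I ι : Type} {R : RankTwoModel} {D : CrystalData I ι} {idx : Fin 2 → I}

/-- The element `b` such that the action of `exp(b e_i)` at `x` is that of `e_i^c`. -/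
noncomputable def expParam (D : CrystalData I ι) (i : I) (c : ℂˣ) (x : ι → ℂˣ) : ℂ :=
  (c - 1) / D.ε i x

theorem one_add_expParam (hD : D.IsPositive) (i : I) (c : ℂˣ) {x : ι → ℂˣ} (hx : PosPt x) :
    1 + D.expParam i c x * D.ε i x = c := by
  rw [expParam, div_mul_cancel₀ _ (hD.ε_pos i x hx).ne']
  ring

theorem IsPositive.step (hD : D.IsPositive) (k : Fin 2) {c : ℂˣ} {x : ι → ℂˣ} (hc : 0 < (c : ℂ))
    (hx : PosPt x) : D.Step idx k (D.expParam (idx k) c x) ⟨x, hx⟩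
      ⟨D.e (idx k) c x, hD.e_pos _ hc hx⟩ :=
  ⟨c, hc, (one_add_expParam hD _ _ hx).symm, rfl⟩

namespace IsUnipotentPair

/-- The parameter of `c = 1` is 0, so the run of one letter has the same matrix as the empty run. -/
theorem e_one (h : IsUnipotentPair R D idx) (hD : D.IsPositive) (k : Fin 2) (x : ι → ℂˣ)
    (hx : PosPt x) : D.e (idx k) 1 x = x := by
  obtain ⟨f, hf, hf'⟩ := h
  have h1 := hf.unique (w' := []) (Run.cons (hD.step k (c := 1) (by simp) hx) (Run.nil _))
    (Run.nil (⟨x, hx⟩ : PosPts ι)) (by simp [RankTwoModel.wordMatrix, expParam, R.x_zero])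
  exact congrArg Subtype.val h1

theorem ε_e (h : IsUnipotentPair R D idx) (hD : D.IsPositive) (k : Fin 2) {c : ℂˣ} (hc : 0 < (c : ℂ))
    (x : ι → ℂˣ) (hx : PosPt x) : D.ε (idx k) (D.e (idx k) c x) = D.ε (idx k) x / c := by
  obtain ⟨f, hf, hf'⟩ := h
  have hs := hD.step (idx := idx) k hc hx
  have := R.ε_step k _ (hf.mem _) (hf.mem _) (hf.ne_zero hs) (hf.step hs)
  rwa [← (hf' _ _).1, ← (hf' _ _).1, one_add_expParam hD _ _ hx] at this

theorem γ_e (h : IsUnipotentPair R D idx) (hD : D.IsPositive) (k l : Fin 2) {c : ℂˣ}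
    (hc : 0 < (c : ℂ)) (x : ι → ℂˣ) (hx : PosPt x) :
    D.γ (idx l) (D.e (idx k) c x) = (c : ℂ) ^ R.a k l * D.γ (idx l) x := by
  obtain ⟨f, hf, hf'⟩ := h
  have hs := hD.step (idx := idx) k hc hx
  have := R.γ_step k l _ (hf.mem _) (hf.mem _) (hf.ne_zero hs) (hf.step hs)
  rwa [← (hf' _ _).2, ← (hf' _ _).2, ← (hf' _ _).1, one_add_expParam hD _ _ hx] at this

theorem e_mul (h : IsUnipotentPair R D idx) (hD : D.IsPositive) (k : Fin 2) {c d : ℂˣ}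
    (hc : 0 < (c : ℂ)) (hd : 0 < (d : ℂ)) (x : ι → ℂˣ) (hx : PosPt x) :
    D.e (idx k) c (D.e (idx k) d x) = D.e (idx k) (c * d) x := by
  have hε := h.ε_e hD k hd x hx
  obtain ⟨f, hf, hf'⟩ := h
  have h1 := hf.unique (Run.cons (hD.step k hd hx)
      (Run.cons (hD.step k hc (hD.e_pos _ hd hx)) (Run.nil _)))
    (Run.cons (hD.step k (mul_coe_pos hc hd) hx) (Run.nil _)) (by
      simp only [RankTwoModel.wordMatrix, one_mul]
      rw [← R.x_add]
      congr 1
      -- After `e^d` the value of `ε` is `ε / d`, so the parameters `(d - 1) / ε` and `(c - 1) d /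
      -- ε` add up to `(cd - 1) / ε`.
      simp only [expParam, hε, Units.val_mul]
      have := (hD.ε_pos (idx k) x hx).ne'
      field_simp
      ring)
  exact congrArg Subtype.val h1

end IsUnipotentPair

/-- One step of the coordinate matrices of a unipotent pair. -/
theorem IsUnipotentPair.matrix_step {f : PosPts ι → Matrix (Fin R.n) (Fin R.n) ℂ}
    (hf : Unipotent R (D.Step idx) f)
    (hf' : ∀ k x, D.ε (idx k) x.1 = R.ε k (f x) ∧ D.γ (idx k) x.1 = R.γ k (f x))
    (hD : D.IsPositive) (k : Fin 2) {c : ℂˣ} {x : ι → ℂˣ} (hc : 0 < (c : ℂ)) (hx : PosPt x) :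
    1 + D.expParam (idx k) c x * R.ε k (f ⟨x, hx⟩) = c ∧
      R.B (f ⟨x, hx⟩) ∧ R.B (f ⟨D.e (idx k) c x, hD.e_pos _ hc hx⟩) ∧
      1 + D.expParam (idx k) c x * R.ε k (f ⟨x, hx⟩) ≠ 0 ∧
      R.x k (D.expParam (idx k) c x) * f ⟨x, hx⟩ = f ⟨D.e (idx k) c x, hD.e_pos _ hc hx⟩ *
        R.x k (D.expParam (idx k) c x /
          (R.γ k (f ⟨x, hx⟩) * (1 + D.expParam (idx k) c x * R.ε k (f ⟨x, hx⟩)))) := by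
  have hs := hD.step (idx := idx) k hc hx
  exact ⟨by rw [← (hf' _ _).1, one_add_expParam hD _ _ hx], hf.mem _, hf.mem _, hf.ne_zero hs,
    hf.step hs⟩

theorem IsUnipotentPair.run_unique (h : IsUnipotentPair R D idx) {x z z' : PosPts ι}
    {w w' : List (Fin 2 × ℂ)} (hw : Run (D.Step idx) x w z) (hw' : Run (D.Step idx) x w' z')
    (hww' : R.wordMatrix w = R.wordMatrix w') : z.1 = z'.1 := by
  obtain ⟨f, hf, -⟩ := h
  rw [hf.unique hw hw' hww']

/-- Each action leaves the other `ε` unchanged, so both orders use the same two parameters, and the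
two root subgroups commute. -/
theorem IsUnipotentPair.braid_A1A1 (h : IsUnipotentPair A1A1Model D idx) (hD : D.IsPositive)
    {c d : ℂˣ} (hc : 0 < (c : ℂ)) (hd : 0 < (d : ℂ)) (x : ι → ℂˣ) (hx : PosPt x) :
    D.e (idx 0) c (D.e (idx 1) d x) = D.e (idx 1) d (D.e (idx 0) c x) := by
  have key : ∀ (k l : Fin 2) (c : ℂˣ) (hc : 0 < (c : ℂ)), l ≠ k →
      D.ε (idx l) (D.e (idx k) c x) = D.ε (idx l) x := fun k l c hc hl => by
    obtain ⟨f, hf, hf'⟩ := h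
    obtain ⟨-, s1, s2, s3, s4⟩ := matrix_step hf hf' hD k hc hx
    have := (A1A1_step k _ s1 s2 s3 s4).2.2 l hl
    exact ((hf' l ⟨_, hD.e_pos _ hc hx⟩).1.trans this).trans (hf' l ⟨x, hx⟩).1.symm
  refine h.run_unique (Run.cons (hD.step 1 hd hx)
      (Run.cons (hD.step 0 hc (hD.e_pos _ hd hx)) (Run.nil _)))
    (Run.cons (hD.step 0 hc hx) (Run.cons (hD.step 1 hd (hD.e_pos _ hc hx)) (Run.nil _))) ?_
  simp only [RankTwoModel.wordMatrix, expParam, key 1 0 d hd (by decide),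
    key 0 1 c hc (by decide), one_mul]
  change A1A1x 0 _ * A1A1x 1 _ = A1A1x 1 _ * A1A1x 0 _
  simp [A1A1x]

/-- The coordinate of the flag of a unipotent crystal of type `A₂` that is not an `ε`. -/
noncomputable def A2P (m : Matrix (Fin 3) (Fin 3) ℂ) : ℂ := m 2 0 / m 0 0

/-- Supplies the third coordinate of `A2_step` as a function on the crystal, so that `ε` can be
followed through several actions. Its value 0 off the positive points plays no role. -/
theorem IsUnipotentPair.exists_A2 (h : IsUnipotentPair A2Model D idx) (hD : D.IsPositive) :
    ∃ p : (ι → ℂˣ) → ℂ, ∀ (c : ℂˣ) (x : ι → ℂˣ), 0 < (c : ℂ) → PosPt x →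
      (D.ε (idx 1) (D.e (idx 0) c x) = D.ε (idx 1) x + (c - 1) / D.ε (idx 0) x *
        (D.ε (idx 0) x * D.ε (idx 1) x - p x) ∧ p (D.e (idx 0) c x) = p x / c) ∧
      (D.ε (idx 0) (D.e (idx 1) c x) = D.ε (idx 0) x + (c - 1) / D.ε (idx 1) x * p x ∧
        p (D.e (idx 1) c x) = p x) := by
  classical
  obtain ⟨f, hf, hf'⟩ := h
  refine ⟨fun x => if hx : PosPt x then A2P (f ⟨x, hx⟩) else 0, fun c x hc hx => ?_⟩
  obtain ⟨e0, s1, s2, s3, s4⟩ := matrix_step hf hf' hD 0 hc hx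
  obtain ⟨e1, t1, t2, t3, t4⟩ := matrix_step hf hf' hD 1 hc hx
  have h0 := (A2_step 0 _ s1 s2 s3 s4).2.2.1 rfl
  have h1 := (A2_step 1 _ t1 t2 t3 t4).2.2.2 rfl
  change 1 + _ * A2ε 0 (f ⟨x, hx⟩) = _ at e0
  rw [e0] at h0
  simp only [dif_pos hx, dif_pos (hD.e_pos _ hc hx)]
  have a0 := (hf' 0 ⟨x, hx⟩).1
  have a1 := (hf' 1 ⟨x, hx⟩).1
  change _ = A2ε 0 _ at a0
  change _ = A2ε 1 _ at a1
  rw [← a0, ← a1] at h0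
  rw [← a0] at h1
  exact ⟨⟨(hf' 1 ⟨_, hD.e_pos _ hc hx⟩).1.trans h0.1, h0.2⟩,
    ⟨(hf' 0 ⟨_, hD.e_pos _ hc hx⟩).1.trans h1.1, h1.2⟩⟩

/-- Both sides are ends of runs from `x`, so it suffices that the word matrices agree: an instance
of `x₀ x₁ x₀ = x₁ x₀ x₁` with the parameters found along the two runs. -/
theorem IsUnipotentPair.braid_A2 (h : IsUnipotentPair A2Model D idx) (hD : D.IsPositive)
    {c d : ℂˣ} (hc : 0 < (c : ℂ)) (hd : 0 < (d : ℂ)) (x : ι → ℂˣ) (hx : PosPt x) :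
    D.e (idx 0) d (D.e (idx 1) (c * d) (D.e (idx 0) c x)) =
      D.e (idx 1) c (D.e (idx 0) (c * d) (D.e (idx 1) d x)) := by
  have hcd := mul_coe_pos hc hd
  have x1 := hD.e_pos (idx 0) hc hx
  have x2 := hD.e_pos (idx 1) hcd x1
  have y1 := hD.e_pos (idx 1) hd hx
  have y2 := hD.e_pos (idx 0) hcd y1
  refine h.run_unique (Run.cons (hD.step 0 hc hx) (Run.cons (hD.step 1 hcd x1)
      (Run.cons (hD.step 0 hd x2) (Run.nil _))))
    (Run.cons (hD.step 1 hd hx) (Run.cons (hD.step 0 hcd y1)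
      (Run.cons (hD.step 1 hc y2) (Run.nil _)))) ?_
  obtain ⟨p, hp⟩ := h.exists_A2 hD
  have a1 := h.ε_e hD 0 hc x hx
  have b1 := h.ε_e hD 1 hd x hx
  have a2 := (hp c x hc hx).1
  have b2 := (hp d x hd hx).2
  have a3 := (hp (c * d) _ hcd x1).2.1
  have b3 := (hp (c * d) _ hcd y1).1.1
  have n1 := (hD.ε_pos (idx 1) _ x1).ne'
  have n3 := (hD.ε_pos (idx 0) _ y1).ne'
  have he := (hD.ε_pos (idx 0) x hx).ne'
  have hf := (hD.ε_pos (idx 1) x hx).ne'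
  have hc' := c.ne_zero
  have hd' := d.ne_zero
  simp only [RankTwoModel.wordMatrix, expParam, one_mul]
  rw [a1, a2.2] at a3
  rw [b1, b2.2] at b3
  rw [a3, b3]
  replace a2 := a2.1
  replace b2 := b2.1
  simp only [Units.val_mul] at a3 b3 ⊢
  generalize D.ε (idx 1) (D.e (idx 0) c x) = f₁ at *
  generalize D.ε (idx 0) (D.e (idx 1) d x) = e₁ at *
  generalize D.ε (idx 0) x = e at *
  generalize D.ε (idx 1) x = f at *
  generalize p x = q at *
  generalize (c : ℂ) = c at *
  generalize (d : ℂ) = d at *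
  -- `N` and `M` are the numerators of the intermediate values of `ε`. They are non-zero because `ε`
  -- is positive at positive points, and naming them makes all later denominators monomials.
  obtain ⟨N, hN⟩ : ∃ N, N = q + c * (e * f - q) := ⟨_, rfl⟩
  obtain ⟨M, hM⟩ : ∃ M, M = e * f - q + d * q := ⟨_, rfl⟩
  have a2' : f₁ = N / e := by rw [a2, hN]; field_simp; ring
  have b2' : e₁ = M / f := by rw [b2, hM]; field_simp; ring
  have hN0 : N ≠ 0 := fun h0 => n1 (by rw [a2', h0, zero_div])
  have hM0 : M ≠ 0 := fun h0 => n3 (by rw [b2', h0, zero_div])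
  have a3' : e / c + (c * d - 1) / f₁ * (q / c) = e * M / N := by
    rw [a2']; field_simp; rw [hN, hM]; ring
  have b3' : f / d + (c * d - 1) / e₁ * (e₁ * (f / d) - q) = f * N / M := by
    rw [b2']; field_simp; rw [hN, hM]; ring
  rw [a3', b3', a2', b2']
  change A2x 0 _ * A2x 1 _ * A2x 0 _ = A2x 1 _ * A2x 0 _ * A2x 1 _
  simp [A2x]
  refine ⟨⟨?_, ?_⟩, ?_⟩ <;> field_simp <;> rw [hN, hM] <;> ring

theorem IsUnipotentPair.exists_C2 (h : IsUnipotentPair C2Model D idx) (hD : D.IsPositive) :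
    ∃ r s : (ι → ℂˣ) → ℂ, ∀ (c : ℂˣ) (x : ι → ℂˣ), 0 < (c : ℂ) → PosPt x →
      (D.ε (idx 1) (D.e (idx 0) c x) = D.ε (idx 1) x + 2 * ((c - 1) / D.ε (idx 0) x) * r x +
          ((c - 1) / D.ε (idx 0) x) ^ 2 * s x ∧
        r (D.e (idx 0) c x) = r x + (c - 1) / D.ε (idx 0) x * s x ∧
        s (D.e (idx 0) c x) = s x) ∧
      (D.ε (idx 0) (D.e (idx 1) c x) = D.ε (idx 0) x + (c - 1) / D.ε (idx 1) x *
          (D.ε (idx 0) x * D.ε (idx 1) x - r x) ∧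
        r (D.e (idx 1) c x) = r x / c ∧
        s (D.e (idx 1) c x) = (s x + (c - 1) / D.ε (idx 1) x *
          (D.ε (idx 1) x * s x - r x ^ 2)) / c) := by
  classical
  obtain ⟨f, hf, hf'⟩ := h
  refine ⟨fun x => if hx : PosPt x then C2R (f ⟨x, hx⟩) else 0,
    fun x => if hx : PosPt x then C2S (f ⟨x, hx⟩) else 0, fun c x hc hx => ?_⟩
  obtain ⟨e0, s1, s2, s3, s4⟩ := matrix_step hf hf' hD 0 hc hx
  obtain ⟨e1, t1, t2, t3, t4⟩ := matrix_step hf hf' hD 1 hc hx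
  have h0 := (C2_step 0 _ s1 s2 s3 s4).2.2.1 rfl
  have h1 := (C2_step 1 _ t1 t2 t3 t4).2.2.2 rfl
  change 1 + _ * C2ε 1 (f ⟨x, hx⟩) = _ at e1
  rw [e1] at h1
  simp only [dif_pos hx, dif_pos (hD.e_pos _ hc hx)]
  have a0 := (hf' 0 ⟨x, hx⟩).1
  have a1 := (hf' 1 ⟨x, hx⟩).1
  change _ = C2ε 0 _ at a0
  change _ = C2ε 1 _ at a1
  rw [← a1] at h0
  rw [← a0, ← a1] at h1
  exact ⟨⟨(hf' 1 ⟨_, hD.e_pos _ hc hx⟩).1.trans h0.1, h0.2⟩,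
    ⟨(hf' 0 ⟨_, hD.e_pos _ hc hx⟩).1.trans h1.1, h1.2⟩⟩

/-- The same argument with words of length four: the parameters are followed by means of
`exists_C2`, and the claim becomes `x₀ x₁ x₀ x₁ = x₁ x₀ x₁ x₀` for explicit parameters. -/
theorem IsUnipotentPair.braid_C2 (h : IsUnipotentPair C2Model D idx) (hD : D.IsPositive)
    {c d : ℂˣ} (hc : 0 < (c : ℂ)) (hd : 0 < (d : ℂ)) (x : ι → ℂˣ) (hx : PosPt x) :
    D.e (idx 0) c (D.e (idx 1) (c ^ 2 * d) (D.e (idx 0) (c * d) (D.e (idx 1) d x))) =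
      D.e (idx 1) d (D.e (idx 0) (c * d) (D.e (idx 1) (c ^ 2 * d) (D.e (idx 0) c x))) := by
  have hcd := mul_coe_pos hc hd
  have hccd := mul_coe_pos (pow_coe_pos hc 2) hd
  have x1 := hD.e_pos (idx 1) hd hx
  have x2 := hD.e_pos (idx 0) hcd x1
  have x3 := hD.e_pos (idx 1) hccd x2
  have y1 := hD.e_pos (idx 0) hc hx
  have y2 := hD.e_pos (idx 1) hccd y1
  have y3 := hD.e_pos (idx 0) hcd y2
  refine h.run_unique (Run.cons (hD.step 1 hd hx) (Run.cons (hD.step 0 hcd x1)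
      (Run.cons (hD.step 1 hccd x2) (Run.cons (hD.step 0 hc x3) (Run.nil _)))))
    (Run.cons (hD.step 0 hc hx) (Run.cons (hD.step 1 hccd y1)
      (Run.cons (hD.step 0 hcd y2) (Run.cons (hD.step 1 hd y3) (Run.nil _))))) ?_
  obtain ⟨r, s, hp⟩ := h.exists_C2 hD
  obtain ⟨a1, a2, a3⟩ := (hp d x hd hx).2
  have a4 := h.ε_e hD 1 hd x hx
  obtain ⟨a5, a6, a7⟩ := (hp (c * d) _ hcd x1).1
  have a8 := h.ε_e hD 0 hcd _ x1
  have a9 := (hp (c ^ 2 * d) _ hccd x2).2.1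
  obtain ⟨b1, b2, b3⟩ := (hp c x hc hx).1
  have b4 := h.ε_e hD 0 hc x hx
  obtain ⟨b5, b6, b7⟩ := (hp (c ^ 2 * d) _ hccd y1).2
  have b8 := h.ε_e hD 1 hccd _ y1
  have b9 := (hp (c * d) _ hcd y2).1.1
  have n1 := (hD.ε_pos (idx 0) _ x1).ne'
  have n2 := (hD.ε_pos (idx 1) _ x2).ne'
  have n3 := (hD.ε_pos (idx 0) _ x3).ne'
  have m1 := (hD.ε_pos (idx 1) _ y1).ne'
  have m2 := (hD.ε_pos (idx 0) _ y2).ne'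
  have m3 := (hD.ε_pos (idx 1) _ y3).ne'
  have he := (hD.ε_pos (idx 0) x hx).ne'
  have hf := (hD.ε_pos (idx 1) x hx).ne'
  have hc' := c.ne_zero
  have hd' := d.ne_zero
  simp only [RankTwoModel.wordMatrix, expParam, one_mul]
  rw [a8, a6] at a9
  rw [b8, b6, b7] at b9
  simp only [Units.val_mul, Units.val_pow_eq_pow_val] at a1 a2 a3 a4 a5 a9 b1 b2 b3 b4 b5 b9 ⊢
  rw [a2, a3, a4] at a5
  rw [a2, a3] at a9
  rw [b2, b4] at b5
  rw [b2, b3] at b9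
  generalize D.ε (idx 0) (D.e (idx 1) (c ^ 2 * d) (D.e (idx 0) (c * d) (D.e (idx 1) d x))) = e₃
    at *
  generalize D.ε (idx 1) (D.e (idx 0) (c * d) (D.e (idx 1) (c ^ 2 * d) (D.e (idx 0) c x))) = f₃
    at *
  generalize D.ε (idx 1) (D.e (idx 0) (c * d) (D.e (idx 1) d x)) = f₂ at *
  generalize D.ε (idx 0) (D.e (idx 1) (c ^ 2 * d) (D.e (idx 0) c x)) = e₂ at *
  generalize D.ε (idx 0) (D.e (idx 1) d x) = e₁ at *
  generalize D.ε (idx 1) (D.e (idx 0) c x) = f₁ at *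
  generalize D.ε (idx 0) x = e at *
  generalize D.ε (idx 1) x = f at *
  generalize r x = r at *
  generalize s x = s at *
  generalize (c : ℂ) = c at *
  generalize (d : ℂ) = d at *
  change C2x 0 _ * C2x 1 _ * C2x 0 _ * C2x 1 _ = C2x 1 _ * C2x 0 _ * C2x 1 _ * C2x 0 _
  clear a2 a3 a4 a6 a7 a8 b2 b3 b4 b6 b7 b8 hp hc hd hcd hccd x1 x2 x3 y1 y2 y3
  -- In terms of these four polynomials every intermediate value of `ε` is a monomial: `e₁ = A/f`,
  -- `f₂ = fK/A²`, `e₃ = AJ/K`, `f₁ = N/e²`, `e₂ = eJ/N`, `f₃ = NK/J²`.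
  obtain ⟨A, hA⟩ : ∃ A, A = d * (e * f - r) + r := ⟨_, rfl⟩
  obtain ⟨K, hK⟩ : ∃ K, K = d * (e * f - r + c * r) ^ 2 + (c * d - 1) ^ 2 * (f * s - r ^ 2) :=
    ⟨_, rfl⟩
  obtain ⟨J, hJ⟩ : ∃ J, J = c * e * A + (c * d - 1) * (c - 1) * (e * r - s) := ⟨_, rfl⟩
  obtain ⟨N, hN⟩ : ∃ N, N = e ^ 2 * f + 2 * (c - 1) * e * r + (c - 1) ^ 2 * s := ⟨_, rfl⟩
  have ha : e₁ = A / f := by rw [a1, hA]; field_simp; ring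
  have hA0 : A ≠ 0 := fun h0 => n1 (by rw [ha, h0, zero_div])
  have hb : f₂ = f * K / A ^ 2 := by rw [a5, ha]; field_simp; rw [hK, hA]; ring
  have hK0 : K ≠ 0 := fun h0 => n2 (by rw [hb, h0, mul_zero, zero_div])
  have hc : e₃ = A * J / K := by rw [a9, hb, ha]; field_simp; rw [hJ, hK, hA]; ring
  have hJ0 : J ≠ 0 := fun h0 => n3 (by rw [hc, h0, mul_zero, zero_div])
  have hu : f₁ = N / e ^ 2 := by rw [b1, hN]; field_simp
  have hN0 : N ≠ 0 := fun h0 => m1 (by rw [hu, h0, zero_div])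
  have hv : e₂ = e * J / N := by rw [b5, hu]; field_simp; rw [hJ, hN, hA]; ring
  have hw : f₃ = N * K / J ^ 2 := by rw [b9, hv, hu]; field_simp; rw [hJ, hN, hK, hA]; ring
  rw [ha, hb, hc, hu, hv, hw]
  clear a1 a5 a9 b1 b5 b9 ha hb hc hu hv hw n1 n2 n3 m1 m2 m3
  simp [C2x]
  -- Equality of the coefficients of the short root, which appears in two entries of the matrices.
  have h1 : (c * d - 1) / (A / f) + (c - 1) / (A * J / K) =
      (c - 1) / e + (c * d - 1) / (e * J / N) := by
    field_simp
    rw [hJ, hK, hN, hA]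
    ring
  refine ⟨⟨h1, ?_, ?_⟩, ⟨?_, ?_⟩, h1⟩ <;> field_simp <;> simp only [hJ, hK, hN, hA] <;> ring

end CrystalData

/-! ### Products of families, and the passage from pairs to geometric crystals. -/

namespace CrystalData

variable {I ι κ : Type}

/-- For each pair of indices, `D` is induced by a unipotent crystal of rank two. -/
structure HasUnipotentPairs (A : Matrix I I ℤ) (D : CrystalData I ι) : Prop where
  two : ∀ i j, i ≠ j → A i j = 0 → A j i = 0 → IsUnipotentPair A1A1Model D ![i, j]
  three : ∀ i j, i ≠ j → A i j = -1 → A j i = -1 → IsUnipotentPair A2Model D ![i, j]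
  four : ∀ i j, i ≠ j → A i j = -2 → A j i = -1 → IsUnipotentPair C2Model D ![i, j]

theorem HasUnipotentPairs.prod {A : Matrix I I ℤ} {D : CrystalData I ι} {D' : CrystalData I κ}
    (h : HasUnipotentPairs A D) (h' : HasUnipotentPairs A D') (hD : D.IsPositive)
    (hD' : D'.IsPositive) : HasUnipotentPairs A (D.prod D') where
  two i j hij h1 h2 := (h.two i j hij h1 h2).prod (h'.two i j hij h1 h2) hD hD'
  three i j hij h1 h2 := (h.three i j hij h1 h2).prod (h'.three i j hij h1 h2) hD hD'
  four i j hij h1 h2 := (h.four i j hij h1 h2).prod (h'.four i j hij h1 h2) hD hD'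

theorem HasUnipotentPairs.exists_pair {A : Matrix I I ℤ} {D : CrystalData I ι}
    (h : HasUnipotentPairs A D) (hA' : ∀ i j, i ≠ j → RankTwoEntries (A i j) (A j i)) {i j : I}
    (hij : i ≠ j) : ∃ (R : RankTwoModel) (idx : Fin 2 → I) (k l : Fin 2), idx k = i ∧ idx l = j ∧
      R.a k l = A i j ∧ IsUnipotentPair R D idx := by
  rcases hA' i j hij with ⟨h1, h2⟩ | ⟨h1, h2⟩ | ⟨h1, h2⟩ | ⟨h1, h2⟩
  · exact ⟨_, _, 0, 1, rfl, rfl, h1.symm, h.two i j hij h1 h2⟩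
  · exact ⟨_, _, 0, 1, rfl, rfl, h1.symm, h.three i j hij h1 h2⟩
  · exact ⟨_, _, 0, 1, rfl, rfl, h1.symm, h.four i j hij h1 h2⟩
  -- The C₂ model has the entry `-2` at `(0, 1)`, so here the pair is listed in the opposite order.
  · exact ⟨_, _, 1, 0, rfl, rfl, h1.symm, h.four j i hij.symm h2 h1⟩

/-- The axioms that involve one index are read off from any pair containing it; such a pair exists
since there are at least two indices. -/
theorem HasUnipotentPairs.isPositiveCrystal [Nontrivial I] {A : Matrix I I ℤ}
    {D : CrystalData I ι} (h : HasUnipotentPairs A D) (hA : ∀ i, A i i = 2)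
    (hA' : ∀ i j, i ≠ j → RankTwoEntries (A i j) (A j i)) (hD : D.IsPositive) :
    IsPositiveCrystal A D where
  positive := hD
  e_one i x hx := by
    obtain ⟨j, hj⟩ := exists_ne i
    obtain ⟨R, idx, k, l, rfl, -, -, hp⟩ := h.exists_pair hA' hj.symm
    exact hp.e_one hD k x hx
  e_mul i c d hc hd x hx := by
    obtain ⟨j, hj⟩ := exists_ne i
    obtain ⟨R, idx, k, l, rfl, -, -, hp⟩ := h.exists_pair hA' hj.symm
    exact hp.e_mul hD k hc hd x hx
  γ_e i j c hc x hx := by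
    rw [Units.val_zpow_eq_zpow_val]
    by_cases hij : i = j
    · subst hij
      obtain ⟨j, hj⟩ := exists_ne i
      obtain ⟨R, idx, k, l, rfl, -, -, hp⟩ := h.exists_pair hA' hj.symm
      rw [hA, ← R.a_self k]
      exact hp.γ_e hD k k hc x hx
    · obtain ⟨R, idx, k, l, rfl, rfl, ha, hp⟩ := h.exists_pair hA' hij
      rw [← ha]
      exact hp.γ_e hD k l hc x hx
  ε_e i c hc x hx := by
    obtain ⟨j, hj⟩ := exists_ne i
    obtain ⟨R, idx, k, l, rfl, -, -, hp⟩ := h.exists_pair hA' hj.symm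
    rw [hp.ε_e hD k hc x hx, Units.val_inv_eq_inv_val, div_eq_inv_mul]
  braid i j hij := ⟨fun h1 h2 c d hc hd x hx => (h.two i j hij h1 h2).braid_A1A1 hD hc hd x hx,
    fun h1 h2 c d hc hd x hx => (h.three i j hij h1 h2).braid_A2 hD hc hd x hx,
    fun h1 h2 c d hc hd x hx => (h.four i j hij h1 h2).braid_C2 hD hc hd x hx⟩

namespace IsRegularFamily

variable {Λ : Type} {D : (Λ → ℂˣ) → CrystalData I ι} {D' : (Λ → ℂˣ) → CrystalData I κ}
  {L₀ : Λ → ℂˣ} {x₀ : ι → ℂˣ} {y₀ : κ → ℂˣ}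

theorem reindex {Λ' : Type} (h : IsRegularFamily D L₀ x₀) (ρ : Λ → Λ') {L₁ : Λ' → ℂˣ}
    (hL : L₁ ∘ ρ = L₀) : IsRegularFamily (fun L => D (L ∘ ρ)) L₁ x₀ := by
  subst hL
  exact {
    γ_reg := fun i => h.γ_comp i (PointedMap.precomp (b := Sum.elim L₁ x₀) (Sum.inl ∘ ρ))
      (PointedMap.precomp Sum.inr)
    γ_pos := fun i L x hL hx => h.γ_pos i _ x (fun j => hL _) hx
    γ_ne := h.γ_ne
    ε_reg := fun i => h.ε_comp i (PointedMap.precomp (b := Sum.elim L₁ x₀) (Sum.inl ∘ ρ))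
      (PointedMap.precomp Sum.inr)
    ε_pos := fun i L x hL hx => h.ε_pos i _ x (fun j => hL _) hx
    ε_ne := h.ε_ne
    e_map := fun i => h.e_comp i ⟨fun _ => RegOn.coord _, fun p hp _ => hp _, rfl⟩
      (PointedMap.precomp (Sum.inr ∘ Sum.inl ∘ ρ)) (PointedMap.precomp (Sum.inr ∘ Sum.inr)) }

/-- The only new denominators are `φ_i(x)`, non-zero at the base point by assumption on the first
factor, and `φ_i(x) + ε_i(y)`, whose value at the base point is the one in `hne`. -/
theorem prod (h : IsRegularFamily D L₀ x₀) (h' : IsRegularFamily D' L₀ y₀)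
    (hne : ∀ i, (D L₀).φ i x₀ + (D' L₀).ε i y₀ ≠ 0) :
    IsRegularFamily (fun L => (D L).prod (D' L)) L₀ (Sum.elim x₀ y₀) := by
  have hφ₀ : ∀ i, (D L₀).φ i x₀ ≠ 0 := fun i => mul_ne_zero (h.γ_ne i) (h.ε_ne i)
  have hφ : ∀ i L x, PosPt L → PosPt x → 0 < (D L).φ i x := fun i L x hL hx =>
    mul_pos (h.γ_pos i L x hL hx) (h.ε_pos i L x hL hx)
  have hL := PointedMap.precomp (b := Sum.elim L₀ (Sum.elim x₀ y₀)) Sum.inl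
  have hx := PointedMap.precomp (b := Sum.elim L₀ (Sum.elim x₀ y₀)) (Sum.inr ∘ Sum.inl)
  have hy := PointedMap.precomp (b := Sum.elim L₀ (Sum.elim x₀ y₀)) (Sum.inr ∘ Sum.inr)
  refine ⟨fun i => (h.γ_comp i hL hx).mul (h'.γ_comp i hL hy), fun i L z hL hz => ?_,
    fun i => mul_ne_zero (h.γ_ne i) (h'.γ_ne i), fun i => ?_, fun i L z hL hz => ?_, fun i => ?_,
    fun i => ?_⟩
  · exact mul_pos (h.γ_pos i L _ hL fun _ => hz _) (h'.γ_pos i L _ hL fun _ => hz _)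
  · exact (h.ε_comp i hL hx).add (((h.ε_comp i hL hx).mul (h'.ε_comp i hL hy)).div
      ((h.γ_comp i hL hx).mul (h.ε_comp i hL hx)) (forall_good.2
        ⟨fun p hp => (hφ i _ _ (fun _ => hp _) fun _ => hp _).ne', hφ₀ i⟩))
  · have h1 := h.ε_pos i L (z ∘ Sum.inl) hL fun _ => hz _
    have h2 := h'.ε_pos i L (z ∘ Sum.inr) hL fun _ => hz _
    have h3 := hφ i L (z ∘ Sum.inl) hL fun _ => hz _
    change 0 < _ + _ * _ / _
    positivity
  · change (D L₀).ε i x₀ + (D L₀).ε i x₀ * (D' L₀).ε i y₀ / (D L₀).φ i x₀ ≠ 0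
    have := hφ₀ i
    have e : (D L₀).ε i x₀ + (D L₀).ε i x₀ * (D' L₀).ε i y₀ / (D L₀).φ i x₀ =
        (D L₀).ε i x₀ * ((D L₀).φ i x₀ + (D' L₀).ε i y₀) / (D L₀).φ i x₀ := by field_simp
    rw [e]
    exact div_ne_zero (mul_ne_zero (h.ε_ne i) (hne i)) this
  · let b : Unit ⊕ (Λ ⊕ (ι ⊕ κ)) → ℂˣ := Sum.elim (fun _ => 1) (Sum.elim L₀ (Sum.elim x₀ y₀))
    have hc : PointedMap b (fun _ : Unit => 1) fun p _ => p (Sum.inl ()) :=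
      ⟨fun _ => RegOn.coord _, fun p hp _ => hp _, rfl⟩
    have hL := PointedMap.precomp (b := b) (Sum.inr ∘ Sum.inl)
    have hx := PointedMap.precomp (b := b) (Sum.inr ∘ Sum.inr ∘ Sum.inl)
    have hy := PointedMap.precomp (b := b) (Sum.inr ∘ Sum.inr ∘ Sum.inr)
    have rφ := (h.γ_comp i hL hx).mul (h.ε_comp i hL hx)
    have rε := h'.ε_comp i hL hy
    have p1 : ∀ p : Unit ⊕ (Λ ⊕ (ι ⊕ κ)) → ℂˣ, PosPt p →
        0 < (D (p ∘ Sum.inr ∘ Sum.inl)).φ i (p ∘ Sum.inr ∘ Sum.inr ∘ Sum.inl) :=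
      fun p hp => hφ i _ _ (fun _ => hp _) fun _ => hp _
    have p2 : ∀ p : Unit ⊕ (Λ ⊕ (ι ⊕ κ)) → ℂˣ, PosPt p →
        0 < (D' (p ∘ Sum.inr ∘ Sum.inl)).ε i (p ∘ Sum.inr ∘ Sum.inr ∘ Sum.inr) :=
      fun p hp => h'.ε_pos i _ _ (fun _ => hp _) fun _ => hp _
    have p3 : ∀ p : Unit ⊕ (Λ ⊕ (ι ⊕ κ)) → ℂˣ, PosPt p →
        0 < (p (Sum.inl ()) : ℂ) := fun p hp => hp _
    have hc₁ : PointedMap b (fun _ : Unit => 1) fun p _ =>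
        unitOf ((p (Sum.inl ()) *
            (D (p ∘ Sum.inr ∘ Sum.inl)).φ i (p ∘ Sum.inr ∘ Sum.inr ∘ Sum.inl) +
            (D' (p ∘ Sum.inr ∘ Sum.inl)).ε i (p ∘ Sum.inr ∘ Sum.inr ∘ Sum.inr)) /
          ((D (p ∘ Sum.inr ∘ Sum.inl)).φ i (p ∘ Sum.inr ∘ Sum.inr ∘ Sum.inl) +
            (D' (p ∘ Sum.inr ∘ Sum.inl)).ε i (p ∘ Sum.inr ∘ Sum.inr ∘ Sum.inr))) := by
      -- At `c = 1` one has `c₁ = c₂ = 1`, so the actions on both factors fix their base points.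
      have e1 : (((1 : ℂˣ) : ℂ) * (D L₀).φ i x₀ + (D' L₀).ε i y₀) /
          ((D L₀).φ i x₀ + (D' L₀).ε i y₀) = 1 := by
        rw [Units.val_one, one_mul, div_self (hne i)]
      refine ⟨fun _ => RegOn.unitOf ((((RegOn.coord _).mul rφ).add rε).div (rφ.add rε)
        (forall_good.2 ⟨fun p hp => ?_, hne i⟩)) (forall_good.2 ⟨fun p hp => ?_, ?_⟩),
        fun p hp _ => unitOf_pos ?_, funext fun _ => ?_⟩
      · have := p1 p hp; have := p2 p hp
        positivity
      · have h1 := p1 p hp; have h2 := p2 p hp; have h3 := p3 p hp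
        exact (div_pos (add_pos (mul_pos h3 h1) h2) (add_pos h1 h2)).ne'
      · exact e1.trans_ne one_ne_zero
      · have h1 := p1 p hp; have h2 := p2 p hp; have h3 := p3 p hp
        exact div_pos (add_pos (mul_pos h3 h1) h2) (add_pos h1 h2)
      · refine Units.ext ((coe_unitOf ?_).trans e1)
        exact e1.trans_ne one_ne_zero
    refine (h.e_comp i hc₁ hL hx).sumElim (h'.e_comp i ⟨fun _ => (hc.regOn ()).units_div
      (hc₁.regOn ()), fun p hp _ => div_coe_pos (hp _) (hc₁.pos p hp ()), ?_⟩ hL hy)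
    exact funext fun _ => (congrArg (fun u => (1 : ℂˣ) / u) (congrFun hc₁.base ())).trans (div_one _)

end IsRegularFamily

instance {ι : Type} [Finite ι] (k : ℕ) : Finite (ProductIndex ι k) := by
  induction k with
  | zero => exact inferInstanceAs (Finite ι)
  | succ k ih => exact inferInstanceAs (Finite (ProductIndex ι k ⊕ ι))

/-- Products of members of a family of data that are induced by unipotent crystals of rank two are
geometric crystals. -/
theorem multiProd_isGeometricCrystal [Finite ι] [Fintype I] [DecidableEq I] [Nontrivial I]
    {A : Matrix I I ℤ} (hA : ∀ i, A i i = 2)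
    (hA' : ∀ i j, i ≠ j → RankTwoEntries (A i j) (A j i)) (V : ℂˣ → CrystalData I ι)
    (hV : ∀ L : ℂˣ, 0 < (L : ℂ) → HasUnipotentPairs A (V L))
    (hV' : ∀ (L : ℂˣ) (a : I → ℂ), ∃ y₀, IsRegularFamily (fun M : Unit → ℂˣ => V (M ()))
      (fun _ => L) y₀ ∧ ∀ i, a i + (V L).ε i y₀ ≠ 0) (k : ℕ) (L : Fin (k + 1) → ℂˣ) :
    (multiProd V k L).IsGeometricCrystal A := by
  have h1 : ∀ k (L : Fin (k + 1) → ℂˣ), ∃ x₀, IsRegularFamily (multiProd V k) L x₀ := by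
    intro k
    induction k with
    | zero =>
      intro L
      obtain ⟨y₀, hy, -⟩ := hV' (L 0) 0
      exact ⟨y₀, hy.reindex (fun _ => 0) rfl⟩
    | succ k ih =>
      intro L
      obtain ⟨x₀, hx⟩ := ih fun j => L j.castSucc
      -- The base point of the new factor is chosen after that of the previous ones, so as to avoid
      -- the zeros of `φ_i(x₀) + ε_i(y)`.
      obtain ⟨y₀, hy, hxy⟩ := hV' (L (Fin.last (k + 1)))
        fun i => (multiProd V k fun j => L j.castSucc).φ i x₀
      exact ⟨Sum.elim x₀ y₀, (hx.reindex Fin.castSucc (L₁ := L) rfl).prod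
        (hy.reindex (fun _ => Fin.last (k + 1)) (L₁ := L) rfl) hxy⟩
  have h2 : ∀ k (L : Fin (k + 1) → ℂˣ), PosPt L → HasUnipotentPairs A (multiProd V k L) := by
    intro k
    induction k with
    | zero => exact fun L hL => hV _ (hL 0)
    | succ k ih =>
      intro L hL
      obtain ⟨x₀, hx⟩ := h1 k fun j => L j.castSucc
      obtain ⟨y₀, hy, -⟩ := hV' (L (Fin.last (k + 1))) 0
      exact (ih _ fun _ => hL _).prod (hV _ (hL _)) (hx.isPositive fun _ => hL _)
        (hy.isPositive (L := fun _ => L (Fin.last (k + 1))) fun _ => hL _)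
  obtain ⟨x₀, hx⟩ := h1 k L
  exact hx.isGeometricCrystal hA hA' fun L hL =>
    (h2 k L hL).isPositiveCrystal hA hA' (hx.isPositive hL)

end CrystalData

/-! ### Schubert cells -/

theorem Run.mono {X : Type} {S S' : Fin 2 → ℂ → X → X → Prop}
    (h : ∀ k b x y, S k b x y → S' k b x y) {x z : X} {w : List (Fin 2 × ℂ)} (hr : Run S x w z) :
    Run S' x w z := by
  induction hr with
  | nil x => exact Run.nil x
  | cons h1 _ ih => exact Run.cons (h _ _ _ _ h1) ih

theorem Unipotent.mono {R : RankTwoModel} {X : Type} {S S' : Fin 2 → ℂ → X → X → Prop}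
    {f : X → Matrix (Fin R.n) (Fin R.n) ℂ} (hf : Unipotent R S' f)
    (h : ∀ k b x y, S k b x y → S' k b x y) : Unipotent R S f where
  mem := hf.mem
  ne_zero hs := hf.ne_zero (h _ _ _ _ hs)
  step hs := hf.step (h _ _ _ _ hs)
  unique h1 h2 := hf.unique (h1.mono h) (h2.mono h)

section Schubert

variable {I : Type} [DecidableEq I] (A : Matrix I I ℤ)

/-- The sum of the terms of `ε_i` at the places before `j`. -/
noncomputable def schubertLT {m : ℕ} (w : Fin m → I) (i : I) (x : Fin m → ℂˣ) (j : Fin m) : ℂ :=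
  ∑ r with w r = i, if r < j then schubertTerm A w i x r else 0

/-- The sum of the terms of `ε_i` at the places up to `j`. -/
noncomputable def schubertLE {m : ℕ} (w : Fin m → I) (i : I) (x : Fin m → ℂˣ) (j : Fin m) : ℂ :=
  ∑ r with w r = i, if r ≤ j then schubertTerm A w i x r else 0

variable {A} {m : ℕ}

theorem schubertTerm_pos {w : Fin m → I} (i : I) {x : Fin m → ℂˣ} (hx : PosPt x) (r : Fin m) :
    0 < schubertTerm A w i x r :=
  inv_coe_pos (mul_coe_pos (prod_coe_pos _ fun _ _ => zpow_coe_pos (hx _) _) (hx r))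

theorem schubertTerm_castSucc (w : Fin (m + 1) → I) (i : I) (x : Fin (m + 1) → ℂˣ) (r : Fin m) :
    schubertTerm A w i x r.castSucc =
      schubertTerm A (fun j => w j.castSucc) i (fun j => x j.castSucc) r := by
  simp only [schubertTerm, Finset.prod_filter, Fin.prod_univ_castSucc, Fin.castSucc_lt_castSucc_iff,
    if_neg (not_lt.2 (Fin.le_last r.castSucc)), mul_one]

theorem schubertTerm_last (w : Fin (m + 1) → I) (i : I) (x : Fin (m + 1) → ℂˣ) :
    schubertTerm A w i x (Fin.last m) =
      1 / (((∏ j : Fin m, x j.castSucc ^ A (w j.castSucc) i : ℂˣ) : ℂ) * x (Fin.last m)) := by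
  simp only [schubertTerm, Finset.prod_filter, Fin.prod_univ_castSucc, Fin.castSucc_lt_last,
    if_true, lt_irrefl, if_false, mul_one, Units.val_inv_eq_inv_val, Units.val_mul, one_div]

theorem schubertε_succ (w : Fin (m + 1) → I) (i : I) (x : Fin (m + 1) → ℂˣ) :
    schubertε A w i x = schubertε A (fun j => w j.castSucc) i (fun j => x j.castSucc) +
      if w (Fin.last m) = i then schubertTerm A w i x (Fin.last m) else 0 := by
  simp only [schubertε, Finset.sum_filter, Fin.sum_univ_castSucc, schubertTerm_castSucc]

theorem schubertLT_castSucc (w : Fin (m + 1) → I) (i : I) (x : Fin (m + 1) → ℂˣ) (j : Fin m) :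
    schubertLT A w i x j.castSucc =
      schubertLT A (fun j => w j.castSucc) i (fun j => x j.castSucc) j := by
  simp [schubertLT, Finset.sum_filter, Fin.sum_univ_castSucc, schubertTerm_castSucc,
    not_lt.2 (Fin.le_last j.castSucc)]

theorem schubertLE_castSucc (w : Fin (m + 1) → I) (i : I) (x : Fin (m + 1) → ℂˣ) (j : Fin m) :
    schubertLE A w i x j.castSucc =
      schubertLE A (fun j => w j.castSucc) i (fun j => x j.castSucc) j := by
  simp [schubertLE, Finset.sum_filter, Fin.sum_univ_castSucc, schubertTerm_castSucc,
    not_le.2 (Fin.castSucc_lt_last j)]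

theorem schubertLT_last (w : Fin (m + 1) → I) (i : I) (x : Fin (m + 1) → ℂˣ) :
    schubertLT A w i x (Fin.last m) =
      schubertε A (fun j => w j.castSucc) i (fun j => x j.castSucc) := by
  simp [schubertLT, schubertε, Finset.sum_filter, Fin.sum_univ_castSucc, schubertTerm_castSucc]

theorem schubertLE_last (w : Fin (m + 1) → I) (i : I) (x : Fin (m + 1) → ℂˣ) :
    schubertLE A w i x (Fin.last m) = schubertε A w i x := by
  simp [schubertLE, schubertε, Fin.le_last]

/-- With `c = 1 + b ε`, a sum in which some terms carry the factor `c` equals `ε` times `1 + b`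
times the sum of those terms; the factors `ε` cancel in the quotient. Unlike the original formula,
the result refers only to places up to `j`, which permits induction on the word. -/
theorem schubertE_eq {w : Fin m → I} {i : I} {x : Fin m → ℂˣ} (hx : PosPt x) {b : ℂ} {c : ℂˣ}
    (hc : 0 < (c : ℂ)) (hcb : (c : ℂ) = 1 + b * schubertε A w i x) (j : Fin m) :
    1 + b * schubertLT A w i x j ≠ 0 ∧ (schubertE A w i c x j : ℂ) =
      x j * ((1 + b * schubertLE A w i x j) / (1 + b * schubertLT A w i x j)) := by
  have ht := fun r => schubertTerm_pos (A := A) (w := w) i hx r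
  by_cases hw : ∃ r, w r = i
  · obtain ⟨r, hr⟩ := hw
    have hε : 0 < schubertε A w i x := Finset.sum_pos (fun _ _ => ht _) ⟨r, by simpa using hr⟩
    have key : ∀ p : Fin m → Prop, ∀ [DecidablePred p],
        (∑ r with w r = i, (if p r then (c : ℂ) else 1) * schubertTerm A w i x r) =
        schubertε A w i x *
          (1 + b * ∑ r with w r = i, if p r then schubertTerm A w i x r else 0) := by
      intro p _
      have : ∀ r, (if p r then (c : ℂ) else 1) * schubertTerm A w i x r = schubertTerm A w i x r +
          schubertε A w i x * b * (if p r then schubertTerm A w i x r else 0) := fun r => by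
        split_ifs
        · rw [hcb]; ring
        · ring
      simp only [this, Finset.sum_add_distrib, ← Finset.mul_sum]
      rw [mul_add, mul_one, mul_assoc]
      rfl
    have hpos : ∀ p : Fin m → Prop, ∀ [DecidablePred p],
        0 < ∑ r with w r = i, (if p r then (c : ℂ) else 1) * schubertTerm A w i x r := by
      intro p _
      refine Finset.sum_pos (fun r _ => ?_) ⟨r, by simpa using hr⟩
      have := ht r
      split_ifs <;> positivity
    have h1 := hpos (· ≤ j)
    have h2 := hpos (· < j)
    rw [schubertE, Units.val_mul, coe_unitOf (div_pos h1 h2).ne']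
    rw [key] at h1 h2
    rw [key, key, mul_div_mul_left _ _ hε.ne']
    exact ⟨right_ne_zero_of_mul h2.ne', rfl⟩
  · have he : ({r | w r = i} : Finset (Fin m)) = ∅ := by
      simpa [Finset.filter_eq_empty_iff] using hw
    -- If the letter does not occur, the quotient is `0 / 0 = 0`, and the default `unitOf 0 = 1`
    -- makes the action trivial.
    simp [schubertE, schubertLT, schubertLE, he, unitOf]

namespace CrystalData

/-- The data of the geometric crystal on a Schubert cell. -/
noncomputable def schubert (A : Matrix I I ℤ) (w : Fin m → I) (ξ : I → ℂˣ) :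
    CrystalData I (Fin m) where
  e := schubertE A w
  γ := schubertγ A w ξ
  ε := schubertε A w

/-- The cell is a product of one-dimensional crystals, obtained by splitting off the last letter. A
last letter in the pair contributes `Y` and is translated by the parameter that the preceding
letters pass on; a letter outside the pair is fixed and contributes a torus element. -/
theorem exists_unipotent_schubert (R : RankTwoModel) {idx : Fin 2 → I}
    (hidx : Function.Injective idx) (hR : ∀ k l, A (idx k) (idx l) = R.a k l) (w : Fin m → I) :
    ∃ f : PosPts (Fin m) → Matrix (Fin R.n) (Fin R.n) ℂ,
      Unipotent R (fun k b x y => ∀ j, 1 + b * schubertLT A w (idx k) x.1 j ≠ 0 ∧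
        (y.1 j : ℂ) = x.1 j * ((1 + b * schubertLE A w (idx k) x.1 j) /
          (1 + b * schubertLT A w (idx k) x.1 j))) f ∧
      ∀ k x, schubertε A w (idx k) x.1 = R.ε k (f x) ∧
        ((∏ j, x.1 j ^ A (w j) (idx k) : ℂˣ) : ℂ) = R.γ k (f x) := by
  induction m with
  | zero =>
    refine ⟨_, (Unipotent.trivial (R := R) (K := PosPts (Fin 0)) (fun _ _ => 1)
      fun _ _ => one_ne_zero).mono fun k b x y _ => Subtype.ext (Subsingleton.elim _ _),
      fun k x => ?_⟩
    rw [R.ε_torus _ _ fun _ => one_ne_zero, R.γ_torus _ _ fun _ => one_ne_zero]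
    simp [schubertε]
  | succ m ih =>
    obtain ⟨f, hf, hf'⟩ := ih fun j => w j.castSucc
    let p : PosPts (Fin (m + 1)) → PosPts (Fin m) := fun x => ⟨fun j => x.1 j.castSucc, fun j => x.2 _⟩
    have hp : ∀ {k : Fin 2} {b : ℂ} {x y : PosPts (Fin (m + 1))},
        (∀ j, 1 + b * schubertLT A w (idx k) x.1 j ≠ 0 ∧
        (y.1 j : ℂ) = x.1 j * ((1 + b * schubertLE A w (idx k) x.1 j) /
          (1 + b * schubertLT A w (idx k) x.1 j))) →
        (∀ j, 1 + b * schubertLT A (fun j => w j.castSucc) (idx k) (p x).1 j ≠ 0 ∧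
        ((p y).1 j : ℂ) = (p x).1 j * ((1 + b * schubertLE A (fun j => w j.castSucc) (idx k)
          (p x).1 j) / (1 + b * schubertLT A (fun j => w j.castSucc) (idx k) (p x).1 j))) :=
      fun h j => by simpa only [schubertLT_castSucc, schubertLE_castSucc] using h j.castSucc
    have hext : ∀ x y : PosPts (Fin (m + 1)), p x = p y → x.1 (Fin.last m) = y.1 (Fin.last m) →
        x = y := fun x y h1 h2 => Subtype.ext (funext (Fin.lastCases h2 fun j =>
          congrFun (congrArg Subtype.val h1) j))
    have hγ : ∀ k (x : PosPts (Fin (m + 1))), ((∏ j, x.1 j ^ A (w j) (idx k) : ℂˣ) : ℂ) =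
        R.γ k (f (p x)) * (x.1 (Fin.last m) : ℂ) ^ A (w (Fin.last m)) (idx k) := fun k x => by
      rw [Fin.prod_univ_castSucc, Units.val_mul, Units.val_zpow_eq_zpow_val, ← (hf' k (p x)).2]
    have hl : ∀ {k : Fin 2} {b : ℂ} {x y : PosPts (Fin (m + 1))},
        (∀ j, 1 + b * schubertLT A w (idx k) x.1 j ≠ 0 ∧
        (y.1 j : ℂ) = x.1 j * ((1 + b * schubertLE A w (idx k) x.1 j) /
          (1 + b * schubertLT A w (idx k) x.1 j))) →
        (y.1 (Fin.last m) : ℂ) = if w (Fin.last m) = idx k then x.1 (Fin.last m) +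
          b / (R.γ k (f (p x)) * (1 + b * R.ε k (f (p x)))) else x.1 (Fin.last m) := by
      intro k b x y h
      obtain ⟨h1, h2⟩ := h (Fin.last m)
      rw [schubertLE_last, schubertε_succ, schubertLT_last, schubertTerm_last] at h2
      rw [schubertLT_last] at h1
      rw [h2, ← (hf' k (p x)).1, ← (hf' k (p x)).2]
      have h3 : (x.1 (Fin.last m) : ℂ) ≠ 0 := Units.ne_zero _
      have h4 : (((∏ j : Fin m, x.1 j.castSucc ^ A (w j.castSucc) (idx k) : ℂˣ) : ℂ)) ≠ 0 :=
        Units.ne_zero _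
      change _ = if _ then _ + _ / (((∏ j : Fin m, x.1 j.castSucc ^ A (w j.castSucc) (idx k) : ℂˣ) : ℂ) *
        (1 + b * schubertε A (fun j => w j.castSucc) (idx k) fun j => x.1 j.castSucc)) else _
      split_ifs
      · field_simp
        ring
      · rw [add_zero, div_self h1, mul_one]
    by_cases hw : ∃ l, w (Fin.last m) = idx l
    · obtain ⟨l, hw⟩ := hw
      refine ⟨_, hf.prod (Unipotent.letter l) p (fun x => ⟨x.1 (Fin.last m), x.2 _⟩)
        (fun x y h1 h2 => hext x y h1 (Units.ext (congrArg Subtype.val h2)))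
        fun k b x y h => ⟨hp h, ?_⟩, fun k x => ?_⟩
      · have := hl h
        simp only [hw, hidx.eq_iff, eq_comm (a := l)] at this
        exact this
      · have h3 : (x.1 (Fin.last m) : ℂ) ≠ 0 := Units.ne_zero _
        rw [R.ε_mul _ (hf.mem _) (R.B_Y _ _ h3), R.γ_mul _ (hf.mem _) (R.B_Y _ _ h3),
          R.ε_Y _ _ _ h3, R.γ_Y _ _ _ h3, hγ, hw, hR]
        refine ⟨?_, rfl⟩
        rw [schubertε_succ, schubertTerm_last, hw, ← (hf' k (p x)).1, ← (hf' k (p x)).2]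
        simp only [hidx.eq_iff, eq_comm (a := l)]
        split_ifs
        · rw [one_div, mul_inv, mul_comm, ← div_eq_mul_inv]
        · rw [zero_div]
    · refine ⟨_, hf.prod (Unipotent.trivial (fun (u : ℂˣ) k => (u : ℂ) ^ A (w (Fin.last m)) (idx k))
        fun u k => zpow_ne_zero _ u.ne_zero) p (fun x => x.1 (Fin.last m)) hext
        fun k b x y h => ⟨hp h, Units.ext ?_⟩, fun k x => ?_⟩
      · rw [hl h, if_neg fun h => hw ⟨k, h⟩]
      · have h3 : ∀ k, (x.1 (Fin.last m) : ℂ) ^ A (w (Fin.last m)) (idx k) ≠ 0 :=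
          fun k => zpow_ne_zero _ (Units.ne_zero _)
        rw [R.ε_mul _ (hf.mem _) (R.B_torus _ h3), R.γ_mul _ (hf.mem _) (R.B_torus _ h3),
          R.ε_torus _ _ h3, R.γ_torus _ _ h3, hγ]
        refine ⟨?_, rfl⟩
        rw [schubertε_succ, if_neg fun h => hw ⟨k, h⟩, zero_div]
        exact congrArg (· + (0 : ℂ)) (hf' k (p x)).1

/-- The geometric crystal on a Schubert cell is induced by a unipotent crystal. -/
theorem isUnipotentPair_schubert (R : RankTwoModel) {idx : Fin 2 → I}
    (hidx : Function.Injective idx) (hR : ∀ k l, A (idx k) (idx l) = R.a k l) (w : Fin m → I)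
    (ξ : I → ℂˣ) : IsUnipotentPair R (schubert A w ξ) idx := by
  obtain ⟨f, hf, hf'⟩ := exists_unipotent_schubert R hidx hR w
  have hξ : ∀ k, (ξ (idx k) : ℂ) ≠ 0 := fun k => Units.ne_zero _
  refine ⟨_, hf.prod (Unipotent.trivial (K := Unit) (fun _ k => (ξ (idx k) : ℂ)) fun _ => hξ) id
    (fun _ => ()) (fun _ _ h _ => h) fun k b x y h => ⟨?_, rfl⟩, fun k x => ?_⟩
  · obtain ⟨c, hc, hcb, hy⟩ := h
    intro j
    rw [id, id, hy]
    exact schubertE_eq x.2 hc hcb j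
  · rw [R.ε_mul _ (hf.mem _) (R.B_torus _ hξ), R.γ_mul _ (hf.mem _) (R.B_torus _ hξ),
      R.ε_torus _ _ hξ, R.γ_torus _ _ hξ, zero_div, add_zero]
    refine ⟨(hf' k x).1, ?_⟩
    rw [id, ← (hf' k x).2]
    exact Units.val_mul _ _

end CrystalData

end Schubert

/-! ### Regularity of the affine geometric crystals -/

section SchubertRegular

variable {I : Type} [DecidableEq I] {A : Matrix I I ℤ} {m : ℕ} {w : Fin m → I} {i : I} {μ : Type}
  {G : Set (μ → ℂˣ)} {b : μ → ℂˣ} {x₀ : Fin m → ℂˣ}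

theorem schubertTerm_regOn {F : (μ → ℂˣ) → (Fin m → ℂˣ)} (hF : ∀ j, RegOn G fun p => (F p j : ℂ))
    (r : Fin m) : RegOn G fun p => schubertTerm A w i (F p) r :=
  ((RegOn.units_prod _ fun j _ => (hF j).units_zpow _).units_mul (hF r)).units_inv

theorem schubertε_regOn {F : (μ → ℂˣ) → (Fin m → ℂˣ)} (hF : ∀ j, RegOn G fun p => (F p j : ℂ)) :
    RegOn G fun p => schubertε A w i (F p) :=
  RegOn.sum _ fun r _ => schubertTerm_regOn hF r

theorem schubertε_pos (hw : ∃ r, w r = i) {x : Fin m → ℂˣ} (hx : PosPt x) :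
    0 < schubertε A w i x :=
  Finset.sum_pos (fun r _ => schubertTerm_pos i hx r) (hw.imp fun r hr => by simpa using hr)

/-- At `c = 1` numerator and denominator of each factor are both `ε_i(x₀)`, so its non-vanishing
gives regularity and fixes the base point. -/
theorem schubertE_pointedMap {c : (μ → ℂˣ) → ℂˣ} {F : (μ → ℂˣ) → (Fin m → ℂˣ)}
    (hw : ∃ r, w r = i) (hc : PointedMap b (fun _ : Unit => 1) fun p _ => c p)
    (hF : PointedMap b x₀ F) (h₀ : schubertε A w i x₀ ≠ 0) :
    PointedMap b x₀ fun p => schubertE A w i (c p) (F p) := by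
  have hc1 : c b = 1 := congrFun hc.base ()
  have hreg : ∀ q : Fin m → Prop, ∀ [DecidablePred q], RegOn (good b) fun p =>
      ∑ r with w r = i, (if q r then (c p : ℂ) else 1) * schubertTerm A w i (F p) r := by
    intro q _
    refine RegOn.sum _ fun r _ => RegOn.mul ?_ (schubertTerm_regOn hF.regOn r)
    split_ifs
    exacts [hc.regOn (), RegOn.const 1]
  have hpos : ∀ q : Fin m → Prop, ∀ [DecidablePred q], ∀ p, PosPt p →
      0 < ∑ r with w r = i, (if q r then (c p : ℂ) else 1) * schubertTerm A w i (F p) r := by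
    intro q _ p hp
    refine Finset.sum_pos (fun r _ => ?_) (hw.imp fun r hr => by simpa using hr)
    have h1 := schubertTerm_pos (A := A) (w := w) i (hF.pos p hp) r
    have h2 := hc.pos p hp ()
    split_ifs
    · exact mul_pos h2 h1
    · exact mul_pos one_pos h1
  have hbase : ∀ q : Fin m → Prop, ∀ [DecidablePred q],
      ∑ r with w r = i, (if q r then (c b : ℂ) else 1) * schubertTerm A w i (F b) r =
        schubertε A w i x₀ := by
    intro q _
    rw [hF.base]
    simp [hc1, schubertε]
  refine ⟨fun j => (hF.regOn j).units_mul (((hreg _).div (hreg _) (forall_good.2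
    ⟨fun p hp => (hpos _ p hp).ne', ?_⟩)).unitOf (forall_good.2
      ⟨fun p hp => (div_pos (hpos _ p hp) (hpos _ p hp)).ne', ?_⟩)), fun p hp j =>
      mul_coe_pos (hF.pos p hp j) (unitOf_pos (div_pos (hpos _ p hp) (hpos _ p hp))), ?_⟩
  · rwa [hbase]
  · rw [hbase, hbase, div_self h₀]
    exact one_ne_zero
  · funext j
    refine Units.ext ?_
    rw [schubertE, hbase, hbase, div_self h₀, Units.val_mul, coe_unitOf one_ne_zero, mul_one,
      hF.base]

/-- `ε_i` is not constant. -/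
theorem exists_add_schubertε_ne_zero (A : Matrix I I ℤ) (hw : ∃ r, w r = i) (a : ℂ) :
    ∃ x, a + schubertε A w i x ≠ 0 := by
  have hne : ({r | w r = i} : Finset (Fin m)).Nonempty := hw.imp fun r hr => by simpa using hr
  -- The coordinate at the last occurrence enters no term of `ε_i` other than its own, so changing
  -- it from 1 to -1 changes `ε_i` by 2.
  obtain ⟨r₀, hr₀, hmax⟩ := Finset.exists_max_image _ (fun r => r) hne
  have key : ∀ u : ℂˣ, schubertε A w i (Function.update 1 r₀ u) =
      ∑ r with w r = i, if r = r₀ then ((u⁻¹ : ℂˣ) : ℂ) else 1 := fun u => by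
    refine Finset.sum_congr rfl fun r hr => ?_
    rw [schubertTerm, Finset.prod_eq_one fun j hj => ?_, one_mul]
    · split_ifs with h
      · rw [h, Function.update_self]
      · rw [Function.update_of_ne h]
        simp
    · have h1 : j < r := by simpa using hj
      rw [Function.update_of_ne (h1.trans_le (hmax r hr)).ne]
      simp
  by_contra! h
  have h1 := h (Function.update 1 r₀ 1)
  have h2 := h (Function.update 1 r₀ (-1))
  rw [key, ← Finset.add_sum_erase _ _ hr₀, if_pos rfl] at h1 h2
  rw [Finset.sum_congr rfl fun r hr => if_neg (Finset.ne_of_mem_erase hr)] at h1 h2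
  have h3 : (2 : ℂ) = 0 := by
    simp at h1 h2
    linear_combination h1 - h2
  norm_num at h3

end SchubertRegular

/-- One non-zero value shows that the numerator is not the zero polynomial; regularity on the whole
torus excludes any other exception. -/
theorem RegOn.generic_ne_zero {ι : Type} {f : (ι → ℂˣ) → ℂ} (hf : RegOn Set.univ f)
    (h : ∃ x, f x ≠ 0) : ∀ᶠ x in generic ι, f x ≠ 0 := by
  obtain ⟨x, hx⟩ := h
  obtain ⟨P, Q, hQ, hP⟩ := hf
  have hP' : ∀ x, f x = evalAt P x / evalAt Q x := fun x =>
    of_eventually_nonvanishing hP (Set.mem_univ x)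
  have h1 : evalAt P x ≠ 0 := fun h0 => hx (by rw [hP', h0, zero_div])
  exact ⟨P, ne_zero_of_evalAt h1, fun y hy => by
    rw [Set.mem_ofPred_eq, hP']
    exact div_ne_zero hy (hQ y (Set.mem_univ y))⟩

theorem generic_neBot (ι : Type) : (generic ι).NeBot := by
  refine ⟨fun h => ?_⟩
  obtain ⟨Q, hQ, h⟩ := Filter.empty_mem_iff_bot.2 h
  exact hQ (eq_zero_of_vanishing fun x _ => by_contra fun hx => h x hx)

namespace AffineType

variable {X : AffineType} {n : ℕ}

theorem exists_word (hn : X.minRank ≤ n) {i : Fin (n + 1)} (hi : i ≠ 0) :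
    ∃ r, X.word n r = i := by
  have h1 : 1 ≤ (i : ℕ) := Nat.one_le_iff_ne_zero.2 fun h => hi (Fin.ext h)
  have h2 := i.is_lt
  have key : ∀ r (hr : r < X.dim n), X.letter n r = i → ∃ r, X.word n r = i := fun r hr h =>
    ⟨⟨r, hr⟩, Fin.ext (by rw [word, Fin.val_ofNat, h, Nat.mod_eq_of_lt h2])⟩
  cases X
  case A1 => exact key (n - i) (by simp only [dim]; omega) (by simp only [letter]; omega)
  case B1 | D1 | A2odd =>
    simp only [minRank] at hn
    exact key (i - 1) (by simp only [dim]; omega) (by simp only [letter]; split_ifs <;> omega)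
  all_goals
    simp only [minRank] at hn
    exact key i (by simp only [dim]; omega) (by simp only [letter]; split_ifs <;> omega)

section

variable {μ : Type} {G : Set (μ → ℂˣ)} {b : μ → ℂˣ} {x₀ : Fin (X.dim n) → ℂˣ} {L₀ : ℂˣ}
  {F : (μ → ℂˣ) → (Fin (X.dim n) → ℂˣ)} {M : (μ → ℂˣ) → ℂˣ}

theorem coord_regOn {m : ℕ} {F : (μ → ℂˣ) → (Fin m → ℂˣ)}
    (hF : ∀ j, RegOn G fun p => (F p j : ℂ)) (j : ℕ) : RegOn G fun p => (coord (F p) j : ℂ) := by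
  unfold coord
  split_ifs
  exacts [hF _, RegOn.const 1]

theorem coord_pos {m : ℕ} {x : Fin m → ℂˣ} (hx : PosPt x) (j : ℕ) : 0 < (coord x j : ℂ) := by
  unfold coord
  split_ifs
  exacts [hx _, by simp]

theorem sigmaBar_regOn (hM : RegOn G fun p => (M p : ℂ)) (hF : ∀ j, RegOn G fun p => (F p j : ℂ))
    (j : Fin (X.dim n)) : RegOn G fun p => (sigmaBar X n (M p) (F p) j : ℂ) := by
  have h := (hM.units_mul (coord_regOn hF 0)).units_mul (coord_regOn hF (X.dim n - 1))
  unfold sigmaBar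
  cases X
  case A2odd =>
    dsimp only
    split_ifs
    exacts [(hF j).units_div (h.units_pow 2), (hF j).units_div h]
  all_goals exact (hF j).units_div h

theorem sigmaBar_pos {L : ℂˣ} (hL : 0 < (L : ℂ)) {x : Fin (X.dim n) → ℂˣ} (hx : PosPt x) :
    PosPt (sigmaBar X n L x) := fun j => by
  have h := mul_coe_pos (mul_coe_pos hL (coord_pos hx 0)) (coord_pos hx (X.dim n - 1))
  unfold sigmaBar
  cases X
  case A2odd =>
    dsimp only
    split_ifs
    exacts [div_coe_pos (hx j) (pow_coe_pos h 2), div_coe_pos (hx j) h]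
  all_goals exact div_coe_pos (hx j) h

theorem sigmaBar_pointedMap (hM : PointedMap b (fun _ : Unit => L₀) fun p _ => M p)
    (hF : PointedMap b x₀ F) :
    PointedMap b (sigmaBar X n L₀ x₀) fun p => sigmaBar X n (M p) (F p) :=
  ⟨sigmaBar_regOn (hM.regOn ()) hF.regOn, fun p hp => sigmaBar_pos (hM.pos p hp ()) (hF.pos p hp),
    by rw [hF.base, show M b = L₀ from congrFun hM.base ()]⟩

end

end AffineType

/-! ### Weights of the coordinates, the involution, and regularity at node 0. -/

namespace AffineType

variable {X : AffineType} {n : ℕ}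

/-- The weights of the coordinates of `V(g)_L`, given by the null root. -/
def weight (X : AffineType) (n j : ℕ) : ℕ :=
  match X with
  | A2odd => if j + 1 = n then 2 else 1
  | A2even => if j = n then 2 else 1
  | A2evenDagger => if j = 0 then 2 else 1
  | _ => 1

/-- The types with an automorphism of the Dynkin diagram that exchanges `0` and `1` and fixes the
other nodes. -/
def IsForked : AffineType → Prop
  | B1 | D1 | A2odd => True
  | _ => False

theorem sigmaBar_apply (L : ℂˣ) (x : Fin (X.dim n) → ℂˣ) (hX : X.IsForked) (j : Fin (X.dim n)) :
    sigmaBar X n L x j = x j / (L * coord x 0 * coord x (X.dim n - 1)) ^ X.weight n j := by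
  unfold sigmaBar weight
  cases X <;> simp only [IsForked] at hX <;> dsimp only
  all_goals first | rw [pow_one] | (split_ifs <;> simp)

theorem IsForked.lt_dim (hX : X.IsForked) (hn : X.minRank ≤ n) : 3 ≤ X.dim n := by
  cases X <;> simp only [IsForked] at hX <;> simp only [minRank] at hn <;> simp only [dim] <;> omega

theorem IsForked.weight_zero (hX : X.IsForked) (hn : X.minRank ≤ n) : X.weight n 0 = 1 := by
  cases X <;> simp only [IsForked] at hX <;> simp only [minRank] at hn <;> simp only [weight]
  rw [if_neg (by omega)]

theorem IsForked.weight_last (hX : X.IsForked) (hn : X.minRank ≤ n) :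
    X.weight n (X.dim n - 1) = 1 := by
  cases X <;> simp only [IsForked] at hX <;> simp only [minRank] at hn <;> simp only [weight]
  exact if_neg (by simp only [dim]; omega)

theorem coord_eq {m : ℕ} (x : Fin m → ℂˣ) {j : ℕ} (hj : j < m) : coord x j = x ⟨j, hj⟩ :=
  dif_pos hj

/-- Put `a = L x₁ x̄₁`. Both end coordinates have weight 1, so the involution sends `a` to `a / a² =
a⁻¹`, and the second application undoes the first. -/
theorem sigmaBar_sigmaBar (hX : X.IsForked) (hn : X.minRank ≤ n) (L : ℂˣ)
    (x : Fin (X.dim n) → ℂˣ) : sigmaBar X n L (sigmaBar X n L x) = x := by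
  have hd := hX.lt_dim hn
  funext j
  rw [sigmaBar_apply _ _ hX, coord_eq _ (show 0 < X.dim n by omega),
    coord_eq _ (show X.dim n - 1 < X.dim n by omega), sigmaBar_apply _ _ hX, sigmaBar_apply _ _ hX,
    sigmaBar_apply _ _ hX]
  dsimp only
  rw [hX.weight_zero hn, hX.weight_last hn, ← coord_eq x (show 0 < X.dim n by omega),
    ← coord_eq x (show X.dim n - 1 < X.dim n by omega), pow_one]
  generalize ha : L * coord x 0 * coord x (X.dim n - 1) = a
  have : L * (coord x 0 / a) * (coord x (X.dim n - 1) / a) = a⁻¹ := by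
    have h : L * (coord x 0 / a) * (coord x (X.dim n - 1) / a) =
        L * coord x 0 * coord x (X.dim n - 1) / a / a := by
      simp only [div_eq_mul_inv]
      ac_rfl
    rw [h, ha, div_self', one_div]
  rw [this, inv_pow, div_inv_eq_mul, div_mul_cancel]

theorem e0_of_isForked (hX : X.IsForked) (L c : ℂˣ) (x : Fin (X.dim n) → ℂˣ) :
    e0 X n L c x =
      sigmaBar X n L (schubertE (X.cartan n) (X.word n) 1 c (sigmaBar X n L x)) := by
  cases X <;> simp only [IsForked] at hX <;> rfl

theorem ε0_of_isForked (hX : X.IsForked) (L : ℂˣ) (x : Fin (X.dim n) → ℂˣ) :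
    ε0 X n L x = schubertε (X.cartan n) (X.word n) 1 (sigmaBar X n L x) := by
  cases X <;> simp only [IsForked] at hX <;> rfl

/-- The types for which `e₀` is given in closed form, by a path `0, 1, …, n`. -/
def IsPath : AffineType → Prop
  | D2 | A2even | A2evenDagger => True
  | _ => False

/-- The factor by which `e₀` multiplies the coordinates of weight one. -/
noncomputable def ratio (X : AffineType) (n : ℕ) (L c : ℂˣ) (x : Fin (X.dim n) → ℂˣ) : ℂˣ :=
  let x0 : ℂ := coord x 0
  let q : ℂ := coord x 1 * coord x (X.dim n - 1)
  match X with
  | A2evenDagger => unitOf ((c * x0 + L * q) / (c * (x0 + L * q)))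
  | _ => unitOf ((c ^ 2 * x0 ^ 2 + L ^ 2 * q) / (c ^ 2 * (x0 ^ 2 + L ^ 2 * q)))

theorem e0_of_isPath (hX : X.IsPath) (hn : X.minRank ≤ n) (L c : ℂˣ) (x : Fin (X.dim n) → ℂˣ)
    (j : Fin (X.dim n)) : e0 X n L c x j =
      x j * ((if (j : ℕ) = 0 then c else 1) * X.ratio n L c x ^ X.weight n j) := by
  cases X <;> simp only [IsPath] at hX <;> simp only [minRank] at hn <;>
    simp only [e0, ratio, weight]
  all_goals split_ifs <;> first | omega | simp [mul_assoc]

theorem one_ne_zero_fin (hn : X.minRank ≤ n) : (1 : Fin (n + 1)) ≠ 0 := by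
  have : 2 ≤ n := by cases X <;> simp only [minRank] at hn <;> omega
  have : NeZero n := ⟨by omega⟩
  obtain ⟨n, rfl⟩ := Nat.exists_eq_succ_of_ne_zero (NeZero.ne n)
  exact Fin.zero_ne_one.symm

section

variable {μ : Type} {G : Set (μ → ℂˣ)} {b : μ → ℂˣ} {x₀ : Fin (X.dim n) → ℂˣ} {L₀ : ℂˣ}
  {F : (μ → ℂˣ) → (Fin (X.dim n) → ℂˣ)} {M : (μ → ℂˣ) → ℂˣ}

theorem ε0_regOn (hM : RegOn G fun p => (M p : ℂ)) (hF : ∀ j, RegOn G fun p => (F p j : ℂ)) :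
    RegOn G fun p => ε0 X n (M p) (F p) := by
  have h0 := coord_regOn hF 0
  have hq := (coord_regOn hF 1).mul (coord_regOn hF (X.dim n - 1))
  unfold ε0
  cases X
  case A1 => exact hM.mul (coord_regOn hF _)
  case B1 | D1 | A2odd => exact schubertε_regOn (sigmaBar_regOn hM hF)
  case D2 | A2even =>
    exact ((h0.pow 2).add ((hM.pow 2).mul hq)).div (h0.pow 3)
      fun _ _ => pow_ne_zero _ (Units.ne_zero _)
  case A2evenDagger =>
    exact ((h0.add (hM.mul hq)).pow 2).div (h0.pow 3) fun _ _ => pow_ne_zero _ (Units.ne_zero _)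

theorem ε0_pos (hn : X.minRank ≤ n) {L : ℂˣ} (hL : 0 < (L : ℂ)) {x : Fin (X.dim n) → ℂˣ}
    (hx : PosPt x) : 0 < ε0 X n L x := by
  have h0 := coord_pos hx 0
  have h1 := coord_pos hx 1
  have hl := coord_pos hx (X.dim n - 1)
  by_cases hX : X.IsForked
  · rw [ε0_of_isForked hX]
    exact schubertε_pos (exists_word hn (one_ne_zero_fin hn)) (sigmaBar_pos hL hx)
  · unfold ε0
    cases X <;> simp [IsForked] at hX
    case A1 => exact mul_pos hL (coord_pos hx _)
    all_goals
      dsimp only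
      positivity

theorem pointedMap_mul {f g : (μ → ℂˣ) → ℂˣ} (hf : PointedMap b (fun _ : Unit => 1) fun p _ => f p)
    (hg : PointedMap b (fun _ : Unit => 1) fun p _ => g p) :
    PointedMap b (fun _ : Unit => 1) fun p _ => f p * g p :=
  ⟨fun j => (hf.regOn j).units_mul (hg.regOn j), fun p hp j =>
    mul_coe_pos (hf.pos p hp j) (hg.pos p hp j), funext fun _ =>
      (congrArg₂ (· * ·) (congrFun hf.base ()) (congrFun hg.base ())).trans (mul_one 1)⟩

theorem pointedMap_pow {f : (μ → ℂˣ) → ℂˣ} (hf : PointedMap b (fun _ : Unit => 1) fun p _ => f p)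
    (k : ℕ) : PointedMap b (fun _ : Unit => 1) fun p _ => f p ^ k :=
  ⟨fun j => (hf.regOn j).units_pow k, fun p hp j => pow_coe_pos (hf.pos p hp j) k, funext fun _ =>
      (congrArg (· ^ k) (congrFun hf.base ())).trans (one_pow k)⟩

theorem pointedMap_inv {f : (μ → ℂˣ) → ℂˣ} (hf : PointedMap b (fun _ : Unit => 1) fun p _ => f p) :
    PointedMap b (fun _ : Unit => 1) fun p _ => (f p)⁻¹ :=
  ⟨fun j => (hf.regOn j).units_inv, fun p hp j => inv_coe_pos (hf.pos p hp j), funext fun _ =>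
      (congrArg (·⁻¹) (congrFun hf.base ())).trans inv_one⟩

theorem pointedMap_unitOf {f g : (μ → ℂˣ) → ℂ} (hf : RegOn (good b) f) (hg : RegOn (good b) g)
    (pf : ∀ p, PosPt p → 0 < f p) (pg : ∀ p, PosPt p → 0 < g p) (h1 : f b = g b) (h2 : g b ≠ 0) :
    PointedMap b (fun _ : Unit => 1) fun p _ => unitOf (f p / g p) := by
  refine ⟨fun _ => (hf.div hg (forall_good.2 ⟨fun p hp => (pg p hp).ne', h2⟩)).unitOf
    (forall_good.2 ⟨fun p hp => (div_pos (pf p hp) (pg p hp)).ne', ?_⟩),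
    fun p hp _ => unitOf_pos (div_pos (pf p hp) (pg p hp)), funext fun _ => Units.ext ?_⟩
  · rw [h1, div_self h2]
    exact one_ne_zero
  · rw [h1, div_self h2, coe_unitOf one_ne_zero, Units.val_one]

theorem pointedMap_coord_mul (hF : PointedMap b x₀ F) {f : (μ → ℂˣ) → Fin (X.dim n) → ℂˣ}
    (hf : ∀ j, PointedMap b (fun _ : Unit => 1) fun p _ => f p j) :
    PointedMap b x₀ fun p j => F p j * f p j :=
  ⟨fun j => (hF.regOn j).units_mul ((hf j).regOn ()), fun p hp j =>
    mul_coe_pos (hF.pos p hp j) ((hf j).pos p hp ()), by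
      funext j
      rw [hF.base]
      exact (congrArg (fun u => x₀ j * u) (congrFun (hf j).base ())).trans (mul_one _)⟩

/-- At `c = 1` the numerator and the denominator of the ratio coincide, and their common value
divides the numerator of `ε₀`; so `ε₀ ≠ 0` at the base point is all that is needed. -/
theorem ratio_pointedMap (hX : X.IsPath) {c : (μ → ℂˣ) → ℂˣ}
    (hc : PointedMap b (fun _ : Unit => 1) fun p _ => c p)
    (hM : PointedMap b (fun _ : Unit => L₀) fun p _ => M p) (hF : PointedMap b x₀ F)
    (h₀ : ε0 X n L₀ x₀ ≠ 0) :
    PointedMap b (fun _ : Unit => 1) fun p _ => ratio X n (M p) (c p) (F p) := by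
  have hc1 : c b = 1 := congrFun hc.base ()
  have hM1 : M b = L₀ := congrFun hM.base ()
  have hc' := hc.regOn ()
  have hM' := hM.regOn ()
  have h0 := coord_regOn hF.regOn 0
  have hq := (coord_regOn hF.regOn 1).mul (coord_regOn hF.regOn (X.dim n - 1))
  have p0 : ∀ p, PosPt p → 0 < (coord (F p) 0 : ℂ) := fun p hp => coord_pos (hF.pos p hp) 0
  have pq : ∀ p, PosPt p → 0 < (coord (F p) 1 * coord (F p) (X.dim n - 1) : ℂ) :=
    fun p hp => mul_pos (coord_pos (hF.pos p hp) 1) (coord_pos (hF.pos p hp) _)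
  have pc : ∀ p, PosPt p → 0 < (c p : ℂ) := fun p hp => hc.pos p hp ()
  have pM : ∀ p, PosPt p → 0 < (M p : ℂ) := fun p hp => hM.pos p hp ()
  unfold ratio
  cases X <;> simp only [IsPath] at hX
  case A2evenDagger =>
    refine pointedMap_unitOf ((hc'.mul h0).add (hM'.mul hq))
      (hc'.mul (h0.add (hM'.mul hq))) (fun p hp => ?_) (fun p hp => ?_) ?_ ?_
    · have := p0 p hp; have := pq p hp; have := pc p hp; have := pM p hp
      positivity
    · have := p0 p hp; have := pq p hp; have := pc p hp; have := pM p hp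
      positivity
    · rw [hc1]; simp
    · rw [hc1, hM1, hF.base, Units.val_one, one_mul]
      exact fun h => (div_ne_zero_iff.1 h₀).1 (pow_eq_zero_iff two_ne_zero |>.2 h)
  all_goals
    refine pointedMap_unitOf (((hc'.pow 2).mul (h0.pow 2)).add ((hM'.pow 2).mul hq))
      ((hc'.pow 2).mul ((h0.pow 2).add ((hM'.pow 2).mul hq))) (fun p hp => ?_) (fun p hp => ?_) ?_ ?_
    · have := p0 p hp; have := pq p hp; have := pc p hp; have := pM p hp
      positivity
    · have := p0 p hp; have := pq p hp; have := pc p hp; have := pM p hp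
      positivity
    · rw [hc1]; simp
    · rw [hc1, hM1, hF.base, Units.val_one, one_pow, one_mul]
      exact (div_ne_zero_iff.1 h₀).1

theorem e0_pointedMap (hn : X.minRank ≤ n) {c : (μ → ℂˣ) → ℂˣ}
    (hc : PointedMap b (fun _ : Unit => 1) fun p _ => c p)
    (hM : PointedMap b (fun _ : Unit => L₀) fun p _ => M p) (hF : PointedMap b x₀ F)
    (h₀ : ε0 X n L₀ x₀ ≠ 0) : PointedMap b x₀ fun p => e0 X n (M p) (c p) (F p) := by
  by_cases hX : X.IsForked
  · simp only [e0_of_isForked hX]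
    rw [ε0_of_isForked hX] at h₀
    have := sigmaBar_pointedMap hM
      (schubertE_pointedMap (exists_word hn (one_ne_zero_fin hn)) hc (sigmaBar_pointedMap hM hF) h₀)
    rwa [sigmaBar_sigmaBar hX hn] at this
  by_cases hX' : X.IsPath
  · have h1 : ∀ p, e0 X n (M p) (c p) (F p) = fun j => F p j *
        ((if (j : ℕ) = 0 then c p else 1) * X.ratio n (M p) (c p) (F p) ^ X.weight n j) :=
      fun p => funext fun j => e0_of_isPath hX' hn _ _ _ j
    simp only [h1]
    refine pointedMap_coord_mul hF fun j => pointedMap_mul ?_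
      (pointedMap_pow (ratio_pointedMap hX' hc hM hF h₀) _)
    split_ifs
    exacts [hc, ⟨fun _ => by simpa using RegOn.const 1, fun _ _ _ => by simp, rfl⟩]
  · cases X <;> simp [IsForked, IsPath] at hX hX'
    simp only [e0, div_eq_mul_inv]
    exact pointedMap_coord_mul hF fun _ => pointedMap_inv hc

end

/-- The `γ_i` are monomials, and the actions are regular at `c = 1` wherever the corresponding `ε_i`
does not vanish. So the `ε_i` are the only obstruction to a base point. -/
theorem isRegularFamily_V (hn : X.minRank ≤ n) (L : ℂˣ) (y₀ : Fin (X.dim n) → ℂˣ)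
    (h₀ : ∀ i, (V X n L).ε i y₀ ≠ 0) :
    CrystalData.IsRegularFamily (fun M : Unit → ℂˣ => V X n (M ())) (fun _ => L) y₀ where
  γ_reg i := (RegOn.units_prod _ fun j _ => (RegOn.coord (Sum.inr j)).units_zpow _).units_mul
    ((RegOn.coord (Sum.inl ())).units_zpow _)
  γ_pos i L x hL hx := mul_coe_pos (prod_coe_pos _ fun j _ => zpow_coe_pos (hx j) _)
    (zpow_coe_pos (hL ()) _)
  γ_ne i := by
    simp only [V, schubertγ]
    exact Units.ne_zero _
  ε_reg i := by
    simp only [V]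
    split_ifs
    exacts [ε0_regOn (RegOn.coord _) fun j => RegOn.coord _, schubertε_regOn fun j => RegOn.coord _]
  ε_pos i L x hL hx := by
    simp only [V]
    split_ifs with hi
    exacts [ε0_pos hn (hL ()) hx, schubertε_pos (exists_word hn hi) hx]
  ε_ne := h₀
  e_map i := by
    have := h₀ i
    simp only [V] at this ⊢
    split_ifs at this ⊢ with hi
    · exact e0_pointedMap (M := fun p => p (Sum.inr (Sum.inl ()))) hn
        ⟨fun _ => RegOn.coord _, fun p hp _ => hp _, rfl⟩
        ⟨fun _ => RegOn.coord _, fun p hp _ => hp _, rfl⟩ (PointedMap.precomp (Sum.inr ∘ Sum.inr)) this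
    · exact schubertE_pointedMap (exists_word hn hi)
        ⟨fun _ => RegOn.coord _, fun p hp _ => hp _, rfl⟩ (PointedMap.precomp (Sum.inr ∘ Sum.inr)) this

theorem exists_add_ε0_ne_zero (hn : X.minRank ≤ n) (L : ℂˣ) (a : ℂ) :
    ∃ x, a + ε0 X n L x ≠ 0 := by
  have key : (∃ x y, ε0 X n L x ≠ ε0 X n L y) → ∃ x, a + ε0 X n L x ≠ 0 := by
    rintro ⟨x, y, h⟩
    by_contra! h'
    exact h (add_left_cancel ((h' _).trans (h' _).symm))
  have hL := L.ne_zero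
  by_cases hX : X.IsForked
  · obtain ⟨z, hz⟩ := exists_add_schubertε_ne_zero (X.cartan n)
      (exists_word hn (one_ne_zero_fin hn)) a
    exact ⟨sigmaBar X n L z, by rwa [ε0_of_isForked hX, sigmaBar_sigmaBar hX hn]⟩
  cases X <;> simp [IsForked] at hX <;> simp only [minRank] at hn
  · refine key ⟨fun _ => 1, fun _ => -1, ?_⟩
    simp only [ε0]
    rw [coord_eq _ (by simp only [dim]; omega), coord_eq _ (by simp only [dim]; omega)]
    simp only [Units.val_neg, Units.val_one, ne_eq]
    intro h
    have : (L : ℂ) = 0 := by linear_combination h / 2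
    exact hL this
  all_goals
    -- Changing the sign of `x₁` alone changes the sign of `x₁ x̄₁`, because `x̄₁` sits at the place
    -- `2n - 1 ≠ 1`.
    refine key ⟨fun _ => 1, fun j => if (j : ℕ) = 1 then -1 else 1, ?_⟩
    have h2 : 2 * n - 1 ≠ 1 := by omega
    have h3 : 0 < n := by omega
    have h4 : 1 < 2 * n := by omega
    simp [ε0, coord, dim, h2, h3, h4]
    intro h
    apply hL
  · have : (L : ℂ) ^ 2 = 0 := by linear_combination h / 2
    exact pow_eq_zero_iff two_ne_zero |>.1 this
  · have : (L : ℂ) ^ 2 = 0 := by linear_combination h / 2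
    exact pow_eq_zero_iff two_ne_zero |>.1 this
  · linear_combination h / 4

/-- None of the finitely many functions `ε_i` and `a_i + ε_i` is identically zero, so generically
all are non-zero at once. -/
theorem exists_base (hn : X.minRank ≤ n) (L : ℂˣ) (a : Fin (n + 1) → ℂ) :
    ∃ y₀, CrystalData.IsRegularFamily (fun M : Unit → ℂˣ => V X n (M ())) (fun _ => L) y₀ ∧
      ∀ i, a i + (V X n L).ε i y₀ ≠ 0 := by
  have h1 : ∀ i (a : ℂ), ∀ᶠ y in generic (Fin (X.dim n)), a + (V X n L).ε i y ≠ 0 := by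
    intro i a
    refine RegOn.generic_ne_zero ((RegOn.const a).add ?_) ?_
    · simp only [V]
      split_ifs
      exacts [ε0_regOn (RegOn.const _) fun j => RegOn.coord _, schubertε_regOn fun j => RegOn.coord _]
    · simp only [V]
      split_ifs with hi
      exacts [exists_add_ε0_ne_zero hn L a, exists_add_schubertε_ne_zero _ (exists_word hn hi) a]
  have := generic_neBot (Fin (X.dim n))
  obtain ⟨y₀, hy, hy'⟩ := ((eventually_all.2 fun i => h1 i 0).and
    (eventually_all.2 fun i => h1 i (a i))).exists
  exact ⟨y₀, isRegularFamily_V hn L y₀ fun i => by simpa using hy i, hy'⟩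

end AffineType

/-! ### Pairs of indices -/

section Single

variable {I : Type} [DecidableEq I] {A : Matrix I I ℤ} {m : ℕ} {w : Fin m → I} {i : I} {r₀ : Fin m}

theorem filter_eq_single (h : ∀ r, w r = i ↔ r = r₀) :
    ({r | w r = i} : Finset (Fin m)) = {r₀} := by
  ext r
  simp [h]

theorem schubertTerm_ne_zero (x : Fin m → ℂˣ) (r : Fin m) : schubertTerm A w i x r ≠ 0 :=
  Units.ne_zero _

theorem schubertε_single (h : ∀ r, w r = i ↔ r = r₀) (x : Fin m → ℂˣ) :
    schubertε A w i x = schubertTerm A w i x r₀ := by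
  rw [schubertε, filter_eq_single h, Finset.sum_singleton]

theorem schubertE_single (h : ∀ r, w r = i ↔ r = r₀) (c : ℂˣ) (x : Fin m → ℂˣ) (j : Fin m) :
    schubertE A w i c x j = x j * if j = r₀ then c else 1 := by
  rw [schubertE, filter_eq_single h, Finset.sum_singleton, Finset.sum_singleton,
    mul_div_mul_right _ _ (schubertTerm_ne_zero x r₀)]
  congr 1
  refine Units.ext ?_
  rcases lt_trichotomy j r₀ with hj | rfl | hj
  · rw [if_neg hj.not_ge, if_neg hj.not_gt, if_neg hj.ne, div_one, coe_unitOf one_ne_zero,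
      Units.val_one]
  · rw [if_pos le_rfl, if_neg (lt_irrefl _), if_pos rfl, div_one, coe_unitOf c.ne_zero]
  · rw [if_pos hj.le, if_pos hj, if_neg hj.ne', div_self c.ne_zero, coe_unitOf one_ne_zero,
      Units.val_one]

end Single

namespace CrystalData

variable {I ι κ : Type} {A : Matrix I I ℤ} {D : CrystalData I ι} {i j : I}

/-- For the indices `i, j`, in either order, `D` is induced by a unipotent crystal. -/
def UnipotentAt (A : Matrix I I ℤ) (D : CrystalData I ι) (i j : I) : Prop :=
  ∀ (R : RankTwoModel) (idx : Fin 2 → I),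
    ((idx 0 = i ∧ idx 1 = j) ∨ (idx 0 = j ∧ idx 1 = i)) →
      (∀ k l, A (idx k) (idx l) = R.a k l) → IsUnipotentPair R D idx

theorem UnipotentAt.symm (h : UnipotentAt A D i j) : UnipotentAt A D j i :=
  fun R idx hidx => h R idx hidx.symm

theorem hasUnipotentPairs_of_unipotentAt (hA : ∀ i, A i i = 2)
    (h : ∀ i j, i ≠ j → UnipotentAt A D i j) : HasUnipotentPairs A D := by
  refine ⟨fun i j hij h1 h2 => ?_, fun i j hij h1 h2 => ?_, fun i j hij h1 h2 => ?_⟩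
  all_goals
    refine h i j hij _ _ (Or.inl ⟨rfl, rfl⟩) fun k l => ?_
    fin_cases k <;> fin_cases l
    exacts [hA i, h1, h2, hA j]

/-- `IsUnipotentPair.of_map` with a relabelling `s` of the indices, as needed for diagram
automorphisms; all conditions are restricted to the two indices at hand. -/
theorem UnipotentAt.of_map {D' : CrystalData I κ} (s : I → I)
    (h : UnipotentAt A D' (s i) (s j))
    (hA : ∀ k l, k = i ∨ k = j → l = i ∨ l = j → A (s k) (s l) = A k l) {K : Type}
    (Φ : (ι → ℂˣ) → (κ → ℂˣ)) (hΦ : ∀ x, PosPt x → PosPt (Φ x)) (inv : (ι → ℂˣ) → K)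
    (g : K → I → ℂ) (hg : ∀ x k, k = i ∨ k = j → PosPt x → g (inv x) k ≠ 0)
    (hinj : ∀ x y, PosPt x → PosPt y → Φ x = Φ y → inv x = inv y → x = y)
    (he : ∀ k (c : ℂˣ) x, k = i ∨ k = j → 0 < (c : ℂ) → PosPt x →
      Φ (D.e k c x) = D'.e (s k) c (Φ x))
    (hinv : ∀ k (c : ℂˣ) x, k = i ∨ k = j → 0 < (c : ℂ) → PosPt x → inv (D.e k c x) = inv x)
    (hε : ∀ k x, k = i ∨ k = j → PosPt x → D.ε k x = D'.ε (s k) (Φ x))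
    (hγ : ∀ k x, k = i ∨ k = j → PosPt x → D.γ k x = D'.γ (s k) (Φ x) * g (inv x) k) :
    UnipotentAt A D i j := by
  intro R idx hidx hR
  have hk : ∀ k, idx k = i ∨ idx k = j := fun k => by
    rcases hidx with ⟨h0, h1⟩ | ⟨h0, h1⟩ <;> fin_cases k
    exacts [Or.inl h0, Or.inr h1, Or.inr h0, Or.inl h1]
  refine IsUnipotentPair.of_map (idx' := s ∘ idx) (h R _ ?_ fun k l => ?_) Φ hΦ inv
    (fun x k => g x (idx k)) (fun x k => hg x _ (hk k)) hinj (fun k c x => he _ c x (hk k))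
    (fun k c x => hinv _ c x (hk k)) (fun k x => hε _ x (hk k)) fun k x => hγ _ x (hk k)
  · rcases hidx with ⟨h0, h1⟩ | ⟨h0, h1⟩
    exacts [Or.inl ⟨congrArg s h0, congrArg s h1⟩, Or.inr ⟨congrArg s h0, congrArg s h1⟩]
  · rw [← hR]
    exact hA _ _ (hk k) (hk l)

theorem unipotentAt_schubert [DecidableEq I] {m : ℕ} (w : Fin m → I) (ξ : I → ℂˣ) (hij : i ≠ j) :
    UnipotentAt A (schubert A w ξ) i j := fun R idx hidx hR =>
  isUnipotentPair_schubert R (by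
    have : idx 0 ≠ idx 1 := by
      rcases hidx with ⟨h0, h1⟩ | ⟨h0, h1⟩ <;> rw [h0, h1]
      exacts [hij, hij.symm]
    intro k l hkl
    fin_cases k <;> fin_cases l
    exacts [rfl, (this hkl).elim, (this hkl.symm).elim, rfl]) hR w ξ

/-- The identities that involve only the index `i`. -/
structure RankOne (A : Matrix I I ℤ) (D : CrystalData I ι) (i : I) : Prop where
  e_one : ∀ x, PosPt x → D.e i 1 x = x
  e_mul : ∀ (c d : ℂˣ), 0 < (c : ℂ) → 0 < (d : ℂ) → ∀ x, PosPt x →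
    D.e i c (D.e i d x) = D.e i (c * d) x
  ε_e : ∀ (c : ℂˣ), 0 < (c : ℂ) → ∀ x, PosPt x → D.ε i (D.e i c x) = D.ε i x / c
  γ_e : ∀ (c : ℂˣ), 0 < (c : ℂ) → ∀ x, PosPt x →
    D.γ i (D.e i c x) = (c : ℂ) ^ A i i * D.γ i x

theorem UnipotentAt.exists_pair (h : UnipotentAt A D i j) (hA : ∀ i, A i i = 2)
    (hA' : RankTwoEntries (A i j) (A j i)) :
    ∃ (R : RankTwoModel) (idx : Fin 2 → I) (k l : Fin 2), idx k = i ∧ idx l = j ∧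
      R.a k l = A i j ∧ IsUnipotentPair R D idx := by
  have key : ∀ (R : RankTwoModel) (i j : I), UnipotentAt A D i j →
      R.a 0 0 = 2 → R.a 1 1 = 2 → A i j = R.a 0 1 → A j i = R.a 1 0 →
      IsUnipotentPair R D ![i, j] := fun R i j h a0 a1 h1 h2 =>
    h R _ (Or.inl ⟨rfl, rfl⟩) fun k l => by
      fin_cases k <;> fin_cases l
      exacts [(hA i).trans a0.symm, h1, h2, (hA j).trans a1.symm]
  rcases hA' with ⟨h1, h2⟩ | ⟨h1, h2⟩ | ⟨h1, h2⟩ | ⟨h1, h2⟩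
  · exact ⟨_, _, 0, 1, rfl, rfl, h1.symm, key A1A1Model i j h rfl rfl h1 h2⟩
  · exact ⟨_, _, 0, 1, rfl, rfl, h1.symm, key A2Model i j h rfl rfl h1 h2⟩
  · exact ⟨_, _, 0, 1, rfl, rfl, h1.symm, key C2Model i j h rfl rfl h1 h2⟩
  · exact ⟨_, _, 1, 0, rfl, rfl, h1.symm, key C2Model j i h.symm rfl rfl h2 h1⟩

theorem UnipotentAt.rankOne (h : UnipotentAt A D i j) (hA : ∀ i, A i i = 2)
    (hA' : RankTwoEntries (A i j) (A j i)) (hD : D.IsPositive) : RankOne A D i := by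
  obtain ⟨R, idx, k, l, rfl, -, -, hp⟩ := h.exists_pair hA hA'
  refine ⟨hp.e_one hD k, fun c d hc hd => hp.e_mul hD k hc hd, fun c hc => hp.ε_e hD k hc,
    fun c hc x hx => ?_⟩
  rw [hA, ← R.a_self k]
  exact hp.γ_e hD k k hc x hx

/-- If the actions `e_i` and `e_j` commute, then `D` is induced by a unipotent crystal for the
indices `i` and `j`. -/
theorem unipotentAt_of_commute [DecidableEq I] (hij : i ≠ j) (hD : D.IsPositive)
    (hi : RankOne A D i) (hj : RankOne A D j)
    (hcomm : ∀ c d : ℂˣ, 0 < (c : ℂ) → 0 < (d : ℂ) → ∀ x, PosPt x →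
      D.e i c (D.e j d x) = D.e j d (D.e i c x))
    (hεi : ∀ c : ℂˣ, 0 < (c : ℂ) → ∀ x, PosPt x → D.ε i (D.e j c x) = D.ε i x)
    (hεj : ∀ c : ℂˣ, 0 < (c : ℂ) → ∀ x, PosPt x →
      D.ε j (D.e i c x) = (c : ℂ) ^ (-A i j) * D.ε j x)
    (hγj : ∀ c : ℂˣ, 0 < (c : ℂ) → ∀ x, PosPt x → D.γ j (D.e i c x) = (c : ℂ) ^ A i j * D.γ j x)
    (hγi : ∀ c : ℂˣ, 0 < (c : ℂ) → ∀ x, PosPt x → D.γ i (D.e j c x) = (c : ℂ) ^ A j i * D.γ i x) :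
    UnipotentAt A D i j := by
  have hE : ∀ k x, PosPt x → (unitOf (D.ε k x) : ℂ) = D.ε k x := fun k x hx =>
    coe_unitOf (hD.ε_pos k x hx).ne'
  -- On the cell of the word `(i, j)` with coordinates `u, v` one has `ε_i = u⁻¹` and `ε_j =
  -- u^{-a_ij} v⁻¹`; solving for `u` and `v` gives these functions.
  let u : (ι → ℂˣ) → ℂˣ := fun x => (unitOf (D.ε i x))⁻¹
  let v : (ι → ℂˣ) → ℂˣ := fun x => unitOf (D.ε i x) ^ A i j / unitOf (D.ε j x)
  have hu : ∀ x, PosPt x → 0 < (u x : ℂ) := fun x hx => inv_coe_pos (unitOf_pos (hD.ε_pos i x hx))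
  have hv : ∀ x, PosPt x → 0 < (v x : ℂ) := fun x hx => div_coe_pos
    (zpow_coe_pos (unitOf_pos (hD.ε_pos i x hx)) _) (unitOf_pos (hD.ε_pos j x hx))
  have Eii : ∀ c : ℂˣ, 0 < (c : ℂ) → ∀ x, PosPt x →
      unitOf (D.ε i (D.e i c x)) = unitOf (D.ε i x) / c := fun c hc x hx => Units.ext (by
    rw [Units.val_div_eq_div_val, hE _ _ hx, hE _ _ (hD.e_pos i hc hx), hi.ε_e c hc x hx])
  have Ejj : ∀ c : ℂˣ, 0 < (c : ℂ) → ∀ x, PosPt x →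
      unitOf (D.ε j (D.e j c x)) = unitOf (D.ε j x) / c := fun c hc x hx => Units.ext (by
    rw [Units.val_div_eq_div_val, hE _ _ hx, hE _ _ (hD.e_pos j hc hx), hj.ε_e c hc x hx])
  have Eji : ∀ c : ℂˣ, 0 < (c : ℂ) → ∀ x, PosPt x →
      unitOf (D.ε j (D.e i c x)) = c ^ (-A i j) * unitOf (D.ε j x) := fun c hc x hx =>
    Units.ext (by
      rw [Units.val_mul, Units.val_zpow_eq_zpow_val, hE _ _ hx, hE _ _ (hD.e_pos i hc hx),
        hεj c hc x hx])
  have ui : ∀ c : ℂˣ, 0 < (c : ℂ) → ∀ x, PosPt x → u (D.e i c x) = u x * c := fun c hc x hx => by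
    simp only [u]
    rw [Eii c hc x hx, inv_div, div_eq_mul_inv, mul_comm]
  have uj : ∀ c : ℂˣ, 0 < (c : ℂ) → ∀ x, PosPt x → u (D.e j c x) = u x := fun c hc x hx => by
    simp only [u]
    rw [hεi c hc x hx]
  have vi : ∀ c : ℂˣ, 0 < (c : ℂ) → ∀ x, PosPt x → v (D.e i c x) = v x := fun c hc x hx => by
    simp only [v]
    rw [Eii c hc x hx, Eji c hc x hx, div_zpow, div_div, zpow_neg, mul_inv_cancel_left]
  have vj : ∀ c : ℂˣ, 0 < (c : ℂ) → ∀ x, PosPt x → v (D.e j c x) = v x * c := fun c hc x hx => by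
    simp only [v]
    rw [hεi c hc x hx, Ejj c hc x hx, div_div_eq_mul_div, div_mul_eq_mul_div]
  let Φ : (ι → ℂˣ) → (Fin 2 → ℂˣ) := fun x => ![u x, v x]
  -- The commuting actions multiply `u`, respectively `v`, by `c`. Moving `x` along them until `u =
  -- v = 1` gives an invariant, and `x` is recovered from it by the reverse motion.
  let inv : (ι → ℂˣ) → (ι → ℂˣ) := fun x => D.e i (u x)⁻¹ (D.e j (v x)⁻¹ x)
  have pinv : ∀ x, PosPt x → PosPt (inv x) := fun x hx =>
    hD.e_pos i (inv_coe_pos (hu x hx)) (hD.e_pos j (inv_coe_pos (hv x hx)) hx)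
  have w0 : ∀ r, (![i, j] : Fin 2 → I) r = i ↔ r = 0 := fun r => by
    fin_cases r <;> simp [hij.symm]
  have w1 : ∀ r, (![i, j] : Fin 2 → I) r = j ↔ r = 1 := fun r => by
    fin_cases r <;> simp [hij]
  refine UnipotentAt.of_map id (unipotentAt_schubert (A := A) ![i, j] 1 hij)
    (fun _ _ _ _ => rfl) Φ (fun x hx k => ?_) inv (fun x k => D.γ k x)
    (fun x k _ hx => (hD.γ_pos k _ (pinv x hx)).ne') (fun x y hx hy h1 h2 => ?_)
    (fun k c x hk hc hx => ?_) (fun k c x hk hc hx => ?_) (fun k x hk hx => ?_)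
    fun k x hk hx => ?_
  · fin_cases k
    exacts [hu x hx, hv x hx]
  · have key : ∀ x, PosPt x → D.e j (v x) (D.e i (u x) (inv x)) = x := fun x hx => by
      have p1 := hD.e_pos j (inv_coe_pos (hv x hx)) hx
      rw [hi.e_mul _ _ (hu x hx) (inv_coe_pos (hu x hx)) _ p1, mul_inv_cancel, hi.e_one _ p1,
        hj.e_mul _ _ (hv x hx) (inv_coe_pos (hv x hx)) _ hx, mul_inv_cancel, hj.e_one _ hx]
    have hux : u x = u y := congrFun h1 0
    have hvx : v x = v y := congrFun h1 1
    rw [← key x hx, ← key y hy, h2, hux, hvx]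
  · refine funext fun r => ?_
    rcases hk with rfl | rfl
    · change _ = schubertE A ![k, j] k c _ r
      rw [schubertE_single w0]
      fin_cases r
      exacts [ui c hc x hx, (vi c hc x hx).trans (mul_one _).symm]
    · change _ = schubertE A ![i, k] k c _ r
      rw [schubertE_single w1]
      fin_cases r
      exacts [(uj c hc x hx).trans (mul_one _).symm, vj c hc x hx]
  · have pu := inv_coe_pos (hu x hx)
    have pv := inv_coe_pos (hv x hx)
    have p1 := hD.e_pos j pv hx
    rcases hk with rfl | rfl
    · simp only [inv]
      rw [ui c hc x hx, vi c hc x hx, ← hcomm _ _ hc pv _ hx,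
        hi.e_mul _ _ (inv_coe_pos (mul_coe_pos (hu x hx) hc)) hc _ p1, mul_inv, inv_mul_cancel_right]
    · simp only [inv]
      rw [uj c hc x hx, vj c hc x hx,
        hj.e_mul _ _ (inv_coe_pos (mul_coe_pos (hv x hx) hc)) hc _ hx, mul_inv, inv_mul_cancel_right]
  · rcases hk with rfl | rfl
    · change _ = schubertε A ![k, j] k (Φ x)
      rw [schubertε_single w0, schubertTerm, Finset.prod_filter]
      simp [Φ, u, hE k x hx]
    · change _ = schubertε A ![i, k] k (Φ x)
      rw [schubertε_single w1, schubertTerm, Finset.prod_filter]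
      simp [Φ, u, v, hE _ x hx]
  · have pu := inv_coe_pos (hu x hx)
    have pv := inv_coe_pos (hv x hx)
    have p1 := hD.e_pos j pv hx
    have hγ : D.γ k (inv x) = ((u x)⁻¹ : ℂˣ) ^ A i k * (((v x)⁻¹ : ℂˣ) ^ A j k * D.γ k x) := by
      simp only [inv]
      rcases hk with rfl | rfl
      · rw [hi.γ_e _ pu _ p1, hγi _ pv _ hx]
      · rw [hγj _ pu _ p1, hj.γ_e _ pv _ hx]
    change _ = schubertγ A ![i, j] 1 k (Φ x) * _
    rw [hγ, schubertγ]
    simp [Φ, Fin.prod_univ_two]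
    have h1 := zpow_ne_zero (A i k) (u x).ne_zero
    have h2 := zpow_ne_zero (A j k) (v x).ne_zero
    field_simp

end CrystalData

namespace AffineType

open CrystalData

variable {X : AffineType} {n : ℕ}

/-! ### Cartan matrices -/

theorem cartan_self (i : Fin (n + 1)) : X.cartan n i i = 2 := by
  simp [cartan, cartanEntry]

theorem cartanEntry_A1 {i j : ℕ} (hi : i ≤ n) (hj : j ≤ n) : cartanEntry A1 n i j =
    if i = j then 2 else if i + 1 = j ∨ j + 1 = i ∨ (i = n ∧ j = 0) ∨ (i = 0 ∧ j = n) then -1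
      else 0 := by
  have key : ∀ i j, i ≤ n → j ≤ n → ((i + 1) % (n + 1) = j ↔ i + 1 = j ∨ (i = n ∧ j = 0)) := by
    intro i j hi hj
    rcases hi.eq_or_lt with rfl | hi
    · rw [Nat.mod_self]
      omega
    · rw [Nat.mod_eq_of_lt (by omega)]
      omega
  simp only [cartanEntry, key i j hi hj, key j i hj hi]
  split_ifs <;> omega

theorem rankTwoEntries_cartan (hn : X.minRank ≤ n) {i j : Fin (n + 1)} (hij : i ≠ j) :
    RankTwoEntries (X.cartan n i j) (X.cartan n j i) := by
  obtain ⟨i, hi⟩ := i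
  obtain ⟨j, hj⟩ := j
  simp only [ne_eq, Fin.mk.injEq] at hij
  simp only [cartan, Matrix.of_apply, RankTwoEntries]
  cases X <;> simp only [minRank] at hn
  case A1 =>
    rw [cartanEntry_A1 (by omega) (by omega), cartanEntry_A1 (by omega) (by omega)]
    split_ifs <;> omega
  all_goals
    simp only [cartanEntry, if_neg hij, if_neg (Ne.symm hij)]
    split_ifs <;> omega

end AffineType

namespace CrystalData

variable {I : Type} [DecidableEq I] {A : Matrix I I ℤ} {m : ℕ} {w : Fin m → I} {i j : I}

theorem exists_rankTwoModel (hA : ∀ i, A i i = 2) (hij : i ≠ j)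
    (hA' : RankTwoEntries (A i j) (A j i)) :
    ∃ (R : RankTwoModel) (idx : Fin 2 → I) (k l : Fin 2), idx k = i ∧ idx l = j ∧
      Function.Injective idx ∧ ∀ k l, A (idx k) (idx l) = R.a k l := by
  have key : ∀ (R : RankTwoModel) (i j : I), i ≠ j → R.a 0 0 = 2 → R.a 1 1 = 2 →
      A i j = R.a 0 1 → A j i = R.a 1 0 → Function.Injective ![i, j] ∧
        ∀ k l, A (![i, j] k) (![i, j] l) = R.a k l := fun R i j hij a0 a1 h1 h2 => by
    refine ⟨fun k l hkl => ?_, fun k l => ?_⟩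
    · fin_cases k <;> fin_cases l
      exacts [rfl, (hij hkl).elim, (hij hkl.symm).elim, rfl]
    · fin_cases k <;> fin_cases l
      exacts [(hA i).trans a0.symm, h1, h2, (hA j).trans a1.symm]
  rcases hA' with ⟨h1, h2⟩ | ⟨h1, h2⟩ | ⟨h1, h2⟩ | ⟨h1, h2⟩
  · exact ⟨_, _, 0, 1, rfl, rfl, key A1A1Model i j hij rfl rfl h1 h2⟩
  · exact ⟨_, _, 0, 1, rfl, rfl, key A2Model i j hij rfl rfl h1 h2⟩
  · exact ⟨_, _, 0, 1, rfl, rfl, key C2Model i j hij rfl rfl h1 h2⟩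
  · exact ⟨_, _, 1, 0, rfl, rfl, key C2Model j i hij.symm rfl rfl h2 h1⟩

/-- Read off from the simple root `γ` of the rank two model; the torus constant `ξ` is a common
factor of both sides. -/
theorem schubertγ_schubertE (hA : ∀ i, A i i = 2) (hij : i ≠ j)
    (hA' : RankTwoEntries (A i j) (A j i)) (hw : ∃ r, w r = i) (ξ : I → ℂˣ) {c : ℂˣ}
    (hc : 0 < (c : ℂ)) {x : Fin m → ℂˣ} (hx : PosPt x) (hx' : PosPt (schubertE A w i c x)) :
    schubertγ A w ξ j (schubertE A w i c x) = (c : ℂ) ^ A i j * schubertγ A w ξ j x := by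
  obtain ⟨R, idx, k, l, rfl, rfl, hidx, hR⟩ := exists_rankTwoModel hA hij hA'
  obtain ⟨f, hf, hf'⟩ := exists_unipotent_schubert R hidx hR w
  have hε := (schubertε_pos (A := A) hw hx).ne'
  have hcb : (c : ℂ) = 1 + (c - 1) / schubertε A w (idx k) x * schubertε A w (idx k) x := by
    rw [div_mul_cancel₀ _ hε]
    ring
  have hs := schubertE_eq hx hc hcb
  have h1 := R.γ_step k l _ (hf.mem _) (hf.mem ⟨_, hx'⟩)
    (hf.ne_zero (x := ⟨x, hx⟩) (y := ⟨_, hx'⟩) hs) (hf.step hs)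
  rw [← (hf' k _).1, ← hcb, ← (hf' l _).2, ← (hf' l _).2, ← hR] at h1
  simp only [schubertγ, Units.val_mul] at h1 ⊢
  rw [h1, mul_assoc]

/-- The terms are characters of the coordinate torus. Hence a scaling on which the terms of `ε_i`
are 1 preserves `ε_i` and commutes with `e_i`. -/
theorem schubertTerm_mul (x t : Fin m → ℂˣ) (r : Fin m) :
    schubertTerm A w i (x * t) r = schubertTerm A w i x r * schubertTerm A w i t r := by
  simp only [schubertTerm, Pi.mul_apply, mul_zpow, Finset.prod_mul_distrib, ← Units.val_mul]
  rw [← mul_inv, mul_mul_mul_comm]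

theorem schubertε_mul {t : Fin m → ℂˣ} (ht : ∀ r, w r = i → schubertTerm A w i t r = 1)
    (x : Fin m → ℂˣ) : schubertε A w i (x * t) = schubertε A w i x :=
  Finset.sum_congr rfl fun r hr => by
    rw [schubertTerm_mul, ht r (by simpa using hr), mul_one]

theorem schubertE_mul {t : Fin m → ℂˣ} (ht : ∀ r, w r = i → schubertTerm A w i t r = 1)
    (c : ℂˣ) (x : Fin m → ℂˣ) : schubertE A w i c (x * t) = schubertE A w i c x * t := by
  have h : ∀ r ∈ ({r | w r = i} : Finset (Fin m)),
      schubertTerm A w i (x * t) r = schubertTerm A w i x r := fun r hr => by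
    rw [schubertTerm_mul, ht r (by simpa using hr), mul_one]
  funext j
  have key : ∀ f : Fin m → ℂ, ∑ r with w r = i, f r * schubertTerm A w i (x * t) r =
      ∑ r with w r = i, f r * schubertTerm A w i x r := fun f =>
    Finset.sum_congr rfl fun r hr => by rw [h r hr]
  simp only [schubertE, Pi.mul_apply, key]
  rw [mul_right_comm]

end CrystalData

/-! ### Scalings by the null weights. -/

namespace AffineType

open CrystalData

variable {X : AffineType} {n : ℕ}

/-- The pairing of the initial segment of the weights with a simple root. -/
def prefixSum (X : AffineType) (n k r : ℕ) : ℤ :=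
  ∑ j ∈ Finset.range r, (X.weight n j : ℤ) * X.cartanEntry n (X.letter n j) k

theorem prefixSum_succ (k r : ℕ) : prefixSum X n k (r + 1) =
    prefixSum X n k r + (X.weight n r : ℤ) * X.cartanEntry n (X.letter n r) k :=
  Finset.sum_range_succ _ _

/-- The partial sums vary only where the word passes `k` or a neighbour of `k`; the indicators
record these places. The analogous formulas for the other types have the same origin. -/
theorem prefixSum_A1 (hn : 2 ≤ n) {k : ℕ} (hkn : k ≤ n) (r : ℕ) (hr : r ≤ n) :
    prefixSum A1 n k r = (if k = n ∧ 1 ≤ r then 1 else 0) - (if r + k = n ∧ 1 ≤ r then 1 else 0) +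
      (if r + k = n + 1 then 1 else 0) - (if k = 0 ∧ 1 ≤ r then 1 else 0) := by
  induction r with
  | zero => simp [prefixSum]; omega
  | succ r ih =>
    rw [prefixSum_succ, ih (by omega)]
    simp only [weight, letter]
    rw [cartanEntry_A1 (by omega) (by omega)]
    grind (splits := 30)

theorem prefixSum_B1 (hn : 2 ≤ n) {k : ℕ} (hk : 1 ≤ k) (hkn : k ≤ n) (r : ℕ) (hr : r ≤ 2 * n - 1) :
    prefixSum B1 n k r = (if r = k ∨ r + k = 2 * n then 1 else 0) -
      (if r + 1 = k ∨ r + k = 2 * n - 1 then 1 else 0) + (if k = 1 then 1 else 0) := by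
  induction r with
  | zero => simp [prefixSum]; split_ifs <;> omega
  | succ r ih =>
    rw [prefixSum_succ, ih (by omega)]
    simp only [weight, letter, cartanEntry, max_eq_left hk]
    by_cases h : r < n
    · simp only [if_pos h, max_eq_left (show 1 ≤ r + 1 by omega)]
      grind (splits := 30)
    · simp only [if_neg h, max_eq_left (show 1 ≤ 2 * n - 1 - r by omega)]
      grind (splits := 30)
theorem prefixSum_A2odd (hn : 3 ≤ n) {k : ℕ} (hk : 1 ≤ k) (hkn : k ≤ n) (r : ℕ) (hr : r ≤ 2 * n - 1) :
    prefixSum A2odd n k r = (if k = n then 2 else 1) * ((if r = k ∨ r + k = 2 * n then 1 else 0) -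
      (if r + 1 = k ∨ r + k = 2 * n - 1 then 1 else 0)) + (if k = 1 then 1 else 0) := by
  induction r with
  | zero => simp [prefixSum]; split_ifs <;> omega
  | succ r ih =>
    rw [prefixSum_succ, ih (by omega)]
    simp only [weight, letter, cartanEntry, max_eq_left hk]
    by_cases h : r < n
    · simp only [if_pos h, max_eq_left (show 1 ≤ r + 1 by omega)]
      grind (splits := 30)
    · simp only [if_neg h, max_eq_left (show 1 ≤ 2 * n - 1 - r by omega)]
      grind (splits := 30)
theorem prefixSum_D2 (hn : 2 ≤ n) {k : ℕ} (hkn : k ≤ n) (r : ℕ) (hr : r ≤ 2 * n) :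
    prefixSum D2 n k r = (if r = k + 1 ∨ r + k = 2 * n + 1 then 1 else 0) -
      (if r = k ∨ r + k = 2 * n then 1 else 0) - (if k = 1 ∧ 1 ≤ r then 1 else 0) + (if k = 0 then 1 else 0) := by
  induction r with
  | zero => simp [prefixSum]; split_ifs <;> omega
  | succ r ih =>
    rw [prefixSum_succ, ih (by omega)]
    simp only [weight, letter, cartanEntry]
    grind (splits := 30)
theorem prefixSum_A2even (hn : 2 ≤ n) {k : ℕ} (hkn : k ≤ n) (r : ℕ) (hr : r ≤ 2 * n) :
    prefixSum A2even n k r = (if k = n then 2 else 1) * ((if r = k + 1 ∨ r + k = 2 * n + 1 then 1 else 0) -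
      (if r = k ∨ r + k = 2 * n then 1 else 0)) - (if k = 1 ∧ 1 ≤ r then 1 else 0) + (if k = 0 then 1 else 0) := by
  induction r with
  | zero => simp [prefixSum]; split_ifs <;> omega
  | succ r ih =>
    rw [prefixSum_succ, ih (by omega)]
    simp only [weight, letter, cartanEntry]
    grind (splits := 30)
theorem prefixSum_A2evenDagger (hn : 2 ≤ n) {k : ℕ} (hkn : k ≤ n) (r : ℕ) (hr : r ≤ 2 * n) :
    prefixSum A2evenDagger n k r = (if k = 0 then 2 else 1) * ((if r = k + 1 ∨ r + k = 2 * n + 1 then 1 else 0) -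
      (if r = k ∨ r + k = 2 * n then 1 else 0)) - (if k = 1 ∧ 1 ≤ r then 1 else 0) + (if k = 0 then 2 else 0) := by
  induction r with
  | zero => simp [prefixSum]; split_ifs <;> omega
  | succ r ih =>
    rw [prefixSum_succ, ih (by omega)]
    simp only [weight, letter, cartanEntry]
    grind (splits := 30)
theorem prefixSum_D1 (hn : 4 ≤ n) {k : ℕ} (hk : 1 ≤ k) (hkn : k ≤ n) (r : ℕ) (hr : r ≤ 2 * n - 2) :
    prefixSum D1 n k r = (if k < n ∧ r = k ∨ (k + 1 < n ∧ r + k = 2 * n - 1) ∨ (k + 1 = n ∧ r = n) ∨ (k = n ∧ r = n) then 1 else 0) -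
      (if r + 1 = k ∨ (k + 1 < n ∧ r + k = 2 * n - 2) ∨ (k = n ∧ r + 2 = n) then 1 else 0) + (if k = 1 then 1 else 0) := by
  induction r with
  | zero => simp [prefixSum]; split_ifs <;> omega
  | succ r ih =>
    rw [prefixSum_succ, ih (by omega)]
    simp only [weight, letter, cartanEntry, max_eq_left hk]
    by_cases h : r < n
    · simp only [if_pos h, max_eq_left (show 1 ≤ r + 1 by omega)]
      grind (splits := 30)
    · simp only [if_neg h, max_eq_left (show 1 ≤ 2 * n - 2 - r by omega)]
      grind (splits := 30)

/-- Scaling by `s` multiplies the term at `r` by `s` to the power `-(prefixSum + weight)`; this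
exponent is zero at every occurrence of a letter `k ≥ 2`. -/
theorem prefixSum_letter (hn : X.minRank ≤ n) (hX : X.IsForked ∨ X.IsPath) {k r : ℕ} (hk : 2 ≤ k)
    (hkn : k ≤ n) (hr : r < X.dim n) (h : X.letter n r = k) :
    X.prefixSum n k r = -(X.weight n r : ℤ) := by
  cases X <;> simp only [IsForked, IsPath, or_self, or_true, true_or] at hX <;>
    simp only [minRank] at hn <;> simp only [dim] at hr <;> simp only [letter] at h <;>
    simp only [weight]
  · rw [prefixSum_B1 hn (by omega) hkn _ hr.le]; grind
  · rw [prefixSum_D1 hn (by omega) hkn _ hr.le]; grind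
  · rw [prefixSum_A2odd hn (by omega) hkn _ hr.le]; grind
  · rw [prefixSum_D2 hn hkn _ hr.le]; grind
  · rw [prefixSum_A2even hn hkn _ hr.le]; grind
  · rw [prefixSum_A2evenDagger hn hkn _ hr.le]; grind

/-- Over the whole word the weights of the letters add up to a left null vector of the Cartan
matrix. -/
theorem prefixSum_dim_path (hn : X.minRank ≤ n) (hX : X.IsPath) {k : ℕ}
    (hkn : k ≤ n) : X.prefixSum n k (X.dim n) = 0 := by
  cases X <;> simp only [IsPath] at hX <;>
    simp only [minRank] at hn <;> simp only [dim]
  · rw [prefixSum_D2 hn hkn _ le_rfl]; grind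
  · rw [prefixSum_A2even hn hkn _ le_rfl]; grind
  · rw [prefixSum_A2evenDagger hn hkn _ le_rfl]; grind

/-- The word contains 1 twice and omits 0, so compared with a left null vector the row of 1 replaces
that of 0. These rows agree in the columns `k ≥ 2`. -/
theorem prefixSum_dim_forked (hn : X.minRank ≤ n) (hX : X.IsForked) {k : ℕ} (hk : 1 ≤ k)
    (hkn : k ≤ n) : X.prefixSum n k (X.dim n) = if k = 1 then 2 else 0 := by
  cases X <;> simp only [IsForked] at hX <;>
    simp only [minRank] at hn <;> simp only [dim]
  · rw [prefixSum_B1 hn (by omega) hkn _ le_rfl]; grind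
  · rw [prefixSum_D1 hn (by omega) hkn _ le_rfl]; grind
  · rw [prefixSum_A2odd hn (by omega) hkn _ le_rfl]; grind

/-- The all-ones vector is a left null vector, and the word omits only the letter 0. -/
theorem prefixSum_dim_A1 (hn : 2 ≤ n) {k : ℕ}
    (hkn : k ≤ n) : prefixSum A1 n k (dim A1 n) = - cartanEntry A1 n 0 k := by
  simp only [dim]
  rw [prefixSum_A1 hn hkn _ le_rfl, cartanEntry_A1 (by omega) hkn]; grind (splits := 20)

theorem word_val (hn : X.minRank ≤ n) (r : Fin (X.dim n)) : (X.word n r : ℕ) = X.letter n r := by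
  obtain ⟨r, hr⟩ := r
  rw [word, Fin.val_ofNat, Nat.mod_eq_of_lt]
  cases X <;> simp only [minRank] at hn <;> simp only [dim] at hr <;> simp only [letter]
  all_goals first | omega | (split_ifs <;> omega)

theorem dim_pos (hn : X.minRank ≤ n) : 2 ≤ X.dim n := by
  cases X <;> simp only [minRank] at hn <;> simp only [dim] <;> omega

/-- Scaling all coordinates by the null weights, and the coordinate at place `0` by `c`. -/
def scale (X : AffineType) (n : ℕ) (c s : ℂˣ) : Fin (X.dim n) → ℂˣ := fun j =>
  (if (j : ℕ) = 0 then c else 1) * s ^ X.weight n j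

theorem prod_scale (hn : X.minRank ≤ n) (c s : ℂˣ) (k : Fin (n + 1)) (p : Fin (X.dim n) → Prop)
    [DecidablePred p] (r : ℕ) (hr : r ≤ X.dim n) (hp : ∀ j, p j ↔ (j : ℕ) < r) :
    ∏ j with p j, scale X n c s j ^ X.cartan n (X.word n j) k =
      (if 0 < r then c ^ X.cartanEntry n (X.letter n 0) k else 1) * s ^ X.prefixSum n k r := by
  have h1 : ∏ j with p j, scale X n c s j ^ X.cartan n (X.word n j) k =
      ∏ j ∈ Finset.range r, ((if j = 0 then c else 1) * s ^ X.weight n j) ^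
        X.cartanEntry n (X.letter n j) k := by
    refine Finset.prod_bij (fun j _ => (j : ℕ)) (fun j hj => by simpa [hp] using hj)
      (fun _ _ _ _ h => Fin.ext h) (fun j hj => ?_) (fun j hj => ?_)
    · rw [Finset.mem_range] at hj
      exact ⟨⟨j, by omega⟩, by simpa [hp] using hj, rfl⟩
    · simp only [scale, cartan, Matrix.of_apply, word_val hn]
  rw [h1]
  clear h1 hp
  induction r with
  | zero => simp [prefixSum]
  | succ r ih =>
    rw [Finset.prod_range_succ, ih (by omega), prefixSum_succ, zpow_add, mul_zpow, zpow_mul,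
      zpow_natCast]
    rcases Nat.eq_zero_or_pos r with rfl | h
    · simp [prefixSum]
    · simp [h, h.ne', mul_assoc]

theorem schubertTerm_scale (hn : X.minRank ≤ n) (hX : X.IsForked ∨ X.IsPath) {k : Fin (n + 1)}
    (hk : 2 ≤ (k : ℕ)) {c : ℂˣ} (hc : c = 1 ∨ X.IsPath) (s : ℂˣ) (r : Fin (X.dim n))
    (hr : X.word n r = k) : schubertTerm (X.cartan n) (X.word n) k (scale X n c s) r = 1 := by
  rw [← hr, word_val hn] at hk
  rw [schubertTerm, prod_scale hn c s k (· < r) r r.2.le (fun j => Fin.lt_def), scale,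
    prefixSum_letter hn hX (by rwa [← hr, word_val hn]) (by omega) r.2 (by rw [← hr, word_val hn])]
  have h0 : (r : ℕ) ≠ 0 := by
    intro h0
    rw [h0] at hk
    cases X <;> simp only [IsForked, IsPath, or_self, or_true, true_or] at hX <;>
      simp only [letter] at hk <;> revert hk <;> split_ifs <;> simp only [minRank] at hn <;> omega
  have h1 : c ^ X.cartanEntry n (X.letter n 0) k = 1 := by
    rcases hc with rfl | hX'
    · exact one_zpow _
    -- The additional factor `c` at the coordinate `x₀` is harmless, since 0 is joined only to 1 in
    -- a path.
    · have : X.cartanEntry n (X.letter n 0) k = 0 := by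
        rw [← hr, word_val hn]
        cases X <;> simp only [IsPath] at hX' <;> simp only [minRank] at hn <;>
          simp only [cartanEntry, letter] at hk ⊢ <;> grind (splits := 20)
      rw [this, zpow_zero]
  rw [if_pos (Nat.pos_of_ne_zero h0), h1, if_neg h0, one_mul, one_mul, zpow_neg, zpow_natCast,
    inv_mul_cancel, inv_one, Units.val_one]

theorem schubertγ_scale (hn : X.minRank ≤ n) (ξ : Fin (n + 1) → ℂˣ) (c s : ℂˣ) (k : Fin (n + 1))
    (x : Fin (X.dim n) → ℂˣ) : schubertγ (X.cartan n) (X.word n) ξ k (x * scale X n c s) =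
      schubertγ (X.cartan n) (X.word n) ξ k x * ((c ^ X.cartanEntry n (X.letter n 0) k : ℂˣ) *
        (s ^ X.prefixSum n k (X.dim n) : ℂˣ)) := by
  have h := prod_scale hn c s k (fun _ => True) (X.dim n) le_rfl (fun j => by simp [j.2])
  rw [if_pos (by have := dim_pos hn; omega), Finset.filter_true] at h
  simp only [schubertγ, Pi.mul_apply, mul_zpow, Finset.prod_mul_distrib, ← Units.val_mul]
  rw [h, mul_right_comm]

end AffineType

/-! ### The crystals `V(g)_L` away from node 0. -/

namespace AffineType

open CrystalData

variable {X : AffineType} {n : ℕ} {L : ℂˣ} {i j : Fin (n + 1)}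

theorem isPositive_V (hn : X.minRank ≤ n) (hL : 0 < (L : ℂ)) : (V X n L).IsPositive := by
  obtain ⟨y₀, h, -⟩ := exists_base hn L 0
  exact h.isPositive (L := fun _ => L) fun _ => hL

theorem V_e_zero (c : ℂˣ) (x : Fin (X.dim n) → ℂˣ) : (V X n L).e 0 c x = X.e0 n L c x := by
  simp [V]

theorem V_e (hi : i ≠ 0) (c : ℂˣ) (x : Fin (X.dim n) → ℂˣ) :
    (V X n L).e i c x = schubertE (X.cartan n) (X.word n) i c x :=
  if_neg hi

theorem V_ε_zero (x : Fin (X.dim n) → ℂˣ) : (V X n L).ε 0 x = X.ε0 n L x := by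
  simp [V]

theorem V_ε (hi : i ≠ 0) (x : Fin (X.dim n) → ℂˣ) :
    (V X n L).ε i x = schubertε (X.cartan n) (X.word n) i x :=
  if_neg hi

theorem V_γ (x : Fin (X.dim n) → ℂˣ) : (V X n L).γ i x =
    schubertγ (X.cartan n) (X.word n) (fun i => L ^ X.weightH n i) i x := rfl

theorem unipotentAt_V (hi : i ≠ 0) (hj : j ≠ 0) (hij : i ≠ j) :
    UnipotentAt (X.cartan n) (V X n L) i j := by
  have hk : ∀ k, k = i ∨ k = j → k ≠ 0 := by
    rintro k (rfl | rfl)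
    exacts [hi, hj]
  exact UnipotentAt.of_map id (unipotentAt_schubert (X.word n) (fun i => L ^ X.weightH n i) hij)
    (fun _ _ _ _ => rfl) id (fun _ h => h) (fun _ => ()) (fun _ _ => 1)
    (fun _ _ _ _ => one_ne_zero) (fun _ _ _ _ h _ => h) (fun k c x h _ _ => V_e (hk k h) c x)
    (fun _ _ _ _ _ _ => rfl) (fun k x h _ => V_ε (hk k h) x) fun _ _ _ _ => (mul_one _).symm

theorem two_le (hn : X.minRank ≤ n) : 2 ≤ n := by
  cases X <;> simp only [minRank] at hn <;> omega

theorem rankOne_V (hn : X.minRank ≤ n) (hL : 0 < (L : ℂ)) (hi : i ≠ 0) :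
    RankOne (X.cartan n) (V X n L) i := by
  have h2 := two_le hn
  obtain ⟨j, hj, hij⟩ : ∃ j : Fin (n + 1), j ≠ 0 ∧ i ≠ j := by
    by_cases h : (i : ℕ) = 1
    · exact ⟨⟨2, by omega⟩, by simp [Fin.ext_iff], by simp [Fin.ext_iff, h]⟩
    · exact ⟨⟨1, by omega⟩, by simp [Fin.ext_iff], by simpa [Fin.ext_iff] using h⟩
  exact (unipotentAt_V hi hj hij).rankOne cartan_self (rankTwoEntries_cartan hn hij)
    (isPositive_V hn hL)

theorem V_γ_e (hn : X.minRank ≤ n) (hL : 0 < (L : ℂ)) (hi : i ≠ 0) (hij : i ≠ j) {c : ℂˣ}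
    (hc : 0 < (c : ℂ)) {x : Fin (X.dim n) → ℂˣ} (hx : PosPt x) :
    (V X n L).γ j ((V X n L).e i c x) = (c : ℂ) ^ X.cartan n i j * (V X n L).γ j x := by
  have := (isPositive_V hn hL).e_pos i hc hx
  rw [V_e hi] at this ⊢
  simp only [V_γ]
  exact schubertγ_schubertE cartan_self hij (rankTwoEntries_cartan hn hij) (exists_word hn hi) _ hc
    hx this

theorem V_γ_scale (hn : X.minRank ≤ n) (c s : ℂˣ) (x : Fin (X.dim n) → ℂˣ) :
    (V X n L).γ i (x * scale X n c s) = (V X n L).γ i x *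
      ((c ^ X.cartanEntry n (X.letter n 0) i : ℂˣ) * (s ^ X.prefixSum n i (X.dim n) : ℂˣ)) := by
  simp only [V_γ]
  exact schubertγ_scale hn _ c s i x

/-! ### The type `A_n^{(1)}` -/

section A1

theorem e0_A1 (c : ℂˣ) (x : Fin (dim A1 n) → ℂˣ) :
    e0 A1 n L c x = x * scale A1 n 1 c⁻¹ := by
  funext j
  simp [e0, scale, weight, div_eq_mul_inv]

theorem V_γ_e0_A1 (hn : 2 ≤ n) (c : ℂˣ) (x : Fin (dim A1 n) → ℂˣ) :
    (V A1 n L).γ i ((V A1 n L).e 0 c x) = (c : ℂ) ^ cartan A1 n 0 i * (V A1 n L).γ i x := by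
  rw [V_e_zero, e0_A1, V_γ_scale hn, prefixSum_dim_A1 hn (by omega), one_zpow, Units.val_one,
    one_mul, inv_zpow', neg_neg, mul_comm, Units.val_zpow_eq_zpow_val]
  rfl

theorem rankOne_zero_A1 (hn : 2 ≤ n) : RankOne (cartan A1 n) (V A1 n L) 0 where
  e_one x _ := by
    rw [V_e_zero]
    funext j
    exact div_one _
  e_mul c d _ _ x _ := by
    simp only [V_e_zero]
    funext j
    simp only [e0]
    rw [div_div, mul_comm]
  ε_e c _ x _ := by
    have : n - 1 < dim A1 n := by simp only [dim]; omega
    simp only [V_ε_zero, V_e_zero, ε0, e0, coord_eq _ this, Units.val_div_eq_div_val]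
    rw [mul_div_assoc]
  γ_e c _ x _ := V_γ_e0_A1 hn c x

theorem word_A1 (hn : 2 ≤ n) (hj : j ≠ 0) (r : Fin (dim A1 n)) :
    word A1 n r = j ↔ r = ⟨n - j, by
      have : (j : ℕ) ≠ 0 := fun h => hj (Fin.ext h)
      simp only [dim]; omega⟩ := by
  have : (r : ℕ) < n := r.2
  rw [Fin.ext_iff, Fin.ext_iff, word_val hn]
  simp only [letter]
  omega

theorem ε_e0_A1 (hn : 2 ≤ n) (hj : j ≠ 0) (c : ℂˣ) (x : Fin (dim A1 n) → ℂˣ) :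
    (V A1 n L).ε j ((V A1 n L).e 0 c x) = (if (j : ℕ) = n then (c : ℂ) else 1) * (V A1 n L).ε j x := by
  have h0 : (j : ℕ) ≠ 0 := fun h => hj (Fin.ext h)
  rw [V_e_zero, e0_A1, V_ε hj, V_ε hj, schubertε_single (word_A1 hn hj),
    schubertε_single (word_A1 hn hj), schubertTerm_mul, mul_comm]
  congr 1
  rw [schubertTerm, prod_scale hn 1 c⁻¹ j (· < _) (n - j) (by simp only [dim]; omega)
    (fun r => Fin.lt_def), scale, prefixSum_A1 hn (by omega) _ (by omega)]
  by_cases h : (j : ℕ) = n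
  · simp [weight, h]
  · have h1 : n - (j : ℕ) + j = n := by omega
    have h2 : 1 ≤ n - (j : ℕ) := by omega
    simp [weight, h, h0, h1, h2]

theorem ε_zero_e_A1 (hn : 2 ≤ n) (hj : j ≠ 0) (c : ℂˣ) (x : Fin (dim A1 n) → ℂˣ) :
    (V A1 n L).ε 0 ((V A1 n L).e j c x) = (if (j : ℕ) = 1 then (c : ℂ) else 1) * (V A1 n L).ε 0 x := by
  have h0 : (j : ℕ) ≠ 0 := fun h => hj (Fin.ext h)
  have : n - 1 < dim A1 n := by simp only [dim]; omega
  simp only [V_ε_zero, V_e hj, ε0, coord_eq _ this]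
  rw [schubertE_single (word_A1 hn hj)]
  simp only [Fin.mk.injEq]
  by_cases h : (j : ℕ) = 1
  · simp [h]
    ring
  · have : ¬ (n - 1 = n - (j : ℕ)) := by omega
    simp [h, this]

theorem commute_A1 (hn : 2 ≤ n) (hj : j ≠ 0) (c d : ℂˣ) (x : Fin (dim A1 n) → ℂˣ) :
    (V A1 n L).e j c ((V A1 n L).e 0 d x) = (V A1 n L).e 0 d ((V A1 n L).e j c x) := by
  funext r
  simp only [V_e_zero, V_e hj, e0, schubertE_single (word_A1 hn hj)]
  rw [div_mul_eq_mul_div]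

/-- The action `e₀` scales all coordinates and `e_j` multiplies just one by `c`, so they commute. At
most one of `ε₀`, `ε_j` reacts to the other action: `ε₀` to `e₁`, and `ε_n` to `e₀`. This decides
the order in which the pair is presented to `unipotentAt_of_commute`. -/
theorem unipotentAt_zero_A1 (hn : 2 ≤ n) (hL : 0 < (L : ℂ)) (hj : j ≠ 0) :
    UnipotentAt (cartan A1 n) (V A1 n L) 0 j := by
  have h0 : (j : ℕ) ≠ 0 := fun h => hj (Fin.ext h)
  have hD := isPositive_V (X := A1) hn hL
  have hr := rankOne_V (X := A1) hn hL hj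
  have he : cartan A1 n 0 j = if (j : ℕ) = 1 ∨ (j : ℕ) = n then -1 else 0 := by
    change cartanEntry A1 n 0 j = _
    rw [cartanEntry_A1 (by omega) (by omega)]
    grind
  have he' : cartan A1 n j 0 = if (j : ℕ) = 1 ∨ (j : ℕ) = n then -1 else 0 := by
    change cartanEntry A1 n j 0 = _
    rw [cartanEntry_A1 (by omega) (by omega)]
    grind
  by_cases h : (j : ℕ) = 1
  · refine (unipotentAt_of_commute hj hD hr (rankOne_zero_A1 hn)
      (fun c d _ _ x _ => commute_A1 hn hj c d x) (fun c _ x _ => ?_) (fun c _ x _ => ?_)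
      (fun c hc x hx => V_γ_e hn hL hj hj hc hx) fun c _ x _ => V_γ_e0_A1 hn c x).symm
    · rw [ε_e0_A1 hn hj, if_neg (by omega), one_mul]
    · rw [ε_zero_e_A1 hn hj, if_pos h, he', if_pos (Or.inl h), neg_neg, zpow_one]
  · refine unipotentAt_of_commute hj.symm hD (rankOne_zero_A1 hn) hr
      (fun c d _ _ x _ => (commute_A1 hn hj d c x).symm) (fun c _ x _ => ?_) (fun c _ x _ => ?_)
      (fun c _ x _ => V_γ_e0_A1 hn c x) fun c hc x hx => V_γ_e hn hL hj hj hc hx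
    · rw [ε_zero_e_A1 hn hj, if_neg h, one_mul]
    · rw [ε_e0_A1 hn hj, he]
      by_cases h' : (j : ℕ) = n
      · rw [if_pos h', if_pos (Or.inr h'), neg_neg, zpow_one]
      · rw [if_neg h', if_neg (by omega), neg_zero, zpow_zero]

end A1

end AffineType

/-! ### Letters that occur twice in a word. -/

namespace CrystalData

variable {I : Type} [DecidableEq I] {A : Matrix I I ℤ} {m : ℕ} {w : Fin m → I} {i : I}

theorem schubertE_of_ne (hw : ∃ r, w r = i) {c : ℂˣ} (hc : 0 < (c : ℂ)) {x : Fin m → ℂˣ}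
    (hx : PosPt x) {j : Fin m} (hj : w j ≠ i) : schubertE A w i c x j = x j := by
  have h : ∑ r with w r = i, (if r ≤ j then (c : ℂ) else 1) * schubertTerm A w i x r =
      ∑ r with w r = i, (if r < j then (c : ℂ) else 1) * schubertTerm A w i x r :=
    Finset.sum_congr rfl fun r hr => by
      have : r ≠ j := by
        rintro rfl
        exact hj (by simpa using hr)
      simp only [this.le_iff_lt]
  have hpos : 0 < ∑ r with w r = i, (if r < j then (c : ℂ) else 1) * schubertTerm A w i x r := by
    refine Finset.sum_pos (fun r _ => ?_) (hw.imp fun r hr => by simpa using hr)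
    have := schubertTerm_pos (A := A) (w := w) i hx r
    split_ifs <;> positivity
  rw [schubertE, h, div_self hpos.ne']
  refine Units.ext ?_
  rw [Units.val_mul, coe_unitOf one_ne_zero, mul_one]

variable {p l : Fin m}

theorem filter_eq_pair (h : ∀ r, w r = i ↔ r = p ∨ r = l) :
    ({r | w r = i} : Finset (Fin m)) = {p, l} := by
  ext r
  simp [h]

theorem schubertε_pair (h : ∀ r, w r = i ↔ r = p ∨ r = l) (hpl : p < l) (x : Fin m → ℂˣ) :
    schubertε A w i x = schubertTerm A w i x p + schubertTerm A w i x l := by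
  rw [schubertε, filter_eq_pair h, Finset.sum_pair hpl.ne]

theorem schubertE_pair (h : ∀ r, w r = i ↔ r = p ∨ r = l) (hpl : p < l) {c : ℂˣ}
    (hc : 0 < (c : ℂ)) {x : Fin m → ℂˣ} (hx : PosPt x) {k : ℂˣ} (hk : (k : ℂ) =
      (c * schubertTerm A w i x p + schubertTerm A w i x l) /
        (schubertTerm A w i x p + schubertTerm A w i x l)) (j : Fin m) :
    schubertE A w i c x j = x j * if j = p then k else if j = l then c / k else 1 := by
  by_cases hj : j = p ∨ j = l
  · have h1 := schubertTerm_pos (A := A) (w := w) i hx p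
    have h2 := schubertTerm_pos (A := A) (w := w) i hx l
    have h3 : c * schubertTerm A w i x p + schubertTerm A w i x l ≠ 0 := by positivity
    have h4 : schubertTerm A w i x p + schubertTerm A w i x l ≠ 0 := by positivity
    rw [schubertE, filter_eq_pair h, Finset.sum_pair hpl.ne, Finset.sum_pair hpl.ne]
    congr 1
    refine Units.ext ?_
    rcases hj with rfl | rfl
    · rw [if_pos le_rfl, if_neg hpl.not_ge, if_neg (lt_irrefl _), if_neg hpl.not_gt, if_pos rfl,
        one_mul, one_mul, coe_unitOf (div_ne_zero h3 h4), hk]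
    · rw [if_pos hpl.le, if_pos le_rfl, if_pos hpl, if_neg (lt_irrefl _), if_neg hpl.ne',
        if_pos rfl, one_mul, ← mul_add, coe_unitOf (div_ne_zero (mul_ne_zero c.ne_zero h4) h3),
        Units.val_div_eq_div_val, hk]
      field_simp
  · rw [schubertE_of_ne ⟨p, (h p).2 (Or.inl rfl)⟩ hc hx (fun h' => hj ((h j).1 h'))]
    rw [not_or] at hj
    rw [if_neg hj.1, if_neg hj.2, mul_one]

end CrystalData

/-! ### The action `e₁` in terms of `x₁ x̄₁` and the coordinates between them. -/

namespace AffineType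

open CrystalData

variable {X : AffineType} {n : ℕ} {L : ℂˣ} {i j : Fin (n + 1)}

/-- The place of the coordinate `x₁`, for types other than `A_n^{(1)}`. -/
def firstPlace : AffineType → ℕ
  | D2 | A2even | A2evenDagger => 1
  | _ => 0

/-- The product `x₁ x̄₁`. -/
def pairProd (X : AffineType) (n : ℕ) (x : Fin (X.dim n) → ℂˣ) : ℂˣ :=
  coord x X.firstPlace * coord x (X.dim n - 1)

/-- The part of `γ₁` that comes from the coordinates before `x₁`. -/
def headProd (X : AffineType) (n : ℕ) (x : Fin (X.dim n) → ℂˣ) : ℂˣ :=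
  ∏ j ∈ Finset.univ.filter fun j : Fin (X.dim n) => (j : ℕ) < X.firstPlace,
    x j ^ X.cartan n (X.word n j) 1

/-- The quotient of the product of the coordinates between `x₁` and `x̄₁` in `γ₁`. -/
def midProd (X : AffineType) (n : ℕ) (x : Fin (X.dim n) → ℂˣ) : ℂˣ :=
  headProd X n x * pairProd X n x ^ 2 / ∏ j, x j ^ X.cartan n (X.word n j) 1

theorem val_one_fin (hn : X.minRank ≤ n) : ((1 : Fin (n + 1)) : ℕ) = 1 := by
  have := two_le hn
  rw [Fin.val_one', Nat.mod_eq_of_lt (by omega)]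

theorem firstPlace_lt (hn : X.minRank ≤ n) (hX : X.IsForked ∨ X.IsPath) :
    X.firstPlace < X.dim n - 1 := by
  cases X <;> simp only [IsForked, IsPath, or_self, or_true, true_or] at hX <;>
    simp only [minRank] at hn <;> simp only [dim, firstPlace] <;> omega

theorem weight_firstPlace (hn : X.minRank ≤ n) (hX : X.IsForked ∨ X.IsPath) :
    X.weight n X.firstPlace = 1 := by
  cases X <;> simp only [IsForked, IsPath, or_self, or_true, true_or] at hX <;>
    simp only [minRank] at hn <;> simp only [firstPlace, weight] <;> grind

theorem weight_last (hn : X.minRank ≤ n) (hX : X.IsForked ∨ X.IsPath) :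
    X.weight n (X.dim n - 1) = 1 := by
  cases X <;> simp only [IsForked, IsPath, or_self, or_true, true_or] at hX <;>
    simp only [minRank] at hn <;> simp only [dim, weight] <;> grind

theorem word_eq_one_iff (hn : X.minRank ≤ n) (hX : X.IsForked ∨ X.IsPath) (r : Fin (X.dim n)) :
    X.word n r = 1 ↔ (r : ℕ) = X.firstPlace ∨ (r : ℕ) = X.dim n - 1 := by
  obtain ⟨r, hr⟩ := r
  rw [Fin.ext_iff, word_val hn, val_one_fin hn]
  cases X <;> simp only [IsForked, IsPath, or_self, or_true, true_or] at hX <;>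
    simp only [minRank] at hn <;> simp only [dim] at hr <;>
    simp only [dim, letter, firstPlace] <;> grind

theorem pairProd_pos {x : Fin (X.dim n) → ℂˣ} (hx : PosPt x) : 0 < (pairProd X n x : ℂ) :=
  mul_coe_pos (coord_pos hx _) (coord_pos hx _)

theorem headProd_pos {x : Fin (X.dim n) → ℂˣ} (hx : PosPt x) : 0 < (headProd X n x : ℂ) :=
  prod_coe_pos _ fun _ _ => zpow_coe_pos (hx _) _

theorem midProd_pos {x : Fin (X.dim n) → ℂˣ} (hx : PosPt x) : 0 < (midProd X n x : ℂ) :=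
  div_coe_pos (mul_coe_pos (headProd_pos hx) (pow_coe_pos (pairProd_pos hx) _))
    (prod_coe_pos _ fun _ _ => zpow_coe_pos (hx _) _)

theorem schubertTerm_first (hn : X.minRank ≤ n) (hX : X.IsForked ∨ X.IsPath)
    (x : Fin (X.dim n) → ℂˣ) {p : Fin (X.dim n)} (hp : (p : ℕ) = X.firstPlace) :
    schubertTerm (X.cartan n) (X.word n) 1 x p =
      ((headProd X n x * coord x X.firstPlace : ℂˣ) : ℂ)⁻¹ := by
  have := firstPlace_lt hn hX
  rw [schubertTerm, headProd, coord_eq x (by omega), Units.val_inv_eq_inv_val]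
  simp only [← hp, Fin.lt_def]

theorem schubertTerm_last (hn : X.minRank ≤ n) (hX : X.IsForked ∨ X.IsPath)
    (x : Fin (X.dim n) → ℂˣ) {l : Fin (X.dim n)} (hl : (l : ℕ) = X.dim n - 1) :
    schubertTerm (X.cartan n) (X.word n) 1 x l = midProd X n x / pairProd X n x *
      ((headProd X n x * coord x X.firstPlace : ℂˣ) : ℂ)⁻¹ := by
  have h1 : ∏ j, x j ^ X.cartan n (X.word n j) 1 =
      (∏ j with j < l, x j ^ X.cartan n (X.word n j) 1) * x l ^ (2 : ℤ) := by
    have hw : X.word n l = 1 := (word_eq_one_iff hn hX l).2 (Or.inr hl)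
    have h2 := Finset.prod_filter_mul_prod_filter_not Finset.univ (· < l)
      fun j => x j ^ X.cartan n (X.word n j) 1
    have h3 : ({j | ¬ j < l} : Finset (Fin (X.dim n))) = {l} := by
      ext j
      simp only [Finset.mem_filter, Finset.mem_univ, true_and, Finset.mem_singleton, Fin.lt_def,
        Fin.ext_iff]
      omega
    rw [← h2, h3, Finset.prod_singleton, hw, cartan_self]
  rw [schubertTerm, midProd, h1, pairProd, show coord x (X.dim n - 1) = x l by
    rw [coord_eq x (by omega)]; exact congrArg x (Fin.ext hl.symm)]
  rw [← Units.val_div_eq_div_val, ← Units.val_inv_eq_inv_val, ← Units.val_mul]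
  congr 1
  have e : (x l) ^ (2 : ℤ) = x l ^ 2 := zpow_ofNat _ 2
  rw [e]
  refine Units.ext ?_
  push_cast
  field_simp

theorem ε_one_eq (hn : X.minRank ≤ n) (hX : X.IsForked ∨ X.IsPath) (x : Fin (X.dim n) → ℂˣ) :
    schubertε (X.cartan n) (X.word n) 1 x = (pairProd X n x + midProd X n x) /
      (pairProd X n x * (headProd X n x * coord x X.firstPlace)) := by
  have hlt := firstPlace_lt hn hX
  have hp : X.firstPlace < X.dim n := by omega
  have hl : X.dim n - 1 < X.dim n := by omega
  rw [schubertε_pair (p := ⟨_, hp⟩) (l := ⟨_, hl⟩)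
    (fun r => by rw [word_eq_one_iff hn hX, Fin.ext_iff, Fin.ext_iff]) hlt,
    schubertTerm_first hn hX x rfl, schubertTerm_last hn hX x rfl]
  push_cast
  field_simp

/-- The factor by which `e₁` multiplies `x₁`. -/
noncomputable def firstFactor (X : AffineType) (n : ℕ) (c : ℂˣ) (x : Fin (X.dim n) → ℂˣ) : ℂˣ :=
  unitOf ((c * pairProd X n x + midProd X n x) / (pairProd X n x + midProd X n x))

theorem coe_firstFactor {c : ℂˣ} (hc : 0 < (c : ℂ)) {x : Fin (X.dim n) → ℂˣ} (hx : PosPt x) :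
    (firstFactor X n c x : ℂ) =
      (c * pairProd X n x + midProd X n x) / (pairProd X n x + midProd X n x) := by
  have h1 := pairProd_pos hx
  have h2 := midProd_pos hx
  refine coe_unitOf (ne_of_gt ?_)
  positivity

theorem e_one_eq (hn : X.minRank ≤ n) (hX : X.IsForked ∨ X.IsPath) {c : ℂˣ} (hc : 0 < (c : ℂ))
    {x : Fin (X.dim n) → ℂˣ} (hx : PosPt x) (j : Fin (X.dim n)) :
    schubertE (X.cartan n) (X.word n) 1 c x j = x j *
      if (j : ℕ) = X.firstPlace then firstFactor X n c x
      else if (j : ℕ) = X.dim n - 1 then c / firstFactor X n c x else 1 := by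
  have hlt := firstPlace_lt hn hX
  have hp : X.firstPlace < X.dim n := by omega
  have hl : X.dim n - 1 < X.dim n := by omega
  rw [schubertE_pair (p := ⟨_, hp⟩) (l := ⟨_, hl⟩)
    (fun r => by rw [word_eq_one_iff hn hX, Fin.ext_iff, Fin.ext_iff]) hlt hc hx
    (k := firstFactor X n c x)]
  · simp only [Fin.ext_iff]
  · rw [coe_firstFactor hc hx, schubertTerm_first hn hX x rfl, schubertTerm_last hn hX x rfl]
    have h1 := pairProd_pos hx
    have h2 := midProd_pos hx
    have h3 : (pairProd X n x + midProd X n x : ℂ) ≠ 0 := by positivity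
    push_cast
    field_simp

theorem coord_first_e_one (hn : X.minRank ≤ n) (hX : X.IsForked ∨ X.IsPath) {c : ℂˣ}
    (hc : 0 < (c : ℂ)) {x : Fin (X.dim n) → ℂˣ} (hx : PosPt x) :
    coord (schubertE (X.cartan n) (X.word n) 1 c x) X.firstPlace =
      coord x X.firstPlace * firstFactor X n c x := by
  have hlt := firstPlace_lt hn hX
  have hp : X.firstPlace < X.dim n := by omega
  rw [coord_eq _ hp, coord_eq _ hp, e_one_eq hn hX hc hx, if_pos rfl]

theorem coord_last_e_one (hn : X.minRank ≤ n) (hX : X.IsForked ∨ X.IsPath) {c : ℂˣ}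
    (hc : 0 < (c : ℂ)) {x : Fin (X.dim n) → ℂˣ} (hx : PosPt x) :
    coord (schubertE (X.cartan n) (X.word n) 1 c x) (X.dim n - 1) =
      coord x (X.dim n - 1) * (c / firstFactor X n c x) := by
  have hlt := firstPlace_lt hn hX
  have hl : X.dim n - 1 < X.dim n := by omega
  rw [coord_eq _ hl, coord_eq _ hl, e_one_eq hn hX hc hx, if_neg (by simpa using hlt.ne'),
    if_pos rfl]

theorem pairProd_e_one (hn : X.minRank ≤ n) (hX : X.IsForked ∨ X.IsPath) {c : ℂˣ}
    (hc : 0 < (c : ℂ)) {x : Fin (X.dim n) → ℂˣ} (hx : PosPt x) :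
    pairProd X n (schubertE (X.cartan n) (X.word n) 1 c x) = pairProd X n x * c := by
  rw [pairProd, coord_first_e_one hn hX hc hx, coord_last_e_one hn hX hc hx, pairProd,
    mul_mul_mul_comm, mul_div_cancel]

theorem headProd_e_one (hn : X.minRank ≤ n) (hX : X.IsForked ∨ X.IsPath) {c : ℂˣ}
    (hc : 0 < (c : ℂ)) {x : Fin (X.dim n) → ℂˣ} (hx : PosPt x) :
    headProd X n (schubertE (X.cartan n) (X.word n) 1 c x) = headProd X n x := by
  have hlt := firstPlace_lt hn hX
  refine Finset.prod_congr rfl fun j hj => ?_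
  have hj' : (j : ℕ) < X.firstPlace := by simpa using hj
  rw [e_one_eq hn hX hc hx, if_neg (by omega), if_neg (by omega), mul_one]

theorem prod_e_one (hn : X.minRank ≤ n) {c : ℂˣ}
    (hc : 0 < (c : ℂ)) {x : Fin (X.dim n) → ℂˣ} (hx : PosPt x) :
    ∏ j, schubertE (X.cartan n) (X.word n) 1 c x j ^ X.cartan n (X.word n j) 1 =
      (∏ j, x j ^ X.cartan n (X.word n j) 1) * c ^ 2 := by
  -- At `L = 1` the torus constant disappears from `γ₁`, which leaves the monomial wanted here.
  have h := (rankOne_V (L := 1) hn (by simp) (one_ne_zero_fin hn)).γ_e c hc x hx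
  rw [V_e (one_ne_zero_fin hn), V_γ, V_γ, cartan_self] at h
  simp only [schubertγ, one_zpow, mul_one] at h
  refine Units.ext ?_
  rw [h, Units.val_mul, Units.val_pow_eq_pow_val, mul_comm]
  norm_cast

/-- Both `pairProd²` and the monomial of `γ₁` gain the factor `c²`, which cancels. -/
theorem midProd_e_one (hn : X.minRank ≤ n) (hX : X.IsForked ∨ X.IsPath) {c : ℂˣ}
    (hc : 0 < (c : ℂ)) {x : Fin (X.dim n) → ℂˣ} (hx : PosPt x) :
    midProd X n (schubertE (X.cartan n) (X.word n) 1 c x) = midProd X n x := by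
  rw [midProd, headProd_e_one hn hX hc hx, pairProd_e_one hn hX hc hx, prod_e_one hn hc hx,
    midProd, mul_pow, ← mul_assoc, mul_div_mul_right_eq_div]

theorem coord_scale (c s : ℂˣ) {j : ℕ} (hj : j < X.dim n) (x : Fin (X.dim n) → ℂˣ) :
    coord (x * scale X n c s) j = coord x j * ((if j = 0 then c else 1) * s ^ X.weight n j) := by
  rw [coord_eq _ hj, coord_eq _ hj]
  rfl

theorem pairProd_scale (hn : X.minRank ≤ n) (hX : X.IsForked ∨ X.IsPath) {c : ℂˣ}
    (hc : c = 1 ∨ X.IsPath) (s : ℂˣ) (x : Fin (X.dim n) → ℂˣ) :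
    pairProd X n (x * scale X n c s) = pairProd X n x * s ^ 2 := by
  have hlt := firstPlace_lt hn hX
  have h1 : (if X.firstPlace = 0 then c else 1) = 1 := by
    rcases hc with rfl | hc
    · exact ite_self 1
    · cases X <;> simp only [IsPath] at hc <;> rfl
  rw [pairProd, coord_scale c s (by omega), coord_scale c s (by omega), h1,
    weight_firstPlace hn hX, weight_last hn hX, if_neg (by omega), one_mul, pow_one, pairProd,
    mul_mul_mul_comm, pow_two]

/-- The coordinates `x₁` and `x̄₁` contribute `2 + 2`, so those between them contribute `-2`. This
is why `midProd` scales by `s²`, like `pairProd`. -/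
theorem prefixSum_one (hn : X.minRank ≤ n) (hX : X.IsForked ∨ X.IsPath) :
    X.prefixSum n 1 X.firstPlace + 2 = X.prefixSum n 1 (X.dim n) := by
  cases X <;> simp only [IsForked, IsPath, or_self, or_true, true_or] at hX <;>
    simp only [minRank] at hn <;> simp only [dim, firstPlace]
  · rw [prefixSum_B1 hn le_rfl (by omega) _ (by omega), prefixSum_B1 hn le_rfl (by omega) _ le_rfl]
    grind
  · rw [prefixSum_D1 hn le_rfl (by omega) _ (by omega), prefixSum_D1 hn le_rfl (by omega) _ le_rfl]
    grind
  · rw [prefixSum_A2odd hn le_rfl (by omega) _ (by omega),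
      prefixSum_A2odd hn le_rfl (by omega) _ le_rfl]
    grind
  · rw [prefixSum_D2 hn (by omega) _ (by omega), prefixSum_D2 hn (by omega) _ le_rfl]
    grind
  · rw [prefixSum_A2even hn (by omega) _ (by omega), prefixSum_A2even hn (by omega) _ le_rfl]
    grind
  · rw [prefixSum_A2evenDagger hn (by omega) _ (by omega),
      prefixSum_A2evenDagger hn (by omega) _ le_rfl]
    grind

theorem headProd_scale (hn : X.minRank ≤ n) (hX : X.IsForked ∨ X.IsPath) (c s : ℂˣ)
    (x : Fin (X.dim n) → ℂˣ) : headProd X n (x * scale X n c s) = headProd X n x *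
      ((if 0 < X.firstPlace then c ^ X.cartanEntry n (X.letter n 0) 1 else 1) *
        s ^ X.prefixSum n 1 X.firstPlace) := by
  have hlt := firstPlace_lt hn hX
  have h := prod_scale hn c s 1 (fun j => (j : ℕ) < X.firstPlace) X.firstPlace (by omega)
    fun j => Iff.rfl
  rw [val_one_fin hn] at h
  simp only [headProd, Pi.mul_apply, mul_zpow, Finset.prod_mul_distrib]
  rw [h]

theorem midProd_scale (hn : X.minRank ≤ n) (hX : X.IsForked ∨ X.IsPath) {c : ℂˣ}
    (hc : c = 1 ∨ X.IsPath) (s : ℂˣ) (x : Fin (X.dim n) → ℂˣ) :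
    midProd X n (x * scale X n c s) = midProd X n x * s ^ 2 := by
  have hlt := firstPlace_lt hn hX
  have h := prod_scale hn c s 1 (fun _ => True) (X.dim n) le_rfl (fun j => by simp [j.2])
  have h1 : (if 0 < X.firstPlace then c ^ X.cartanEntry n (X.letter n 0) 1 else 1) =
      c ^ X.cartanEntry n (X.letter n 0) 1 := by
    rcases hc with rfl | hc
    · rw [one_zpow, ite_self]
    · exact if_pos (by cases X <;> simp only [IsPath] at hc <;> exact one_pos)
  rw [if_pos (by omega), Finset.filter_true, val_one_fin hn, ← prefixSum_one hn hX] at h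
  rw [midProd, headProd_scale hn hX, pairProd_scale hn hX hc, midProd, h1]
  simp only [Pi.mul_apply, mul_zpow, Finset.prod_mul_distrib]
  rw [h, zpow_add]
  have e : s ^ (2 : ℤ) = s ^ 2 := zpow_ofNat _ 2
  rw [e]
  refine Units.ext ?_
  push_cast
  field_simp

theorem firstFactor_scale (hn : X.minRank ≤ n) (hX : X.IsForked ∨ X.IsPath) {c : ℂˣ}
    (hc : c = 1 ∨ X.IsPath) (s d : ℂˣ) (x : Fin (X.dim n) → ℂˣ) :
    firstFactor X n d (x * scale X n c s) = firstFactor X n d x := by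
  have hs := pow_ne_zero 2 s.ne_zero
  rw [firstFactor, pairProd_scale hn hX hc, midProd_scale hn hX hc, firstFactor]
  push_cast
  rw [← mul_assoc, ← add_mul, ← add_mul, mul_div_mul_right _ _ hs]

theorem scale_pos {c s : ℂˣ} (hc : 0 < (c : ℂ)) (hs : 0 < (s : ℂ)) : PosPt (scale X n c s) :=
  fun j => by
    rw [scale]
    split_ifs
    exacts [mul_coe_pos hc (pow_coe_pos hs _), mul_coe_pos (by simp) (pow_coe_pos hs _)]

theorem mul_scale_pos {c s : ℂˣ} (hc : 0 < (c : ℂ)) (hs : 0 < (s : ℂ)) {x : Fin (X.dim n) → ℂˣ}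
    (hx : PosPt x) : PosPt (x * scale X n c s) := fun j => mul_coe_pos (hx j) (scale_pos hc hs j)

/-- The factor of `x₁` is a quotient of two expressions that both scale by `s²`, hence is unchanged
by the scaling. -/
theorem e_one_scale (hn : X.minRank ≤ n) (hX : X.IsForked ∨ X.IsPath) {c s d : ℂˣ}
    (hc : c = 1 ∨ X.IsPath) (hc' : 0 < (c : ℂ)) (hs : 0 < (s : ℂ)) (hd : 0 < (d : ℂ))
    {x : Fin (X.dim n) → ℂˣ} (hx : PosPt x) :
    schubertE (X.cartan n) (X.word n) 1 d (x * scale X n c s) =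
      schubertE (X.cartan n) (X.word n) 1 d x * scale X n c s := by
  funext j
  rw [Pi.mul_apply, e_one_eq hn hX hd hx, e_one_eq hn hX hd (mul_scale_pos hc' hs hx),
    firstFactor_scale hn hX hc, Pi.mul_apply, mul_right_comm]

end AffineType

namespace AffineType

open CrystalData

/-! ### The types with an automorphism exchanging the nodes `0` and `1` -/

variable {X : AffineType} {n : ℕ} {L : ℂˣ} {i j : Fin (n + 1)}

theorem sigmaBar_eq_scale (hX : X.IsForked) (x : Fin (X.dim n) → ℂˣ) :
    sigmaBar X n L x = x * scale X n 1 (L * pairProd X n x)⁻¹ := by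
  funext j
  have h : X.firstPlace = 0 := by cases X <;> simp only [IsForked] at hX <;> rfl
  rw [sigmaBar_apply _ _ hX, Pi.mul_apply, scale, ite_self, one_mul, pairProd, h, inv_pow,
    div_eq_mul_inv, mul_assoc L]

theorem scale_mul_scale (s t : ℂˣ) : scale X n 1 s * scale X n 1 t = scale X n 1 (s * t) := by
  funext j
  simp [scale, mul_pow]

theorem scale_one : scale X n 1 1 = 1 := by
  funext j
  simp [scale]

/-- The involution is the scaling by `(L x₁ x̄₁)⁻¹`, and `e₁` commutes with scalings. Since `e₁^c`
multiplies `x₁ x̄₁` by `c`, the two scalings in the conjugate combine to `c⁻¹`. -/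
theorem e_zero_forked (hn : X.minRank ≤ n) (hX : X.IsForked) (hL : 0 < (L : ℂ)) {c : ℂˣ}
    (hc : 0 < (c : ℂ)) {x : Fin (X.dim n) → ℂˣ} (hx : PosPt x) :
    (V X n L).e 0 c x = (V X n L).e 1 c x * scale X n 1 c⁻¹ := by
  have hs : 0 < (((L * pairProd X n x)⁻¹ : ℂˣ) : ℂ) :=
    inv_coe_pos (mul_coe_pos hL (pairProd_pos hx))
  rw [V_e_zero, V_e (one_ne_zero_fin hn), e0_of_isForked hX, sigmaBar_eq_scale hX,
    sigmaBar_eq_scale hX, e_one_scale hn (Or.inl hX) (Or.inl rfl) (by simp) hs hc hx,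
    pairProd_scale hn (Or.inl hX) (Or.inl rfl), pairProd_e_one hn (Or.inl hX) hc hx, mul_assoc,
    scale_mul_scale]
  congr 2
  refine Units.ext ?_
  push_cast
  field_simp

theorem ε_one_scale (hn : X.minRank ≤ n) (hX : X.IsForked) (s : ℂˣ)
    (x : Fin (X.dim n) → ℂˣ) :
    (V X n L).ε 1 (x * scale X n 1 s) = (V X n L).ε 1 x / s := by
  have hX' : X.IsForked ∨ X.IsPath := Or.inl hX
  have hlt := firstPlace_lt hn hX'
  have h : X.firstPlace = 0 := by cases X <;> simp only [IsForked] at hX <;> rfl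
  rw [V_ε (one_ne_zero_fin hn), V_ε (one_ne_zero_fin hn), ε_one_eq hn hX', ε_one_eq hn hX',
    pairProd_scale hn hX' (Or.inl rfl), midProd_scale hn hX' (Or.inl rfl), headProd_scale hn hX',
    coord_scale _ _ (by omega), weight_firstPlace hn hX', ite_self, h]
  simp only [lt_irrefl, if_false, prefixSum, Finset.range_zero, Finset.sum_empty, zpow_zero, mul_one,
    one_mul, pow_one]
  push_cast
  have := s.ne_zero
  field_simp

theorem ε_zero_forked (hn : X.minRank ≤ n) (hX : X.IsForked)
    (x : Fin (X.dim n) → ℂˣ) :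
    (V X n L).ε 0 x = (V X n L).ε 1 x * (L * pairProd X n x) := by
  have := ε_one_scale (L := L) hn hX (L * pairProd X n x)⁻¹ x
  rw [V_ε_zero, ε0_of_isForked hX, sigmaBar_eq_scale hX]
  rw [V_ε (one_ne_zero_fin hn)] at this ⊢
  rw [this, Units.val_inv_eq_inv_val, div_inv_eq_mul, Units.val_mul]
  rw [V_ε (one_ne_zero_fin hn)]

theorem cartan_one_eq (hn : X.minRank ≤ n) (hX : X.IsForked) (r : Fin (X.dim n)) :
    X.cartan n (X.word n r) 1 = X.cartan n (X.word n r) 0 + if X.word n r = 1 then 2 else 0 := by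
  have h2 := two_le hn
  obtain ⟨r, hr⟩ := r
  simp only [cartan, Matrix.of_apply, word_val hn, Fin.ext_iff, val_one_fin hn, Fin.val_zero]
  cases X <;> simp only [IsForked] at hX <;> simp only [minRank] at hn <;>
    simp only [dim] at hr <;> simp only [letter, cartanEntry] <;> grind (splits := 30)

theorem cartan_swap (hn : X.minRank ≤ n) (hX : X.IsForked) (i : Fin (n + 1)) (hi : 2 ≤ (i : ℕ)) :
    X.cartan n 0 i = X.cartan n 1 i ∧ X.cartan n i 0 = X.cartan n i 1 := by
  obtain ⟨i, hi'⟩ := i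
  simp only [cartan, Matrix.of_apply, val_one_fin hn, Fin.val_zero]
  simp only at hi
  cases X <;> simp only [IsForked] at hX <;> simp only [minRank] at hn <;>
    simp only [cartanEntry] <;> grind (splits := 30)

theorem cartan_zero_one (hn : X.minRank ≤ n) (hX : X.IsForked) :
    X.cartan n 0 1 = 0 ∧ X.cartan n 1 0 = 0 := by
  simp only [cartan, Matrix.of_apply, val_one_fin hn, Fin.val_zero]
  cases X <;> simp only [IsForked] at hX <;> simp only [minRank] at hn <;>
    simp only [cartanEntry] <;> grind (splits := 30)

theorem weightH_zero : X.weightH n 0 = -X.weightH n 1 ∨ n = 0 := by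
  rcases n with - | n
  · exact Or.inr rfl
  · left
    simp [weightH]

theorem γ_zero_forked (hn : X.minRank ≤ n) (hX : X.IsForked) (x : Fin (X.dim n) → ℂˣ) :
    (V X n L).γ 0 x = (V X n L).γ 1 x / ((L * pairProd X n x) ^ 2 : ℂˣ) := by
  have h2 := two_le hn
  have hX' : X.IsForked ∨ X.IsPath := Or.inl hX
  have hlt := firstPlace_lt hn hX'
  have hp : X.firstPlace < X.dim n := by omega
  have hl : X.dim n - 1 < X.dim n := by omega
  have hw : ∀ r, X.word n r = 1 ↔ r = ⟨_, hp⟩ ∨ r = ⟨_, hl⟩ := fun r => by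
    rw [word_eq_one_iff hn hX', Fin.ext_iff, Fin.ext_iff]
  have h1 : ∏ r, x r ^ X.cartan n (X.word n r) 1 =
      (∏ r, x r ^ X.cartan n (X.word n r) 0) * pairProd X n x ^ 2 := by
    simp only [cartan_one_eq hn hX, zpow_add, Finset.prod_mul_distrib]
    congr 1
    have h3 : ∀ r, x r ^ (if X.word n r = 1 then 2 else 0 : ℤ) =
        if X.word n r = 1 then x r ^ 2 else 1 := fun r => by
      split_ifs
      exacts [zpow_ofNat _ 2, zpow_zero _]
    simp only [h3]
    rw [← Finset.prod_filter, filter_eq_pair hw, Finset.prod_pair (fun h => hlt.ne (Fin.mk.inj h)),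
      pairProd, coord_eq x hp, coord_eq x hl, mul_pow]
  have h4 : L ^ X.weightH n 1 = L ∧ L ^ X.weightH n 0 = L⁻¹ := by
    have e1 : X.weightH n 1 = 1 := by
      simp only [weightH, val_one_fin hn]
      cases X <;> simp only [IsForked] at hX <;> rfl
    refine ⟨by rw [e1, zpow_one], ?_⟩
    rcases weightH_zero (X := X) (n := n) with h | h
    · rw [h, e1, zpow_neg, zpow_one]
    · omega
  simp only [V_γ, schubertγ]
  rw [h1, h4.1, h4.2, ← Units.val_div_eq_div_val]
  congr 1
  refine Units.ext ?_
  push_cast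
  field_simp

theorem γ_one_scale (hn : X.minRank ≤ n) (hX : X.IsForked) (s : ℂˣ) (x : Fin (X.dim n) → ℂˣ) :
    (V X n L).γ 1 (x * scale X n 1 s) = (V X n L).γ 1 x * (s : ℂ) ^ 2 := by
  have h2 := two_le hn
  have h := prefixSum_dim_forked hn hX (k := 1) le_rfl (by omega)
  rw [if_pos rfl] at h
  rw [V_γ_scale hn, val_one_fin hn, h, one_zpow, Units.val_one, one_mul]
  norm_cast

theorem pairProd_e_zero (hn : X.minRank ≤ n) (hX : X.IsForked) (hL : 0 < (L : ℂ)) {c : ℂˣ}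
    (hc : 0 < (c : ℂ)) {x : Fin (X.dim n) → ℂˣ} (hx : PosPt x) :
    pairProd X n ((V X n L).e 0 c x) = pairProd X n x / c := by
  rw [e_zero_forked hn hX hL hc hx, pairProd_scale hn (Or.inl hX) (Or.inl rfl),
    V_e (one_ne_zero_fin hn), pairProd_e_one hn (Or.inl hX) hc hx]
  refine Units.ext ?_
  push_cast
  field_simp

theorem e_one_mul_scale (hn : X.minRank ≤ n) (hX : X.IsForked) {s d : ℂˣ}
    (hs : 0 < (s : ℂ)) (hd : 0 < (d : ℂ)) {x : Fin (X.dim n) → ℂˣ} (hx : PosPt x) :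
    (V X n L).e 1 d (x * scale X n 1 s) = (V X n L).e 1 d x * scale X n 1 s := by
  simp only [V_e (one_ne_zero_fin hn)]
  exact e_one_scale hn (Or.inl hX) (Or.inl rfl) (by simp) hs hd hx

theorem rankOne_zero_forked (hn : X.minRank ≤ n) (hX : X.IsForked) (hL : 0 < (L : ℂ)) :
    RankOne (X.cartan n) (V X n L) 0 := by
  have h := rankOne_V hn hL (one_ne_zero_fin hn)
  have hD := isPositive_V hn hL
  refine ⟨fun x hx => ?_, fun c d hc hd x hx => ?_, fun c hc x hx => ?_, fun c hc x hx => ?_⟩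
  · rw [e_zero_forked hn hX hL (by simp) hx, h.e_one x hx, inv_one, scale_one, mul_one]
  · rw [e_zero_forked hn hX hL hc (hD.e_pos 0 hd hx), e_zero_forked hn hX hL hd hx,
      e_zero_forked hn hX hL (mul_coe_pos hc hd) hx,
      e_one_mul_scale hn hX (inv_coe_pos hd) hc (hD.e_pos 1 hd hx), h.e_mul c d hc hd x hx,
      mul_assoc, scale_mul_scale, mul_inv, mul_comm d⁻¹]
  · rw [ε_zero_forked hn hX ((V X n L).e 0 c x), pairProd_e_zero hn hX hL hc hx,
      e_zero_forked hn hX hL hc hx, ε_one_scale hn hX,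
      h.ε_e c hc x hx, ε_zero_forked hn hX x]
    push_cast
    have := c.ne_zero
    field_simp
  · rw [γ_zero_forked hn hX, pairProd_e_zero hn hX hL hc hx, e_zero_forked hn hX hL hc hx,
      γ_one_scale hn hX, h.γ_e c hc x hx, γ_zero_forked hn hX, cartan_self, cartan_self]
    push_cast
    have := c.ne_zero
    field_simp

/-- `e₀^c` is `e₁^c` followed by a scaling with which `e₁` commutes, so the two actions commute. The
scaling by `c⁻¹` just undoes the effect of `e₁^c` on `ε₁` and `γ₁`. -/
theorem unipotentAt_zero_one_forked (hn : X.minRank ≤ n) (hX : X.IsForked) (hL : 0 < (L : ℂ)) :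
    UnipotentAt (X.cartan n) (V X n L) 0 1 := by
  have h1 := one_ne_zero_fin hn
  have h := rankOne_V hn hL h1
  have h0 := rankOne_zero_forked hn hX hL
  have hD := isPositive_V hn hL
  obtain ⟨a01, a10⟩ := cartan_zero_one hn hX
  refine unipotentAt_of_commute h1.symm hD h0 h (fun c d hc hd x hx => ?_) (fun c hc x hx => ?_)
    (fun c hc x hx => ?_) (fun c hc x hx => ?_) fun c hc x hx => V_γ_e hn hL h1 h1 hc hx
  · rw [e_zero_forked hn hX hL hc (hD.e_pos 1 hd hx), e_zero_forked hn hX hL hc hx,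
      e_one_mul_scale hn hX (inv_coe_pos hc) hd (hD.e_pos 1 hc hx), h.e_mul _ _ hc hd x hx,
      h.e_mul _ _ hd hc x hx, mul_comm c d]
  · rw [ε_zero_forked hn hX ((V X n L).e 1 c x), h.ε_e c hc x hx, ε_zero_forked hn hX x,
      V_e h1, pairProd_e_one hn (Or.inl hX) hc hx]
    push_cast
    have := c.ne_zero
    field_simp
  · rw [e_zero_forked hn hX hL hc hx, ε_one_scale hn hX,
      h.ε_e c hc x hx, a01, neg_zero, zpow_zero, one_mul, Units.val_inv_eq_inv_val, div_inv_eq_mul,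
      div_mul_cancel₀ _ c.ne_zero]
  · rw [e_zero_forked hn hX hL hc hx, γ_one_scale hn hX, h.γ_e c hc x hx, a01, zpow_zero, one_mul,
      cartan_self, Units.val_inv_eq_inv_val]
    have := c.ne_zero
    have e : (c : ℂ) ^ (2 : ℤ) = (c : ℂ) ^ 2 := zpow_ofNat _ 2
    rw [e]
    field_simp

/-- For `j ≥ 2` the action `e_j` leaves `x₁` and `x̄₁` alone. Along it the involution is therefore a
fixed scaling, which commutes with `e_j` and preserves `ε_j`. So the involution carries the pair
`(0, j)` to the Schubert pair `(1, j)`. -/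
theorem unipotentAt_zero_forked (hn : X.minRank ≤ n) (hX : X.IsForked) (hL : 0 < (L : ℂ))
    (hj : j ≠ 0) : UnipotentAt (X.cartan n) (V X n L) 0 j := by
  by_cases hj1 : j = 1
  · exact hj1 ▸ unipotentAt_zero_one_forked hn hX hL
  have h1 := one_ne_zero_fin hn
  have hX' : X.IsForked ∨ X.IsPath := Or.inl hX
  have hlt := firstPlace_lt hn hX'
  have hj2 : 2 ≤ (j : ℕ) := by
    have := Fin.val_ne_iff.2 hj
    have := Fin.val_ne_iff.2 hj1
    rw [val_one_fin hn] at this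
    rw [Fin.val_zero] at *
    omega
  obtain ⟨a0, a1⟩ := cartan_swap hn hX j hj2
  have s0 : Equiv.swap (0 : Fin (n + 1)) 1 0 = 1 := Equiv.swap_apply_left _ _
  have sj : Equiv.swap (0 : Fin (n + 1)) 1 j = j := Equiv.swap_apply_of_ne_of_ne hj hj1
  have hpair : ∀ (c : ℂˣ) x, 0 < (c : ℂ) → PosPt x →
      pairProd X n ((V X n L).e j c x) = pairProd X n x := fun c x hc hx => by
    have hw : ∀ r (hr : r < X.dim n), r = X.firstPlace ∨ r = X.dim n - 1 →
        coord ((V X n L).e j c x) r = coord x r := fun r hr h => by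
      rw [coord_eq _ hr, coord_eq _ hr, V_e hj, schubertE_of_ne (exists_word hn hj) hc hx]
      rw [(word_eq_one_iff hn hX' ⟨r, hr⟩).2 h]
      exact Ne.symm hj1
    rw [pairProd, hw _ (by omega) (Or.inl rfl), hw _ (by omega) (Or.inr rfl), pairProd]
  have ht : ∀ s, ∀ r, X.word n r = j →
      schubertTerm (X.cartan n) (X.word n) j (scale X n 1 s) r = 1 := fun s r hr =>
    schubertTerm_scale hn hX' hj2 (Or.inl rfl) s r hr
  refine UnipotentAt.of_map (Equiv.swap 0 1) (D' := V X n L) (K := Unit) ?_ ?_ (sigmaBar X n L)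
    (fun x hx => sigmaBar_pos hL hx) (fun _ => ()) (fun _ _ => 1) (fun _ _ _ _ => one_ne_zero)
    (fun x y _ _ h _ => ?_) ?_ (fun _ _ _ _ _ _ => rfl) ?_ ?_
  · rw [s0, sj]
    exact unipotentAt_V h1 hj (Ne.symm hj1)
  · rintro k l (rfl | rfl) (rfl | rfl)
    · rw [s0, cartan_self, cartan_self]
    · rw [s0, sj, a0]
    · rw [s0, sj, a1]
    · rw [sj]
  · rw [← sigmaBar_sigmaBar hX hn L x, h, sigmaBar_sigmaBar hX hn]
  · rintro k c x (rfl | rfl) hc hx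
    · rw [s0, V_e_zero, V_e h1, e0_of_isForked hX, sigmaBar_sigmaBar hX hn]
    · rw [sj, sigmaBar_eq_scale hX, hpair c x hc hx, sigmaBar_eq_scale hX, V_e hj, V_e hj,
        schubertE_mul (ht _)]
  · rintro k x (rfl | rfl) hx
    · rw [s0, V_ε_zero, V_ε h1, ε0_of_isForked hX]
    · rw [sj, V_ε hj, V_ε hj, sigmaBar_eq_scale hX, schubertε_mul (ht _)]
  · rintro k x (rfl | rfl) hx
    · rw [s0, γ_zero_forked hn hX, sigmaBar_eq_scale hX, γ_one_scale hn hX, mul_one,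
        Units.val_inv_eq_inv_val, Units.val_pow_eq_pow_val, inv_pow, div_eq_mul_inv]
    · rw [sj, sigmaBar_eq_scale hX, V_γ_scale hn, prefixSum_dim_forked hn hX (by omega) (by omega),
        if_neg (by omega)]
      simp

end AffineType

namespace AffineType

open CrystalData

/-! ### The types given by a path -/

variable {X : AffineType} {n : ℕ} {L : ℂˣ} {i j : Fin (n + 1)}

/-- The number `-a₀₁` for the types given by a path. -/
def pathD : AffineType → ℕ
  | A2evenDagger => 1
  | _ => 2

/-- The number `-a₁₀` for the types given by a path. -/
def pathF : AffineType → ℕ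
  | A2evenDagger => 2
  | _ => 1

theorem pathD_pathF (X : AffineType) :
    (X.pathD = 2 ∧ X.pathF = 1) ∨ (X.pathD = 1 ∧ X.pathF = 2) := by
  cases X <;> simp [pathD, pathF]

/-- The coordinates on the cell of the word `(1, 0, 1)`. -/
def cellPoint (d f : ℕ) (L x0 x1 q a s : ℂˣ) : Fin 3 → ℂˣ :=
  -- For `a = x₀^d + L^d q` and `s = q + midProd`, the entries solve three equations for `w`: `w₁^d
  -- / (w₀ w₂) = x₀^d / (L^d q)`, so that `e₁` acts compatibly, and agreement of `ε₁` and of `ε₀`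
  -- with their values on the cell.
  ![x1 * a / (L ^ d * x0 ^ d * s), x0 * x1 ^ f / (L ^ 2 * s ^ f), x1 * q * x0 ^ d / (s * a)]

theorem cellPoint_e_one (d f : ℕ) (L x0 x1 q a s c k k' : ℂˣ) :
    cellPoint d f L x0 (x1 * k) (q * c) (a * k') (s * k) =
      ![cellPoint d f L x0 x1 q a s 0 * k', cellPoint d f L x0 x1 q a s 1,
        cellPoint d f L x0 x1 q a s 2 * (c / k')] := by
  funext r
  refine Units.ext ?_
  fin_cases r <;> simp [cellPoint, mul_pow] <;> field_simp

/-- The factors inserted are those by which `e₀` changes the arguments, with `k` the ratio; all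
powers of `k` cancel because `d f = 2`. -/
theorem cellPoint_e_zero {d f : ℕ} (hdf : (d = 2 ∧ f = 1) ∨ (d = 1 ∧ f = 2))
    (L x0 x1 q a s c k : ℂˣ) :
    cellPoint d f L (x0 * (c * k ^ f)) (x1 * k) (q * k ^ 2) (a * (k ^ 3 * c ^ d)) (s * k ^ 2) =
      ![cellPoint d f L x0 x1 q a s 0, cellPoint d f L x0 x1 q a s 1 * c,
        cellPoint d f L x0 x1 q a s 2] := by
  funext r
  refine Units.ext ?_
  rcases hdf with ⟨rfl, rfl⟩ | ⟨rfl, rfl⟩ <;> fin_cases r <;> simp [cellPoint, mul_pow] <;>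
    field_simp

section Cell

variable {d f : ℕ} {L x0 x1 q Q a s : ℂˣ}

/-- This and the next two identities invert the map to the cell: given `w` and the invariant `Q /
G²`, they yield `G`, then `q / Q`, then `x₀`. -/
theorem cellPoint_mid (hdf : (d = 2 ∧ f = 1) ∨ (d = 1 ∧ f = 2)) (ha : (a : ℂ) = x0 ^ d + L ^ d * q) :
    let w := cellPoint d f L x0 x1 q a s
    let G : ℂ := x1 * Q / s
    G = (1 + w 0 * w 2 / w 1 ^ d) / (L ^ d * (Q / G ^ 2) * w 0) := by
  have ha' := a.ne_zero
  have hs' := s.ne_zero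
  rcases hdf with ⟨rfl, rfl⟩ | ⟨rfl, rfl⟩ <;> simp [cellPoint] <;> field_simp <;>
    rw [ha] <;> ring

theorem cellPoint_quot :
    let w := cellPoint d f L x0 x1 q a s
    let G : ℂ := x1 * Q / s
    (q : ℂ) / Q = L ^ d * (Q / G ^ 2) * (w 0 * w 2) := by
  simp [cellPoint]
  field_simp

theorem cellPoint_zero :
    let w := cellPoint d f L x0 x1 q a s
    let G : ℂ := x1 * Q / s
    (x0 : ℂ) = L ^ 2 * (Q / G ^ 2) ^ f * G ^ f * w 1 := by
  simp [cellPoint, div_pow, mul_pow]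
  field_simp
  ring

theorem cellPoint_term (hdf : (d = 2 ∧ f = 1) ∨ (d = 1 ∧ f = 2)) :
    let w := cellPoint d f L x0 x1 q a s
    (w 1 : ℂ) ^ d / (w 0 * w 2) = x0 ^ d / (L ^ d * q) := by
  rcases hdf with ⟨rfl, rfl⟩ | ⟨rfl, rfl⟩ <;> simp [cellPoint] <;> field_simp

theorem cellPoint_ε_zero (hdf : (d = 2 ∧ f = 1) ∨ (d = 1 ∧ f = 2)) :
    let w := cellPoint d f L x0 x1 q a s
    (w 0 : ℂ) ^ f / w 1 = a ^ f / x0 ^ 3 := by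
  rcases hdf with ⟨rfl, rfl⟩ | ⟨rfl, rfl⟩ <;> simp [cellPoint] <;> field_simp

theorem cellPoint_pos (hL : 0 < (L : ℂ)) (h0 : 0 < (x0 : ℂ)) (h1 : 0 < (x1 : ℂ))
    (hq : 0 < (q : ℂ)) (ha : 0 < (a : ℂ)) (hs : 0 < (s : ℂ)) :
    PosPt (cellPoint d f L x0 x1 q a s) := by
  intro r
  fin_cases r <;> simp [cellPoint] <;> positivity

end Cell

/-! The geometric crystal of the word `(1, 0, 1)`. -/

section Word

variable {I : Type} [DecidableEq I] {A : Matrix I I ℤ} {a b : I}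

theorem word_pair (hab : a ≠ b) (r : Fin 3) : (![a, b, a] : Fin 3 → I) r = a ↔ r = 0 ∨ r = 2 := by
  fin_cases r <;> simp [hab.symm]

theorem word_single (hab : a ≠ b) (r : Fin 3) : (![a, b, a] : Fin 3 → I) r = b ↔ r = 1 := by
  fin_cases r <;> simp [hab]

theorem schubertTerm_zero_of_three (w : Fin 3 → I) (k : I) (x : Fin 3 → ℂˣ) :
    schubertTerm A w k x 0 = (x 0 : ℂ)⁻¹ := by
  simp [schubertTerm]

theorem schubertTerm_one_of_three (w : Fin 3 → I) (k : I) (x : Fin 3 → ℂˣ) :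
    schubertTerm A w k x 1 = ((x 0 : ℂ) ^ A (w 0) k * x 1)⁻¹ := by
  simp [schubertTerm, Finset.prod_filter]

theorem schubertTerm_two_of_three (w : Fin 3 → I) (k : I) (x : Fin 3 → ℂˣ) :
    schubertTerm A w k x 2 = ((x 0 : ℂ) ^ A (w 0) k * (x 1 : ℂ) ^ A (w 1) k * x 2)⁻¹ := by
  simp [schubertTerm, Finset.prod_filter, Fin.prod_univ_three]

theorem schubertγ_three (w : Fin 3 → I) (k : I) (x : Fin 3 → ℂˣ) :
    schubertγ A w 1 k x = (x 0 : ℂ) ^ A (w 0) k * (x 1 : ℂ) ^ A (w 1) k * (x 2 : ℂ) ^ A (w 2) k := by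
  simp [schubertγ, Fin.prod_univ_three]

end Word

end AffineType

/-! ### The equivariant map to the cell of the word `(1, 0, 1)`. -/

namespace AffineType

open CrystalData

variable {X : AffineType} {n : ℕ} {L : ℂˣ} {i j : Fin (n + 1)}

theorem IsPath.firstPlace_eq (hX : X.IsPath) : X.firstPlace = 1 := by
  cases X <;> simp only [IsPath] at hX <;> rfl

theorem IsPath.letter_zero (hX : X.IsPath) : X.letter n 0 = 0 := by
  cases X <;> simp only [IsPath] at hX <;> simp [letter]

theorem IsPath.weight_zero (hn : X.minRank ≤ n) (hX : X.IsPath) : X.weight n 0 = X.pathF := by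
  cases X <;> simp only [IsPath] at hX <;> simp only [minRank] at hn <;>
    simp only [weight, pathF] <;> grind

theorem cartan_path (hn : X.minRank ≤ n) (hX : X.IsPath) :
    X.cartan n 0 1 = -(X.pathD : ℤ) ∧ X.cartan n 1 0 = -(X.pathF : ℤ) := by
  simp only [cartan, Matrix.of_apply, val_one_fin hn, Fin.val_zero]
  cases X <;> simp only [IsPath] at hX <;> simp only [minRank] at hn <;>
    simp only [cartanEntry, pathD, pathF] <;> grind (splits := 20)

/-- The numerator of `ε₀`. -/
noncomputable def pathSum (X : AffineType) (n : ℕ) (L : ℂˣ) (x : Fin (X.dim n) → ℂˣ) : ℂˣ :=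
  unitOf (coord x 0 ^ X.pathD + L ^ X.pathD * pairProd X n x)

/-- The numerator of `ε₁`. -/
noncomputable def pairSum (X : AffineType) (n : ℕ) (x : Fin (X.dim n) → ℂˣ) : ℂˣ :=
  unitOf (pairProd X n x + midProd X n x)

section Values

variable {x : Fin (X.dim n) → ℂˣ}

theorem coe_pathSum (hL : 0 < (L : ℂ)) (hx : PosPt x) : (pathSum X n L x : ℂ) =
    coord x 0 ^ X.pathD + L ^ X.pathD * pairProd X n x := by
  have h0 := coord_pos hx 0
  have h1 := pairProd_pos hx
  refine coe_unitOf (ne_of_gt ?_)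
  positivity

theorem pathSum_pos (hL : 0 < (L : ℂ)) (hx : PosPt x) : 0 < (pathSum X n L x : ℂ) := by
  have h0 := coord_pos hx 0
  have h1 := pairProd_pos hx
  rw [coe_pathSum hL hx]
  positivity

theorem coe_pairSum (hx : PosPt x) :
    (pairSum X n x : ℂ) = pairProd X n x + midProd X n x := by
  have h1 := pairProd_pos hx
  have h2 := midProd_pos hx
  refine coe_unitOf (ne_of_gt ?_)
  positivity

theorem pairSum_pos (hx : PosPt x) : 0 < (pairSum X n x : ℂ) := by
  have h1 := pairProd_pos hx
  have h2 := midProd_pos hx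
  rw [coe_pairSum hx]
  positivity

theorem ε_zero_path (hX : X.IsPath) (hL : 0 < (L : ℂ)) (hx : PosPt x) :
    (V X n L).ε 0 x = pathSum X n L x ^ X.pathF / coord x 0 ^ 3 := by
  rw [V_ε_zero, coe_pathSum hL hx]
  cases X <;> simp only [IsPath] at hX <;> simp [ε0, pathD, pathF, pairProd, firstPlace]

theorem coe_ratio (hX : X.IsPath) (hL : 0 < (L : ℂ)) {c : ℂˣ} (hc : 0 < (c : ℂ)) (hx : PosPt x) :
    (ratio X n L c x : ℂ) = (c ^ X.pathD * coord x 0 ^ X.pathD + L ^ X.pathD * pairProd X n x) /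
      (c ^ X.pathD * pathSum X n L x) := by
  have h0 := coord_pos hx 0
  have h1 := pairProd_pos hx
  have h : ratio X n L c x = unitOf
      ((c ^ X.pathD * coord x 0 ^ X.pathD + L ^ X.pathD * pairProd X n x) /
        (c ^ X.pathD * (coord x 0 ^ X.pathD + L ^ X.pathD * pairProd X n x))) := by
    cases X <;> simp only [IsPath] at hX <;> simp [ratio, pathD, pairProd, firstPlace]
  rw [h, coe_pathSum hL hx]
  refine coe_unitOf (ne_of_gt ?_)
  positivity

theorem e_zero_path (hn : X.minRank ≤ n) (hX : X.IsPath) (c : ℂˣ) (x : Fin (X.dim n) → ℂˣ) :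
    (V X n L).e 0 c x = x * scale X n c (ratio X n L c x) := by
  funext j
  rw [V_e_zero, e0_of_isPath hX hn]
  rfl

theorem headProd_path (hn : X.minRank ≤ n) (hX : X.IsPath) :
    headProd X n x = coord x 0 ^ (-(X.pathD : ℤ)) := by
  have hd := dim_pos hn
  have h : (Finset.univ.filter fun j : Fin (X.dim n) => (j : ℕ) < X.firstPlace) =
      {⟨0, by omega⟩} := by
    ext j
    simp [hX.firstPlace_eq, Fin.ext_iff]
  have hw : X.word n ⟨0, by omega⟩ = 0 := Fin.ext (by
    rw [word_val hn, Fin.val_zero]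
    exact hX.letter_zero)
  rw [headProd, h, Finset.prod_singleton, hw, (cartan_path hn hX).1, coord_eq x (by omega)]

theorem ε_one_path (hn : X.minRank ≤ n) (hX : X.IsPath) (hx : PosPt x) : (V X n L).ε 1 x =
    coord x 0 ^ X.pathD * pairSum X n x / (pairProd X n x * coord x 1) := by
  rw [V_ε (one_ne_zero_fin hn), ε_one_eq hn (Or.inr hX), headProd_path hn hX, hX.firstPlace_eq,
    coe_pairSum hx, zpow_neg, zpow_natCast]
  push_cast
  field_simp

/-- The coordinates on the cell of the word `(1, 0, 1)`. -/
noncomputable def toCell (X : AffineType) (n : ℕ) (L : ℂˣ) (x : Fin (X.dim n) → ℂˣ) :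
    Fin 3 → ℂˣ :=
  cellPoint X.pathD X.pathF L (coord x 0) (coord x 1) (pairProd X n x) (pathSum X n L x)
    (pairSum X n x)

/-- A semi-invariant of the actions `e₀` and `e₁`. -/
noncomputable def midFactor (X : AffineType) (n : ℕ) (x : Fin (X.dim n) → ℂˣ) : ℂˣ :=
  coord x 1 * midProd X n x / pairSum X n x

theorem toCell_pos (hL : 0 < (L : ℂ)) (hx : PosPt x) : PosPt (toCell X n L x) :=
  cellPoint_pos hL (coord_pos hx 0) (coord_pos hx 1) (pairProd_pos hx) (pathSum_pos hL hx)
    (pairSum_pos hx)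

/-! The action `e₁`. -/

/-- The factor by which `e₁` multiplies the first coordinate on the cell. -/
noncomputable def cellFactor (X : AffineType) (n : ℕ) (L c : ℂˣ) (x : Fin (X.dim n) → ℂˣ) : ℂˣ :=
  unitOf ((c * (L ^ X.pathD * pairProd X n x) + coord x 0 ^ X.pathD) / pathSum X n L x)

theorem coe_cellFactor (hL : 0 < (L : ℂ)) {c : ℂˣ} (hc : 0 < (c : ℂ)) (hx : PosPt x) :
    (cellFactor X n L c x : ℂ) =
      (c * (L ^ X.pathD * pairProd X n x) + coord x 0 ^ X.pathD) / pathSum X n L x := by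
  have h0 := coord_pos hx 0
  have h1 := pairProd_pos hx
  have h2 := pathSum_pos hL hx
  refine coe_unitOf (ne_of_gt ?_)
  positivity

theorem coord_zero_e_one (hn : X.minRank ≤ n) (hX : X.IsPath) {c : ℂˣ} (hc : 0 < (c : ℂ))
    (hx : PosPt x) : coord ((V X n L).e 1 c x) 0 = coord x 0 := by
  have hd := firstPlace_lt hn (Or.inr hX)
  have h1 := hX.firstPlace_eq
  rw [V_e (one_ne_zero_fin hn), coord_eq _ (show 0 < X.dim n by omega),
    coord_eq _ (show 0 < X.dim n by omega), e_one_eq hn (Or.inr hX) hc hx]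
  simp only
  rw [if_neg (by omega), if_neg (by omega), mul_one]

theorem coord_one_e_one (hn : X.minRank ≤ n) (hX : X.IsPath) {c : ℂˣ} (hc : 0 < (c : ℂ))
    (hx : PosPt x) : coord ((V X n L).e 1 c x) 1 = coord x 1 * firstFactor X n c x := by
  rw [V_e (one_ne_zero_fin hn)]
  have := coord_first_e_one hn (Or.inr hX) hc hx
  rwa [hX.firstPlace_eq] at this

theorem pairProd_V_e_one (hn : X.minRank ≤ n) (hX : X.IsPath) {c : ℂˣ} (hc : 0 < (c : ℂ))
    (hx : PosPt x) : pairProd X n ((V X n L).e 1 c x) = pairProd X n x * c := by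
  rw [V_e (one_ne_zero_fin hn), pairProd_e_one hn (Or.inr hX) hc hx]

theorem midProd_V_e_one (hn : X.minRank ≤ n) (hX : X.IsPath) {c : ℂˣ} (hc : 0 < (c : ℂ))
    (hx : PosPt x) : midProd X n ((V X n L).e 1 c x) = midProd X n x := by
  rw [V_e (one_ne_zero_fin hn), midProd_e_one hn (Or.inr hX) hc hx]

theorem pathSum_e_one (hn : X.minRank ≤ n) (hX : X.IsPath) (hL : 0 < (L : ℂ)) {c : ℂˣ}
    (hc : 0 < (c : ℂ)) (hx : PosPt x) : pathSum X n L ((V X n L).e 1 c x) =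
      pathSum X n L x * cellFactor X n L c x := by
  refine Units.ext ?_
  rw [coe_pathSum hL ((isPositive_V hn hL).e_pos 1 hc hx), Units.val_mul, coe_cellFactor hL hc hx,
    coord_zero_e_one hn hX hc hx, pairProd_V_e_one hn hX hc hx, mul_div_cancel₀ _ (Units.ne_zero _)]
  push_cast
  ring

theorem pairSum_e_one (hn : X.minRank ≤ n) (hX : X.IsPath) (hL : 0 < (L : ℂ)) {c : ℂˣ}
    (hc : 0 < (c : ℂ)) (hx : PosPt x) : pairSum X n ((V X n L).e 1 c x) =
      pairSum X n x * firstFactor X n c x := by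
  refine Units.ext ?_
  rw [coe_pairSum ((isPositive_V hn hL).e_pos 1 hc hx), Units.val_mul, coe_firstFactor hc hx,
    midProd_V_e_one hn hX hc hx, pairProd_V_e_one hn hX hc hx, ← coe_pairSum hx,
    mul_div_cancel₀ _ (Units.ne_zero _)]
  push_cast
  ring

theorem toCell_e_one (hn : X.minRank ≤ n) (hX : X.IsPath) (hL : 0 < (L : ℂ)) {c : ℂˣ}
    (hc : 0 < (c : ℂ)) (hx : PosPt x) : toCell X n L ((V X n L).e 1 c x) =
      ![toCell X n L x 0 * cellFactor X n L c x, toCell X n L x 1,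
        toCell X n L x 2 * (c / cellFactor X n L c x)] := by
  rw [toCell, coord_zero_e_one hn hX hc hx, coord_one_e_one hn hX hc hx,
    pairProd_V_e_one hn hX hc hx, pathSum_e_one hn hX hL hc hx, pairSum_e_one hn hX hL hc hx,
    cellPoint_e_one]
  rfl

theorem midFactor_e_one (hn : X.minRank ≤ n) (hX : X.IsPath) (hL : 0 < (L : ℂ)) {c : ℂˣ}
    (hc : 0 < (c : ℂ)) (hx : PosPt x) :
    midFactor X n ((V X n L).e 1 c x) = midFactor X n x := by
  rw [midFactor, coord_one_e_one hn hX hc hx, midProd_V_e_one hn hX hc hx,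
    pairSum_e_one hn hX hL hc hx, mul_right_comm, mul_div_mul_right_eq_div, midFactor]

/-! The action `e₀`. -/

theorem coord_zero_e_zero (hn : X.minRank ≤ n) (hX : X.IsPath) (c : ℂˣ) :
    coord ((V X n L).e 0 c x) 0 = coord x 0 * (c * ratio X n L c x ^ X.pathF) := by
  have hd := dim_pos hn
  rw [e_zero_path hn hX, coord_scale _ _ (by omega), if_pos rfl, hX.weight_zero hn]

theorem coord_one_e_zero (hn : X.minRank ≤ n) (hX : X.IsPath) (c : ℂˣ) :
    coord ((V X n L).e 0 c x) 1 = coord x 1 * ratio X n L c x := by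
  have hd := dim_pos hn
  have hw := weight_firstPlace hn (Or.inr hX)
  rw [hX.firstPlace_eq] at hw
  rw [e_zero_path hn hX, coord_scale _ _ (by omega), if_neg one_ne_zero, hw, one_mul, pow_one]

theorem pairProd_V_e_zero (hn : X.minRank ≤ n) (hX : X.IsPath) (c : ℂˣ) :
    pairProd X n ((V X n L).e 0 c x) = pairProd X n x * ratio X n L c x ^ 2 := by
  rw [e_zero_path hn hX, pairProd_scale hn (Or.inr hX) (Or.inr hX)]

theorem midProd_V_e_zero (hn : X.minRank ≤ n) (hX : X.IsPath) (c : ℂˣ) :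
    midProd X n ((V X n L).e 0 c x) = midProd X n x * ratio X n L c x ^ 2 := by
  rw [e_zero_path hn hX, midProd_scale hn (Or.inr hX) (Or.inr hX)]

/-- Let `ρ` be the ratio and `a` the sum. As `d f = 2`, `x₀^d` gains the factor `c^d ρ²` and `q`
gains `ρ²`, and `c^d x₀^d + L^d q = ρ c^d a` by the definition of `ρ`. -/
theorem pathSum_e_zero (hn : X.minRank ≤ n) (hX : X.IsPath) (hL : 0 < (L : ℂ)) {c : ℂˣ}
    (hc : 0 < (c : ℂ)) (hx : PosPt x) : pathSum X n L ((V X n L).e 0 c x) =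
      pathSum X n L x * (ratio X n L c x ^ 3 * c ^ X.pathD) := by
  have h2 := (pathSum_pos (X := X) hL hx).ne'
  have h3 := coe_ratio hX hL hc hx
  have h4 : (pathSum X n L x : ℂ) * (ratio X n L c x * c ^ X.pathD) =
      c ^ X.pathD * coord x 0 ^ X.pathD + L ^ X.pathD * pairProd X n x := by
    rw [h3]
    field_simp
  refine Units.ext ?_
  rw [coe_pathSum hL ((isPositive_V hn hL).e_pos 0 hc hx), coord_zero_e_zero hn hX,
    pairProd_V_e_zero hn hX]
  push_cast
  have h5 : ((coord x 0 : ℂ) * (c * (ratio X n L c x : ℂ) ^ X.pathF)) ^ X.pathD =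
      coord x 0 ^ X.pathD * c ^ X.pathD * (ratio X n L c x : ℂ) ^ 2 := by
    rcases pathD_pathF X with ⟨h, h'⟩ | ⟨h, h'⟩ <;> rw [h, h'] <;> ring
  rw [h5]
  linear_combination (-(ratio X n L c x : ℂ) ^ 2) * h4

theorem pairSum_e_zero (hn : X.minRank ≤ n) (hX : X.IsPath) (hL : 0 < (L : ℂ)) {c : ℂˣ}
    (hc : 0 < (c : ℂ)) (hx : PosPt x) : pairSum X n ((V X n L).e 0 c x) =
      pairSum X n x * ratio X n L c x ^ 2 := by
  refine Units.ext ?_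
  rw [coe_pairSum ((isPositive_V hn hL).e_pos 0 hc hx), Units.val_mul, coe_pairSum hx,
    midProd_V_e_zero hn hX, pairProd_V_e_zero hn hX, Units.val_mul, Units.val_mul, add_mul]

theorem toCell_e_zero (hn : X.minRank ≤ n) (hX : X.IsPath) (hL : 0 < (L : ℂ)) {c : ℂˣ}
    (hc : 0 < (c : ℂ)) (hx : PosPt x) : toCell X n L ((V X n L).e 0 c x) =
      ![toCell X n L x 0, toCell X n L x 1 * c, toCell X n L x 2] := by
  rw [toCell, coord_zero_e_zero hn hX, coord_one_e_zero hn hX, pairProd_V_e_zero hn hX,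
    pathSum_e_zero hn hX hL hc hx, pairSum_e_zero hn hX hL hc hx,
    cellPoint_e_zero (pathD_pathF X)]
  rfl

theorem midFactor_e_zero (hn : X.minRank ≤ n) (hX : X.IsPath) (hL : 0 < (L : ℂ)) {c : ℂˣ}
    (hc : 0 < (c : ℂ)) (hx : PosPt x) :
    midFactor X n ((V X n L).e 0 c x) = midFactor X n x * ratio X n L c x := by
  rw [midFactor, coord_one_e_zero hn hX, midProd_V_e_zero hn hX, pairSum_e_zero hn hX hL hc hx,
    midFactor]
  refine Units.ext ?_
  push_cast
  field_simp

end Values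

end AffineType

/-! ### Invariants of `e₀` and `e₁`, and the pairs `(0, j)` for the path types. -/

namespace AffineType

open CrystalData

variable {X : AffineType} {n : ℕ} {L : ℂˣ} {i j : Fin (n + 1)}

/-- The geometric crystal on the cell of the word `(1, 0, 1)`. -/
noncomputable abbrev cell (X : AffineType) (n : ℕ) : CrystalData (Fin (n + 1)) (Fin 3) :=
  schubert (X.cartan n) ![1, 0, 1] 1

section Cell

variable {x : Fin (X.dim n) → ℂˣ}

theorem cell_terms (hn : X.minRank ≤ n) (hX : X.IsPath) :
    (schubertTerm (X.cartan n) ![1, 0, 1] 1 (toCell X n L x) 2 : ℂ) =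
      coord x 0 ^ X.pathD / (L ^ X.pathD * pairProd X n x) * (toCell X n L x 0 : ℂ)⁻¹ := by
  rw [schubertTerm_two_of_three, toCell, ← cellPoint_term (pathD_pathF X)]
  simp only [Matrix.cons_val_zero, Matrix.cons_val_one, cartan_self, (cartan_path hn hX).1,
    zpow_neg, zpow_natCast]
  generalize cellPoint _ _ _ _ _ _ _ _ = w
  have e : (w 0 : ℂ) ^ (2 : ℤ) = (w 0 : ℂ) ^ 2 := zpow_ofNat _ 2
  rw [e]
  field_simp

theorem cell_e_one (hn : X.minRank ≤ n) (hX : X.IsPath) (hL : 0 < (L : ℂ)) {c : ℂˣ}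
    (hc : 0 < (c : ℂ)) (hx : PosPt x) : (cell X n).e 1 c (toCell X n L x) =
      ![toCell X n L x 0 * cellFactor X n L c x, toCell X n L x 1,
        toCell X n L x 2 * (c / cellFactor X n L c x)] := by
  have h0 := coord_pos hx 0
  have h1 := pairProd_pos hx
  funext r
  have h := schubertE_pair (A := X.cartan n) (word_pair (one_ne_zero_fin hn))
    (show (0 : Fin 3) < 2 by decide) hc (toCell_pos hL hx) (k := cellFactor X n L c x) (by
      rw [coe_cellFactor hL hc hx, cell_terms hn hX, schubertTerm_zero_of_three,
        coe_pathSum hL hx]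
      have h2 : (coord x 0 ^ X.pathD + L ^ X.pathD * pairProd X n x : ℂ) ≠ 0 := by positivity
      have h3 : (L ^ X.pathD * pairProd X n x + coord x 0 ^ X.pathD : ℂ) ≠ 0 := by positivity
      field_simp
      rw [add_comm (coord x 0 ^ X.pathD : ℂ)]) r
  rw [show (cell X n).e 1 c (toCell X n L x) r = _ from h]
  fin_cases r <;> simp

theorem cell_e_zero (hn : X.minRank ≤ n) (c : ℂˣ) : (cell X n).e 0 c (toCell X n L x) =
    ![toCell X n L x 0, toCell X n L x 1 * c, toCell X n L x 2] := by
  funext r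
  rw [show (cell X n).e 0 c (toCell X n L x) r = _ from
    schubertE_single (word_single (one_ne_zero_fin hn)) c _ r]
  fin_cases r <;> simp

theorem cell_ε_one (hn : X.minRank ≤ n) (hX : X.IsPath) (hL : 0 < (L : ℂ)) (hx : PosPt x) :
    (cell X n).ε 1 (toCell X n L x) = (V X n L).ε 1 x := by
  rw [show (cell X n).ε 1 (toCell X n L x) = _ from
    schubertε_pair (word_pair (one_ne_zero_fin hn)) (show (0 : Fin 3) < 2 by decide) _,
    cell_terms hn hX, schubertTerm_zero_of_three, ε_one_path hn hX hx]
  simp only [toCell, cellPoint, Matrix.cons_val_zero]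
  have h2 := (pathSum X n L x).ne_zero
  rw [coe_pathSum hL hx] at h2
  push_cast
  rw [coe_pathSum hL hx]
  field_simp
  rw [add_comm]

theorem cell_ε_zero (hn : X.minRank ≤ n) (hX : X.IsPath) (hL : 0 < (L : ℂ)) (hx : PosPt x) :
    (cell X n).ε 0 (toCell X n L x) = (V X n L).ε 0 x := by
  rw [show (cell X n).ε 0 (toCell X n L x) = _ from
    schubertε_single (word_single (one_ne_zero_fin hn)) _, schubertTerm_one_of_three,
    ε_zero_path hX hL hx, ← cellPoint_ε_zero (pathD_pathF X)]
  simp only [Matrix.cons_val_zero, (cartan_path hn hX).2, zpow_neg, zpow_natCast, toCell]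
  field_simp

theorem cell_γ_e_one (hn : X.minRank ≤ n) (hX : X.IsPath) (hL : 0 < (L : ℂ)) {c : ℂˣ}
    (hc : 0 < (c : ℂ)) (hx : PosPt x) : (cell X n).γ i (toCell X n L ((V X n L).e 1 c x)) =
      (c : ℂ) ^ X.cartan n 1 i * (cell X n).γ i (toCell X n L x) := by
  rw [toCell_e_one hn hX hL hc hx]
  simp only [schubert, schubertγ_three, Matrix.cons_val_zero, Matrix.cons_val_one,
    Matrix.cons_val, Units.val_mul, Units.val_div_eq_div_val, mul_zpow,
    div_zpow]
  have := zpow_ne_zero (X.cartan n 1 i) (cellFactor X n L c x).ne_zero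
  field_simp

theorem cell_γ_e_zero (hn : X.minRank ≤ n) (hX : X.IsPath) (hL : 0 < (L : ℂ)) {c : ℂˣ}
    (hc : 0 < (c : ℂ)) (hx : PosPt x) : (cell X n).γ i (toCell X n L ((V X n L).e 0 c x)) =
      (c : ℂ) ^ X.cartan n 0 i * (cell X n).γ i (toCell X n L x) := by
  rw [toCell_e_zero hn hX hL hc hx]
  simp only [schubert, schubertγ_three, Matrix.cons_val_zero, Matrix.cons_val_one,
    Matrix.cons_val, Units.val_mul, mul_zpow]
  ring

theorem γ_e_zero_path (hn : X.minRank ≤ n) (hX : X.IsPath) (c : ℂˣ) :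
    (V X n L).γ i ((V X n L).e 0 c x) = (c : ℂ) ^ X.cartan n 0 i * (V X n L).γ i x := by
  rw [e_zero_path hn hX, V_γ_scale hn, prefixSum_dim_path hn hX (by omega), zpow_zero,
    Units.val_one, mul_one, hX.letter_zero, mul_comm, Units.val_zpow_eq_zpow_val]
  rfl

theorem γ_e_one_path (hn : X.minRank ≤ n) (hL : 0 < (L : ℂ)) {c : ℂˣ} (hc : 0 < (c : ℂ))
    (hx : PosPt x) : (V X n L).γ i ((V X n L).e 1 c x) =
      (c : ℂ) ^ X.cartan n 1 i * (V X n L).γ i x := by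
  by_cases h : 1 = i
  · subst h
    exact (rankOne_V hn hL (one_ne_zero_fin hn)).γ_e c hc x hx
  · exact V_γ_e hn hL (one_ne_zero_fin hn) h hc hx

/-- The coordinates between `x₁` and `x̄₁`, normalized to be invariant under `e₀` and `e₁`. -/
noncomputable def midCoord (X : AffineType) (n : ℕ) (x : Fin (X.dim n) → ℂˣ) :
    Fin (X.dim n) → ℂˣ := fun j =>
  if (j : ℕ) = 0 ∨ (j : ℕ) = 1 ∨ (j : ℕ) = X.dim n - 1 then 1
  else x j / midFactor X n x ^ X.weight n j

/-- The invariants of the actions `e₀` and `e₁`. -/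
noncomputable def pathInvariant (X : AffineType) (n : ℕ) (L : ℂˣ) (x : Fin (X.dim n) → ℂˣ) :
    (Fin (X.dim n) → ℂˣ) × ℂˣ × (Fin (n + 1) → ℂ) :=
  (midCoord X n x, midProd X n x / midFactor X n x ^ 2,
    fun i => (V X n L).γ i x / (cell X n).γ i (toCell X n L x))

theorem cell_γ_ne_zero (y : Fin 3 → ℂˣ) : (cell X n).γ i y ≠ 0 := by
  simp only [schubert, schubertγ]
  exact Units.ne_zero _

theorem pathInvariant_e_one (hn : X.minRank ≤ n) (hX : X.IsPath) (hL : 0 < (L : ℂ)) {c : ℂˣ}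
    (hc : 0 < (c : ℂ)) (hx : PosPt x) :
    pathInvariant X n L ((V X n L).e 1 c x) = pathInvariant X n L x := by
  have hf := hX.firstPlace_eq
  refine Prod.ext (funext fun j => ?_) (Prod.ext ?_ (funext fun i => ?_))
  · simp only [pathInvariant, midCoord]
    split_ifs with h
    · rfl
    · rw [midFactor_e_one hn hX hL hc hx, V_e (one_ne_zero_fin hn), e_one_eq hn (Or.inr hX) hc hx,
        if_neg (by omega), if_neg (by omega), mul_one]
  · simp only [pathInvariant]
    rw [midFactor_e_one hn hX hL hc hx, midProd_V_e_one hn hX hc hx]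
  · simp only [pathInvariant]
    rw [cell_γ_e_one hn hX hL hc hx, γ_e_one_path hn hL hc hx,
      mul_div_mul_left _ _ (zpow_ne_zero _ c.ne_zero)]

theorem pathInvariant_e_zero (hn : X.minRank ≤ n) (hX : X.IsPath) (hL : 0 < (L : ℂ)) {c : ℂˣ}
    (hc : 0 < (c : ℂ)) (hx : PosPt x) :
    pathInvariant X n L ((V X n L).e 0 c x) = pathInvariant X n L x := by
  refine Prod.ext (funext fun j => ?_) (Prod.ext ?_ (funext fun i => ?_))
  · simp only [pathInvariant, midCoord]
    split_ifs with h
    · rfl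
    · rw [midFactor_e_zero hn hX hL hc hx, e_zero_path hn hX, Pi.mul_apply, scale,
        if_neg (by omega), one_mul, mul_pow, mul_div_mul_right_eq_div]
  · simp only [pathInvariant]
    rw [midFactor_e_zero hn hX hL hc hx, midProd_V_e_zero hn hX, mul_pow,
      mul_div_mul_right_eq_div]
  · simp only [pathInvariant]
    rw [cell_γ_e_zero hn hX hL hc hx, γ_e_zero_path hn hX,
      mul_div_mul_left _ _ (zpow_ne_zero _ c.ne_zero)]

/-- The point is reconstructed step by step: `midFactor` from its image in the cell and the
invariant `midProd / midFactor²`, then `midProd`, `x₁ x̄₁`, `x₀`, then `x₁` from `midFactor` and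
`x̄₁` from the product. The remaining coordinates are their normalized values times powers of
`midFactor`. -/
theorem eq_of_pathInvariant (hn : X.minRank ≤ n) (hX : X.IsPath) (hL : 0 < (L : ℂ))
    {x y : Fin (X.dim n) → ℂˣ} (hx : PosPt x) (hy : PosPt y)
    (h : toCell X n L x = toCell X n L y) (h' : pathInvariant X n L x = pathInvariant X n L y) :
    x = y := by
  have hd := firstPlace_lt hn (Or.inr hX)
  have hf := hX.firstPlace_eq
  have hP : midProd X n x / midFactor X n x ^ 2 = midProd X n y / midFactor X n y ^ 2 :=
    congrArg (fun p => p.2.1) h'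
  have hG' : ∀ x, ((midFactor X n x : ℂˣ) : ℂ) = coord x 1 * midProd X n x / pairSum X n x :=
    fun x => by rw [midFactor, Units.val_div_eq_div_val, Units.val_mul]
  have cG : ∀ x, PosPt x → (midFactor X n x : ℂ) =
      (1 + toCell X n L x 0 * toCell X n L x 2 / (toCell X n L x 1 : ℂ) ^ X.pathD) /
        (L ^ X.pathD * ((midProd X n x / midFactor X n x ^ 2 : ℂˣ) : ℂ) * toCell X n L x 0) :=
    fun x hx => by
      have := cellPoint_mid (x1 := coord x 1) (Q := midProd X n x) (s := pairSum X n x)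
        (pathD_pathF X) (coe_pathSum hL hx)
      simp only [← hG'] at this
      rw [Units.val_div_eq_div_val, Units.val_pow_eq_pow_val]
      exact this
  have cr : ∀ x, (pairProd X n x / midProd X n x : ℂ) = L ^ X.pathD *
      ((midProd X n x / midFactor X n x ^ 2 : ℂˣ) : ℂ) * (toCell X n L x 0 * toCell X n L x 2) :=
    fun x => by
      have := cellPoint_quot (d := X.pathD) (f := X.pathF) (L := L) (x0 := coord x 0)
        (x1 := coord x 1) (q := pairProd X n x) (Q := midProd X n x) (a := pathSum X n L x)
        (s := pairSum X n x)
      simp only [← hG'] at this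
      rw [Units.val_div_eq_div_val, Units.val_pow_eq_pow_val]
      exact this
  have c0 : ∀ x, (coord x 0 : ℂ) = L ^ 2 *
      ((midProd X n x / midFactor X n x ^ 2 : ℂˣ) : ℂ) ^ X.pathF * midFactor X n x ^ X.pathF *
        toCell X n L x 1 :=
    fun x => by
      have := cellPoint_zero (d := X.pathD) (f := X.pathF) (L := L) (x0 := coord x 0)
        (x1 := coord x 1) (q := pairProd X n x) (Q := midProd X n x) (a := pathSum X n L x)
        (s := pairSum X n x)
      simp only [← hG'] at this
      rw [Units.val_div_eq_div_val, Units.val_pow_eq_pow_val]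
      exact this
  have hG : midFactor X n x = midFactor X n y := Units.ext (by
    rw [cG x hx, cG y hy, h, hP])
  have hQ : midProd X n x = midProd X n y := by
    rw [hG] at hP
    exact div_left_injective hP
  have hq : pairProd X n x = pairProd X n y := Units.ext (by
    have h1 := cr x
    rw [h, hP, ← cr y, hQ] at h1
    exact (div_left_inj' (Units.ne_zero _)).1 h1)
  have h0 : coord x 0 = coord y 0 := Units.ext (by rw [c0 x, c0 y, h, hP, hG])
  have h1 : coord x 1 = coord y 1 := by
    have hs : pairSum X n x = pairSum X n y := by rw [pairSum, hq, hQ, pairSum]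
    have := hG
    rw [midFactor, midFactor, hs, hQ] at this
    exact mul_left_injective _ (div_left_injective this)
  have hl : coord x (X.dim n - 1) = coord y (X.dim n - 1) := by
    have := hq
    rw [pairProd, pairProd, hf, h1] at this
    exact mul_left_cancel this
  have hv : ∀ x : Fin (X.dim n) → ℂˣ, ∀ j : Fin (X.dim n), x j = coord x j := fun x j =>
    (coord_eq x j.2).symm
  funext j
  by_cases hj : (j : ℕ) = 0 ∨ (j : ℕ) = 1 ∨ (j : ℕ) = X.dim n - 1
  · rw [hv x j, hv y j]
    rcases hj with hj | hj | hj <;> rw [hj] <;> assumption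
  · have h2 : midCoord X n x j = midCoord X n y j := congrFun (congrArg (fun p => p.1) h') j
    rw [midCoord, midCoord, if_neg hj, if_neg hj, hG] at h2
    exact div_left_injective h2

end Cell

theorem unipotentAt_zero_one_path (hn : X.minRank ≤ n) (hX : X.IsPath) (hL : 0 < (L : ℂ)) :
    UnipotentAt (X.cartan n) (V X n L) 0 1 := by
  have h1 := one_ne_zero_fin hn
  have hD := isPositive_V hn hL
  refine UnipotentAt.of_map id (D' := cell X n)
    (unipotentAt_schubert (A := X.cartan n) ![1, 0, 1] 1 h1.symm)
    (fun _ _ _ _ => rfl) (toCell X n L) (fun x hx => toCell_pos hL hx) (pathInvariant X n L)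
    (fun p i => p.2.2 i) (fun x k _ hx => div_ne_zero (hD.γ_pos k x hx).ne' (cell_γ_ne_zero _))
    (fun x y hx hy h h' => eq_of_pathInvariant hn hX hL hx hy h h') ?_ ?_ ?_
    (fun k x _ hx => (mul_div_cancel₀ _ (cell_γ_ne_zero _)).symm)
  · rintro k c x (rfl | rfl) hc hx
    · exact (toCell_e_zero hn hX hL hc hx).trans (cell_e_zero hn c).symm
    · exact (toCell_e_one hn hX hL hc hx).trans (cell_e_one hn hX hL hc hx).symm
  · rintro k c x (rfl | rfl) hc hx
    · exact pathInvariant_e_zero hn hX hL hc hx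
    · exact pathInvariant_e_one hn hX hL hc hx
  · rintro k x (rfl | rfl) hx
    · exact (cell_ε_zero hn hX hL hx).symm
    · exact (cell_ε_one hn hX hL hx).symm

theorem cartan_zero_path (hn : X.minRank ≤ n) (hX : X.IsPath) (i : Fin (n + 1)) (hi : 2 ≤ (i : ℕ)) :
    X.cartan n 0 i = 0 ∧ X.cartan n i 0 = 0 := by
  obtain ⟨i, hi'⟩ := i
  simp only [cartan, Matrix.of_apply, Fin.val_zero]
  simp only at hi
  cases X <;> simp only [IsPath] at hX <;> simp only [minRank] at hn <;>
    simp only [cartanEntry] <;> grind (splits := 30)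

/-- For `j ≥ 2` the action `e_j` does not change `x₀`, `x₁`, `x̄₁`, hence neither `ε₀` nor the
ratio. So `e₀` acts along `e_j` by a fixed scaling, which commutes with `e_j`, and
`unipotentAt_of_commute` applies. -/
theorem unipotentAt_zero_path (hn : X.minRank ≤ n) (hX : X.IsPath) (hL : 0 < (L : ℂ))
    (hj : j ≠ 0) : UnipotentAt (X.cartan n) (V X n L) 0 j := by
  by_cases hj1 : j = 1
  · exact hj1 ▸ unipotentAt_zero_one_path hn hX hL
  have h1 := one_ne_zero_fin hn
  have hX' : X.IsForked ∨ X.IsPath := Or.inr hX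
  have hD := isPositive_V hn hL
  have h0 := (unipotentAt_zero_one_path hn hX hL).rankOne cartan_self
    (rankTwoEntries_cartan hn h1.symm) hD
  have hlt := firstPlace_lt hn hX'
  have hf := hX.firstPlace_eq
  have hj0 : (j : ℕ) ≠ 0 := fun h => hj (Fin.ext h)
  have hj2 : 2 ≤ (j : ℕ) := by
    have : (j : ℕ) ≠ 1 := fun h => hj1 (Fin.ext (h.trans (val_one_fin hn).symm))
    omega
  have hw : ∀ (c : ℂˣ) x, 0 < (c : ℂ) → PosPt x → ∀ r (hr : r < X.dim n),
      X.word n ⟨r, hr⟩ ≠ j → coord ((V X n L).e j c x) r = coord x r := fun c x hc hx r hr h => by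
    rw [coord_eq _ hr, coord_eq _ hr, V_e hj, schubertE_of_ne (exists_word hn hj) hc hx h]
  have w1 : ∀ r (hr : r < X.dim n), r = X.firstPlace ∨ r = X.dim n - 1 → X.word n ⟨r, hr⟩ ≠ j :=
    fun r hr h => by
      rw [(word_eq_one_iff hn hX' ⟨r, hr⟩).2 h]
      exact Ne.symm hj1
  have w0 : X.word n ⟨0, by omega⟩ ≠ j := fun h => hj0 (by
    rw [← h, word_val hn]
    exact hX.letter_zero)
  have e0 : ∀ (c : ℂˣ) x, 0 < (c : ℂ) → PosPt x → coord ((V X n L).e j c x) 0 = coord x 0 :=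
    fun c x hc hx => hw c x hc hx 0 (by omega) w0
  have eq : ∀ (c : ℂˣ) x, 0 < (c : ℂ) → PosPt x →
      pairProd X n ((V X n L).e j c x) = pairProd X n x := fun c x hc hx => by
    rw [pairProd, hw c x hc hx _ (by omega) (w1 _ (by omega) (Or.inl rfl)),
      hw c x hc hx _ (by omega) (w1 _ (by omega) (Or.inr rfl)), pairProd]
  have es : ∀ (c : ℂˣ) x, 0 < (c : ℂ) → PosPt x →
      pathSum X n L ((V X n L).e j c x) = pathSum X n L x := fun c x hc hx => by
    rw [pathSum, e0 c x hc hx, eq c x hc hx, pathSum]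
  have ht : ∀ c s, ∀ r, X.word n r = j →
      schubertTerm (X.cartan n) (X.word n) j (scale X n c s) r = 1 := fun c s r hr =>
    schubertTerm_scale hn hX' hj2 (Or.inr hX) s r hr
  obtain ⟨a0, a1⟩ := cartan_zero_path hn hX j hj2
  refine unipotentAt_of_commute hj.symm hD h0 (rankOne_V hn hL hj) (fun c d hc hd x hx => ?_)
    (fun c hc x hx => ?_) (fun c hc x hx => ?_) (fun c hc x hx => γ_e_zero_path hn hX c)
    fun c hc x hx => V_γ_e hn hL hj hj hc hx
  · have hr : ratio X n L c ((V X n L).e j d x) = ratio X n L c x := Units.ext (by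
      rw [coe_ratio hX hL hc (hD.e_pos j hd hx), e0 d x hd hx, eq d x hd hx, es d x hd hx,
        coe_ratio hX hL hc hx])
    rw [e_zero_path hn hX, e_zero_path hn hX, hr, V_e hj, V_e hj, schubertE_mul (ht _ _)]
  · rw [ε_zero_path hX hL (hD.e_pos j hc hx), e0 c x hc hx, es c x hc hx, ε_zero_path hX hL hx]
  · rw [e_zero_path hn hX, V_ε hj, V_ε hj, schubertε_mul (ht _ _), a0, neg_zero, zpow_zero, one_mul]

theorem hasUnipotentPairs_V (hn : X.minRank ≤ n) (hL : 0 < (L : ℂ)) :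
    HasUnipotentPairs (X.cartan n) (V X n L) := by
  have h0 : ∀ j : Fin (n + 1), j ≠ 0 → UnipotentAt (X.cartan n) (V X n L) 0 j := fun j hj => by
    by_cases hX : X.IsForked
    · exact unipotentAt_zero_forked hn hX hL hj
    by_cases hX' : X.IsPath
    · exact unipotentAt_zero_path hn hX' hL hj
    cases X <;> simp [IsForked, IsPath] at hX hX'
    exact unipotentAt_zero_A1 hn hL hj
  refine hasUnipotentPairs_of_unipotentAt cartan_self fun i j hij => ?_
  by_cases hi : i = 0
  · subst hi
    exact h0 j hij.symm
  by_cases hj : j = 0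
  · subst hj
    exact (h0 i hij).symm
  exact unipotentAt_V hi hj hij

end AffineType

theorem mainTheorem5 (X : AffineType) (n : ℕ) (hn : X.minRank ≤ n) (k : ℕ)
    (L : Fin (k + 1) → ℂˣ) :
    (multiProd (X.V n) k L).IsGeometricCrystal (X.cartan n) := by
  have : Nontrivial (Fin (n + 1)) := ⟨1, 0, AffineType.one_ne_zero_fin hn⟩
  exact CrystalData.multiProd_isGeometricCrystal AffineType.cartan_self
    (fun i j hij => AffineType.rankTwoEntries_cartan hn hij) (X.V n)
    (fun L hL => AffineType.hasUnipotentPairs_V hn hL)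
    (fun L a => AffineType.exists_base hn L a) k L
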